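/- **Setting.** Let $A_x,A_y,A_z$ be the component matrices, in the spin-1 Pauli basis $|x\rangle,|y\rangle,|z\rangle$, of a translation-invariant spin-1 matrix product state (MPS) in canonical form ($\sum_\mu A_\mu A_\mu^\dagger=I$, $\sum_\mu A_\mu^\dagger\Lambda A_\mu=\Lambda$ with $\Lambda>0$, $\operatorname{tr}\Lambda=1$) and with finite correlation length. Here the correlation length of an MPS tensor is $(-\log|\lambda_2/\lambda_1|)^{-1}$ for the two largest eigenvalues (with multiplicity) of its transfer channel $X\mapsto\sum_\mu A_\mu XA_\mu^\dagger$. Let the state be a ground state of the 1D $S_4$ symmetry-protected topologically ordered (SPTO) phase: it is invariant under the on-site rotation group of the octahedron $G\cong S_4$, generated by the $\pi/2$ rotations $r_x,r_z$, i.e. $U_gA_iU_g^\dagger=\sum_j (u_g)_{ji}A_j$ with $u$ the spin-1 representation and $U$ a projective unitary representation, and the cohomology class of $U$ is nontrivial. Then the virtual space is a tensor product (protected qubit) $\otimes$ (junk space), in which $U_g=U_g^{(P)}\otimes U_g^{(J)}$ with $U^{(P)}_g$ the spin-$\frac12$ rotation (up to phase), and $A_\mu=\sigma_\mu\otimes a_\mu$.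 For $\mu\in\{x,z\}$, $\mu$-buffering with $m$ sites replaces $a_\nu$ by $a_\mu^m a_\nu a_\mu^m$. An RG fixed point under $\mu$-buffering is a limit of these tensors as $m\to\infty$ (along a subsequence), up to the choice of a basis of the junk space and rescaled so that the transfer channel $\tilde{\mathcal E}_I$ of $\tilde A_\nu=\sigma_\nu\otimes\tilde a_\nu$ at the limit has spectral radius $1$. The renormalized correlation length $\tilde\xi$ is the correlation length of $\tilde A$. If $\tilde\xi<\infty$, the fixed-point tensor has a canonical form: in a suitable junk basis it is block upper triangular, and one diagonal block, again written $\tilde A_\nu=\sigma_\nu\otimes\tilde a_\nu$, is in canonical form, with left fixed point $\tilde\Lambda_\mu$. With $\tilde a^{(\mu)}$ this block, the renormalized string order parameter is $$\mathcal O^{(\mu)}=\lim_{n\to\infty}\operatorname{tr}\bigl(\tilde\Lambda_\mu\,(\tilde{\mathcal E}_{u_{r_\mu}})^n[I]\bigr),\qquad \tilde{\mathcal E}_{w}(X)=\sum_{\nu,\eta}w_{\nu\eta}\tilde A_\eta X\tilde A_\nu^\dagger ,$$ the expectation value of $u_{r_\mu}^{\otimes n}$ on $n$ consecutive sites of the infinite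 chain, for $n\to\infty$. A rotation $e^{-i\Theta\sigma_z/2}$ is implemented on the $z$-buffered tensor by the measurement outcome $\cos\frac\Theta2|x\rangle-\sin\frac\Theta2|y\rangle$, with byproduct $\sigma_x$, and $e^{-i\Theta\sigma_x/2}$ on the $x$-buffered tensor by $\cos\frac\Theta2|y\rangle-\sin\frac\Theta2|z\rangle$, with byproduct $\sigma_y$. If $K$ is the operator that the outcome induces on the virtual space and $V$ is the byproduct times the rotation, the gate fidelity is $$F=\operatorname{tr}_P\Bigl\{\operatorname{tr}_J\Bigl[\tfrac{K\rho K^\dagger}{\operatorname{tr}K\rho K^\dagger}\Bigr]V\rho^{(P)}V^\dagger\Bigr\},\qquad \rho=\rho^{(P)}\otimes\rho^{(J)},$$ where $\rho^{(J)}$ is any fixed strictly positive density matrix of the junk space of the fixed point. A rotation has perfect fidelity if $F=1$ for all pure $\rho^{(P)}$; a gate $G\in SU(2)$ has perfect fidelity if it is a product of Euler rotations about the $z$, $x$ and $z$ axes that have perfect fidelity. **Theorem.** Consider any such ground state, and RG fixed points under $x$- and $z$-buffering with finite $\tilde\xi$. The limits $\mathcal O^{(x)}$, $\mathcal O^{(z)}$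 exist and are real and at most $\frac12$, and the following are equivalent: 1. all one-qubit gates $G\in SU(2)$ have perfect fidelity; 2. all rotations about the $x$ and the $z$ axis, by any angle, have perfect fidelity; 3. $\mathcal O^{(x)}=\mathcal O^{(z)}=\frac12$. Moreover $\mathcal O^{(z)}=\frac12$ if and only if $\tilde a^{(z)}_x=\tilde a^{(z)}_y$, and $\mathcal O^{(x)}=\frac12$ if and only if $\tilde a^{(x)}_y=\tilde a^{(x)}_z$. -/

import Mathlib

open Matrix Filter Topology
open scoped Kronecker ComplexOrder

noncomputable section

namespace SPTO

/-! ### Matrix product states on spin-1 chains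

The three physical basis vectors `x, y, z` of the spin-1 Pauli basis are indexed by `0, 1, 2 : Fin 3`.
In this basis the spin-1 representation of a rotation is the rotation matrix itself. -/

/-- The Pauli matrices `σ_x, σ_y, σ_z`. -/
def pauli : Fin 3 → Matrix (Fin 2) (Fin 2) ℂ :=
  ![!![0, 1; 1, 0], !![0, -Complex.I; Complex.I, 0], !![1, 0; 0, -1]]

section Tensors

variable {n : Type*} [Fintype n] [DecidableEq n]

/-- The map `E_w (X) = ∑_{ν, η} w_{ν η} A_η X A_ν†` obtained by contracting the physical indices of
`A` and of its conjugate with a one-site operator `w`. -/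
def twistedChannel (w : Matrix (Fin 3) (Fin 3) ℂ) (A : Fin 3 → Matrix n n ℂ) :
    Module.End ℂ (Matrix n n ℂ) where
  toFun X := ∑ ν, ∑ η, w ν η • (A η * X * (A ν)ᴴ)
  map_add' X Y := by
    simp only [Matrix.mul_add, Matrix.add_mul, smul_add, Finset.sum_add_distrib]
  map_smul' c X := by
    simp only [Matrix.mul_smul, Matrix.smul_mul, Finset.smul_sum, RingHom.id_apply, smul_comm c]

/-- The transfer channel `E_I (X) = ∑_μ A_μ X A_μ†`. -/
def channel (A : Fin 3 → Matrix n n ℂ) : Module.End ℂ (Matrix n n ℂ) :=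
  twistedChannel 1 A

/-- Canonical form: `∑ A_μ A_μ† = 1` and `∑ A_μ† Λ A_μ = Λ`, with `Λ` strictly positive of trace one. -/
structure IsCanonical (A : Fin 3 → Matrix n n ℂ) (Λ : Matrix n n ℂ) : Prop where
  right_fixed : ∑ μ, A μ * (A μ)ᴴ = 1
  left_pos : Λ.PosDef
  left_trace : Λ.trace = 1
  left_fixed : ∑ μ, (A μ)ᴴ * Λ * A μ = Λ

/-- The correlation length `(-log |λ₂ / λ₁|)⁻¹` of `A` is finite: the eigenvalues of the transfer
channel, listed with algebraic multiplicity in order of decreasing modulus, satisfy `|λ₂| < |λ₁|`. -/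
def FiniteCorrelationLength (A : Fin 3 → Matrix n n ℂ) : Prop :=
  ∃ l₁ : ℂ, l₁ ≠ 0 ∧ (channel A).charpoly.rootMultiplicity l₁ = 1 ∧
    ∀ l : ℂ, (channel A).charpoly.IsRoot l → l ≠ l₁ → ‖l‖ < ‖l₁‖

end Tensors

/-! ### Octahedral symmetry and its symmetry-protected phase -/

/-- Rotation by `π / 2` about the `x` axis. -/
def rotX : Matrix.SpecialLinearGroup (Fin 3) ℤ :=
  ⟨!![1, 0, 0; 0, 0, -1; 0, 1, 0], by simp [Matrix.det_fin_three]⟩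

/-- Rotation by `π / 2` about the `z` axis. -/
def rotZ : Matrix.SpecialLinearGroup (Fin 3) ℤ :=
  ⟨!![0, -1, 0; 1, 0, 0; 0, 0, 1], by simp [Matrix.det_fin_three]⟩

/-- The rotation group of the octahedron (isomorphic to `S₄`), generated by the `π / 2` rotations
about the `x` and `z` axes. -/
def octahedral : Subgroup (Matrix.SpecialLinearGroup (Fin 3) ℤ) :=
  Subgroup.closure {rotX, rotZ}

/-- The spin-1 representation in the Pauli basis. -/
def spinOne (g : Matrix.SpecialLinearGroup (Fin 3) ℤ) : Matrix (Fin 3) (Fin 3) ℂ :=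
  g.1.map (fun k : ℤ => (k : ℂ))

/-- `A` is a short-range correlated spin-1 matrix product state in canonical form which is invariant
under the on-site octahedral group, acting on the virtual space by the projective unitary
representation `U`, and which lies in the nontrivial symmetry-protected phase. -/
structure IsSPTOState {N : ℕ} (A : Fin 3 → Matrix (Fin N) (Fin N) ℂ)
    (U : octahedral → Matrix.unitaryGroup (Fin N) ℂ) : Prop where
  canonical : ∃ Λ, IsCanonical A Λ
  shortRange : FiniteCorrelationLength A
  /-- `U` is a projective representation. -/
  projective : ∀ g h, ∃ ω : ℂ, ‖ω‖ = 1 ∧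
    (U g).1 * (U h).1 = ω • (U (g * h)).1
  /-- The matrix product state is invariant under the on-site symmetry. -/
  covariant : ∀ g i, (U g).1 * A i * ((U g).1)ᴴ = ∑ j, spinOne g.1 j i • A j
  /-- The class of `U` in the second cohomology group is nontrivial: no choice of phases turns `U`
  into a linear representation. -/
  nontrivial : ¬ ∃ β : octahedral → ℂ, (∀ g, ‖β g‖ = 1) ∧
    ∀ g h, (β g • (U g).1) * (β h • (U h).1) = β (g * h) • (U (g * h)).1

/-! ### Protected space and junk space -/

/-- The tensor `σ_μ ⊗ a_μ` on (protected space) ⊗ (junk space). -/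
def withProtected {D : ℕ} (a : Fin 3 → Matrix (Fin D) (Fin D) ℂ) :
    Fin 3 → Matrix (Fin 2 × Fin D) (Fin 2 × Fin D) ℂ :=
  fun μ => pauli μ ⊗ₖ a μ

/-- `W` identifies the virtual space unitarily with (protected qubit) ⊗ (junk space), in such a way
that each symmetry operation acts as the spin-1/2 rotation of the qubit, tensored with an operation
of the junk space, and the component matrices take the form `σ_μ ⊗ a_μ`. -/
structure IsProtectedJunk {N D : ℕ} (A : Fin 3 → Matrix (Fin N) (Fin N) ℂ)
    (U : octahedral → Matrix.unitaryGroup (Fin N) ℂ) (W : Matrix (Fin 2 × Fin D) (Fin N) ℂ)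
    (a : Fin 3 → Matrix (Fin D) (Fin D) ℂ) : Prop where
  unitary_left : W * Wᴴ = 1
  unitary_right : Wᴴ * W = 1
  components : ∀ μ, W * A μ * Wᴴ = withProtected a μ
  symmetry : ∀ g : octahedral, ∃ (S : Matrix.unitaryGroup (Fin 2) ℂ)
    (V : Matrix.unitaryGroup (Fin D) ℂ),
    (∀ i, S.1 * pauli i * (S.1)ᴴ = ∑ j, spinOne g.1 j i • pauli j) ∧
    W * (U g).1 * Wᴴ = S.1 ⊗ₖ V.1

/-! ### Buffering -/

/-- Junk components of a site with `m` sites on each side measured in the state `κ`. -/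
def buffered {D : ℕ} (a : Fin 3 → Matrix (Fin D) (Fin D) ℂ) (κ : Fin 3) (m : ℕ) (μ : Fin 3) :
    Matrix (Fin D) (Fin D) ℂ :=
  a κ ^ m * a μ * a κ ^ m

/-- `b` is a fixed point of the renormalization by `κ`-buffering: a limit, as the number `m` of
buffering sites goes to infinity (along a subsequence), of the buffered tensors, which are rescaled
so that the transfer channel of the limit has spectral radius one, and which, as tensors of a matrix
product state, are considered up to the choice of a basis of the junk space. -/
def IsRGFixedPoint {D : ℕ} (a : Fin 3 → Matrix (Fin D) (Fin D) ℂ) (κ : Fin 3)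
    (b : Fin 3 → Matrix (Fin D) (Fin D) ℂ) : Prop :=
  spectralRadius ℂ (channel (withProtected b)) = 1 ∧
  ∃ (m : ℕ → ℕ) (r : ℕ → ℝ) (g : ℕ → GL (Fin D) ℂ), StrictMono m ∧ (∀ k, 0 < r k) ∧
    ∀ μ, Tendsto (fun k => (r k : ℂ) • ((g k).1 * buffered a κ (m k) μ * ((g k)⁻¹).1))
      atTop (𝓝 (b μ))

/-- `c` is the canonical form of `b`, with left fixed point `Λ`: in a suitable basis of the junk
space, `b` is block upper triangular with `c` as a diagonal block, and `σ_μ ⊗ c_μ` is in canonical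
form. (If `b` has unit spectral radius and finite correlation length, exactly one irreducible block
has spectral radius one; the other ones do not contribute in the thermodynamic limit.) -/
def IsCanonicalFormOf {D d : ℕ} (b : Fin 3 → Matrix (Fin D) (Fin D) ℂ)
    (c : Fin 3 → Matrix (Fin d) (Fin d) ℂ)
    (Λ : Matrix (Fin 2 × Fin d) (Fin 2 × Fin d) ℂ) : Prop :=
  IsCanonical (withProtected c) Λ ∧
  ∃ (p q : ℕ) (e : Fin D ≃ Fin p ⊕ (Fin d ⊕ Fin q)) (g : GL (Fin D) ℂ), ∀ μ,
    ∃ (s : Matrix (Fin p) (Fin p) ℂ) (t : Matrix (Fin p) (Fin d ⊕ Fin q) ℂ)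
      (v : Matrix (Fin d) (Fin q) ℂ) (w : Matrix (Fin q) (Fin q) ℂ),
      Matrix.reindex e e (g.1 * b μ * (g⁻¹).1) =
        Matrix.fromBlocks s t 0 (Matrix.fromBlocks (c μ) v 0 w)

/-! ### String order -/

/-- Expectation value of `w ⊗ ⋯ ⊗ w` on `n` consecutive sites of the infinite chain described by the
canonical tensor `C` with left fixed point `Λ`. -/
def stringExpectation {ι : Type*} [Fintype ι] [DecidableEq ι] (C : Fin 3 → Matrix ι ι ℂ)
    (Λ : Matrix ι ι ℂ) (w : Matrix (Fin 3) (Fin 3) ℂ) (n : ℕ) : ℂ :=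
  (Λ * ((twistedChannel w C) ^ n) 1).trace

/-- `o` is the string order parameter of the canonical tensor `σ_μ ⊗ c_μ` for the rotation `g`. -/
def HasStringOrder {d : ℕ} (c : Fin 3 → Matrix (Fin d) (Fin d) ℂ)
    (Λ : Matrix (Fin 2 × Fin d) (Fin 2 × Fin d) ℂ)
    (g : Matrix.SpecialLinearGroup (Fin 3) ℤ) (o : ℝ) : Prop :=
  Tendsto (stringExpectation (withProtected c) Λ (spinOne g)) atTop (𝓝 (o : ℂ))

/-! ### Gate fidelity -/

/-- The rotation `exp (-i Θ σ_κ / 2)`. -/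
def qubitRotation (κ : Fin 3) (Θ : ℝ) : Matrix (Fin 2) (Fin 2) ℂ :=
  (Real.cos (Θ / 2) : ℂ) • (1 : Matrix (Fin 2) (Fin 2) ℂ) -
    (Complex.I * (Real.sin (Θ / 2) : ℂ)) • pauli κ

/-- The measurement outcome used for a rotation by `Θ` about the axis `κ`:
`cos (Θ/2) |x⟩ - sin (Θ/2) |y⟩` for `κ = z`, and its cyclic permutations
(`cos (Θ/2) |y⟩ - sin (Θ/2) |z⟩` for `κ = x`). The index arithmetic is modulo three. -/
def outcome (κ : Fin 3) (Θ : ℝ) : Fin 3 → ℂ :=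
  Pi.single (κ + 1) (Real.cos (Θ / 2) : ℂ) - Pi.single (κ + 2) (Real.sin (Θ / 2) : ℂ)

/-- The virtual-space operator `A[ψ] = ∑_μ ψ_μ^* A_μ` induced by the measurement outcome `ψ`. -/
def measured {ι : Type*} (A : Fin 3 → Matrix ι ι ℂ) (ψ : Fin 3 → ℂ) : Matrix ι ι ℂ :=
  ∑ μ, star (ψ μ) • A μ

/-- Partial trace over the junk space. -/
def traceJunk {d : ℕ} (X : Matrix (Fin 2 × Fin d) (Fin 2 × Fin d) ℂ) :
    Matrix (Fin 2) (Fin 2) ℂ :=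
  Matrix.of fun i j => ∑ k, X (i, k) (j, k)

/-- The normalized post-measurement state `K ρ K† / tr (K ρ K†)`. -/
def postMeasurement {ι : Type*} [Fintype ι] (K ρ : Matrix ι ι ℂ) : Matrix ι ι ℂ :=
  ((K * ρ * Kᴴ).trace)⁻¹ • (K * ρ * Kᴴ)

/-- Gate fidelity `tr (tr_J (𝒟 ρ) · V ρ_P V†)`, `ρ = ρ_P ⊗ ρ_J`, of the rotation by `Θ` about the
axis `κ`, where `V` is the rotation followed by its Pauli byproduct `σ_{κ+1}`
(`σ_x` for `κ = z`, `σ_y` for `κ = x`). -/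
def gateFidelity {d : ℕ} (c : Fin 3 → Matrix (Fin d) (Fin d) ℂ) (ρJ : Matrix (Fin d) (Fin d) ℂ)
    (κ : Fin 3) (Θ : ℝ) (ρP : Matrix (Fin 2) (Fin 2) ℂ) : ℂ :=
  let V := pauli (κ + 1) * qubitRotation κ Θ
  (traceJunk (postMeasurement (measured (withProtected c) (outcome κ Θ)) (ρP ⊗ₖ ρJ)) *
    (V * ρP * Vᴴ)).trace

/-- The rotation by `Θ` about the axis `κ` has fidelity one on every pure state of the qubit. -/
def PerfectRotation {d : ℕ} (c : Fin 3 → Matrix (Fin d) (Fin d) ℂ)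
    (ρJ : Matrix (Fin d) (Fin d) ℂ) (κ : Fin 3) (Θ : ℝ) : Prop :=
  ∀ v : Fin 2 → ℂ, star v ⬝ᵥ v = 1 →
    gateFidelity c ρJ κ Θ (Matrix.vecMulVec v (star v)) = 1

/-- Every one-qubit gate has perfect fidelity: it is a product of three Euler rotations about the
`z`, `x` and `z` axes, each of which has perfect fidelity when implemented with the `z`-buffered
tensor `cz` or the `x`-buffered tensor `cx`, respectively. -/
def PerfectGates {dx dz : ℕ} (cx : Fin 3 → Matrix (Fin dx) (Fin dx) ℂ)
    (ρx : Matrix (Fin dx) (Fin dx) ℂ) (cz : Fin 3 → Matrix (Fin dz) (Fin dz) ℂ)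
    (ρz : Matrix (Fin dz) (Fin dz) ℂ) : Prop :=
  ∀ G ∈ Matrix.specialUnitaryGroup (Fin 2) ℂ, ∃ α β γ : ℝ,
    G = qubitRotation 2 α * qubitRotation 0 β * qubitRotation 2 γ ∧
    PerfectRotation cz ρz 2 α ∧ PerfectRotation cx ρx 0 β ∧ PerfectRotation cz ρz 2 γ

end SPTO

end

noncomputable section

namespace SPTO

set_option linter.unusedSectionVars false

/-! ### Iterates of a linear map with a simple dominant eigenvalue -/

/-! Both the fidelity and the string order detect whether the two junk components transverse to the
buffered axis `κ` of the canonical fixed point `c` agree.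

Fidelity. Undoing the byproduct and the rotation, the measured operator is `1 ⊗ (cos² c_{κ+1} + sin²
c_{κ+2}) + i cos sin σ_κ ⊗ (c_{κ+1} - c_{κ+2})`. If the two components agree, the qubit decouples
from the junk space (`perfectRotation_of_eq`). Otherwise, for `cos sin ≠ 0`, an eigenvector of
`σ_{κ+1}` is partly flipped by `σ_κ` into the orthogonal state, which costs fidelity
(`eq_of_perfectRotation`). Euler angles reduce gates to rotations, and one gate whose Euler angles
are always generic gives the converse.

String order. The quarter turn about `κ` exchanges the two transverse axes up to sign. On the junk
space of the original state it is a unitary that permutes the `a_i` and commutes with `a_κ`, so it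
permutes the buffered tensors. The basis changes allowed in the limit may diverge, so this unitary
need not survive; the traces of words do survive and remain invariant. Finite correlation length
makes the iterates of the transfer channel converge to a rank-one projection. The triangular blocks
other than `c` then contribute traces of words whose squares sum to a null sequence, so the overlap
of `c` with its permuted copy tends to one. Cauchy-Schwarz rigidity turns this into a unitary `V`
with `c_{s i} V = V c_i` (`IsNormal.exists_unitary_of_tendsto`).

With `T` the spin-1/2 quarter turn and `Y = T ⊗ V`, the twisted channel is `X ↦ Y E(Y† X)`. Its
iterates on the identity telescope to `Y Eⁿ(Y†)`, so the string order is `|tr ΛY|² = |tr lV|² / 2`,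
where `l` is the left fixed point on the junk space. It is at most `1/2`, with equality exactly for
scalar `V`, which is equivalent to `c_{κ+1} = c_{κ+2}`.

Existence of the protected qubit. If the lifts of the half turns about `x` and `z` commuted, phases
could be chosen to satisfy a presentation of the octahedral group and `U` would be linearizable. In
the nontrivial class they therefore anticommute and generate Pauli matrices. Each `A_i` times the
corresponding Pauli operator commutes with all of them, which gives `A_i = σ_i ⊗ a_i`. -/

theorem tendsto_zero_of_affine_recursion {α : ℂ} (hα : ‖α‖ < 1) {x u : ℕ → ℂ}
    (hx : ∀ n, x (n + 1) = α * x n + u n) (hu : Tendsto u atTop (𝓝 0)) :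
    Tendsto x atTop (𝓝 0) := by
  rw [Metric.tendsto_atTop]
  intro ε hε
  have hb : 0 < 1 - ‖α‖ := by linarith
  obtain ⟨M, hM⟩ := Metric.tendsto_atTop.1 hu (ε / 2 * (1 - ‖α‖)) (by positivity)
  have key : ∀ k, ‖x (M + k)‖ ≤ ‖α‖ ^ k * ‖x M‖ + ε / 2 := by
    intro k
    induction k with
    | zero => simp; positivity
    | succ k ih =>
      have h1 : ‖u (M + k)‖ ≤ ε / 2 * (1 - ‖α‖) := by
        have := hM (M + k) (by omega)
        rw [dist_zero_right] at this
        exact this.le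
      calc ‖x (M + (k + 1))‖ = ‖α * x (M + k) + u (M + k)‖ := by rw [← hx]; rfl
        _ ≤ ‖α‖ * ‖x (M + k)‖ + ‖u (M + k)‖ := by
          rw [← norm_mul]; exact norm_add_le _ _
        _ ≤ ‖α‖ * (‖α‖ ^ k * ‖x M‖ + ε / 2) + ε / 2 * (1 - ‖α‖) := by gcongr
        _ = _ := by ring
  have hp : Tendsto (fun k => ‖α‖ ^ k * ‖x M‖) atTop (𝓝 0) := by
    simpa using (tendsto_pow_atTop_nhds_zero_of_lt_one (norm_nonneg α) hα).mul_const ‖x M‖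
  obtain ⟨K, hK⟩ := Metric.tendsto_atTop.1 hp (ε / 2) (by positivity)
  refine ⟨M + K, fun n hn => ?_⟩
  obtain ⟨k, rfl⟩ := Nat.exists_eq_add_of_le (show M ≤ n by omega)
  have h2 := hK k (by omega)
  rw [dist_zero_right, Real.norm_of_nonneg (by positivity)] at h2
  rw [dist_zero_right]
  linarith [key k]

open Polynomial in
-- Induction on the roots: for a factor `X - α`, the numbers `φ (Tⁿ v)` obey an affine recursion of
-- ratio `α` driven by the same sequence for `T v - α v`, which tends to zero by induction. Neither
-- a Jordan form nor a norm on `V` is needed.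
theorem tendsto_pow_zero_of_roots {V : Type*} [AddCommGroup V] [Module ℂ V]
    (T : Module.End ℂ V) (s : Multiset ℂ) (hs : ∀ α ∈ s, ‖α‖ < 1) :
    ∀ v, aeval T (s.map (fun α => X - C α)).prod v = 0 → ∀ φ : Module.Dual ℂ V,
      Tendsto (fun n : ℕ => φ ((T ^ n) v)) atTop (𝓝 0) := by
  induction s using Multiset.induction_on with
  | empty =>
    intro v hv φ
    have : v = 0 := by simpa using hv
    simp [this]
  | cons α s ih =>
    intro v hv φ
    have h1 := ih (fun β hβ => hs β (Multiset.mem_cons_of_mem hβ)) (T v - α • v) (by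
      rw [Multiset.map_cons, Multiset.prod_cons, mul_comm, map_mul] at hv
      simpa [Algebra.algebraMap_eq_smul_one] using hv) φ
    refine tendsto_zero_of_affine_recursion (hs α (Multiset.mem_cons_self _ _)) (fun n => ?_) h1
    rw [map_sub (T ^ n), map_smul (T ^ n), map_sub, map_smul, pow_succ, Module.End.mul_apply,
      smul_eq_mul]
    ring

open Polynomial in
-- Since `l` is a simple root, `X - l` is coprime to the product `q` of the other factors. Bézout
-- splits `v` into an eigenvector part `u` and a part `w` killed by `q`, all of whose roots lie
-- inside the unit disc.
theorem exists_pow_limit_of_simple_root {V : Type*} [AddCommGroup V] [Module ℂ V]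
    [Module.Finite ℂ V] (T : Module.End ℂ V) (l : ℂ) (hl : ‖l‖ = 1)
    (hm : T.charpoly.rootMultiplicity l = 1)
    (ho : ∀ m : ℂ, T.charpoly.IsRoot m → m ≠ l → ‖m‖ < 1) (v : V) :
    ∃ u, T u = l • u ∧ ∀ φ : Module.Dual ℂ V,
      Tendsto (fun n : ℕ => (l⁻¹) ^ n * φ ((T ^ n) v)) atTop (𝓝 (φ u)) := by
  have hl0 : l ≠ 0 := by rintro rfl; simp at hl
  have hmon := T.charpoly_monic
  have hlr : l ∈ T.charpoly.roots := by
    rw [← Multiset.count_pos, count_roots, hm]; exact one_pos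
  obtain ⟨s, hs⟩ := Multiset.exists_cons_of_mem hlr
  have hls : l ∉ s := by
    rw [← Multiset.count_eq_zero]
    have : Multiset.count l T.charpoly.roots = 1 := by rw [count_roots, hm]
    rw [hs, Multiset.count_cons_self] at this
    omega
  set q : ℂ[X] := (s.map (fun α => X - C α)).prod with hq
  have hfac : T.charpoly = (X - C l) * q := by
    have := (IsAlgClosed.splits T.charpoly).eq_prod_roots_of_monic hmon
    rw [hs, Multiset.map_cons, Multiset.prod_cons] at this
    exact this
  have hsr : ∀ α ∈ s, ‖α‖ < 1 := by
    intro α hα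
    refine ho α ?_ (fun h => hls (h ▸ hα))
    have : α ∈ T.charpoly.roots := by rw [hs]; exact Multiset.mem_cons_of_mem hα
    exact (mem_roots'.1 this).2
  have hcop : IsCoprime (X - C l) q := by
    rw [(irreducible_X_sub_C l).coprime_iff_not_dvd, dvd_iff_isRoot, IsRoot.def, hq,
      eval_multiset_prod]
    intro h
    rw [Multiset.prod_eq_zero_iff, Multiset.map_map, Multiset.mem_map] at h
    obtain ⟨α, hα, h⟩ := h
    simp only [Function.comp, eval_sub, eval_X, eval_C, sub_eq_zero] at h
    exact hls (h ▸ hα)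
  obtain ⟨a, b, hab⟩ := hcop
  set u := aeval T (b * q) v
  set w := aeval T (a * (X - C l)) v
  have hv : v = u + w := by
    have : aeval T (a * (X - C l) + b * q) v = v := by rw [hab]; simp
    rw [map_add, LinearMap.add_apply] at this
    rw [add_comm]; exact this.symm
  have hch : ∀ p : ℂ[X], aeval T (p * ((X - C l) * q)) v = 0 := by
    intro p
    rw [← hfac, map_mul, T.aeval_self_charpoly]; simp
  have hu : T u = l • u := by
    have h1 := hch b
    rw [show b * ((X - C l) * q) = (X - C l) * (b * q) by ring, map_mul,
      Module.End.mul_apply] at h1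
    simpa [u, sub_eq_zero, Algebra.algebraMap_eq_smul_one] using h1
  have hw : aeval T q w = 0 := by
    have h1 := hch a
    rwa [show a * ((X - C l) * q) = q * (a * (X - C l)) by ring, map_mul,
      Module.End.mul_apply] at h1
  have hTu : ∀ n : ℕ, (T ^ n) u = l ^ n • u := by
    intro n
    induction n with
    | zero => simp
    | succ n ih => rw [pow_succ', Module.End.mul_apply, ih, map_smul, hu, smul_smul, pow_succ]
  refine ⟨u, hu, fun φ => ?_⟩
  have h0 : Tendsto (fun n : ℕ => (l⁻¹) ^ n * φ ((T ^ n) w)) atTop (𝓝 0) := by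
    have := tendsto_pow_zero_of_roots T s hsr w hw φ
    rw [tendsto_zero_iff_norm_tendsto_zero] at this ⊢
    simpa [hl] using this
  have : ∀ n : ℕ, (l⁻¹) ^ n * φ ((T ^ n) v) = φ u + (l⁻¹) ^ n * φ ((T ^ n) w) := by
    intro n
    rw [hv, map_add, map_add, hTu, map_smul, smul_eq_mul, mul_add, ← mul_assoc, ← mul_pow,
      inv_mul_cancel₀ hl0, one_pow, one_mul]
  simp_rw [this]
  simpa using h0.const_add (φ u)

open Polynomial in
-- Contrapositive of the decay lemma applied to the characteristic polynomial, which annihilates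
-- every vector by Cayley-Hamilton.
theorem exists_eigenvalue_of_not_tendsto_zero {V : Type*} [AddCommGroup V] [Module ℂ V]
    [Module.Finite ℂ V] (T : Module.End ℂ V) (v : V) (φ : Module.Dual ℂ V)
    (h : ¬ Tendsto (fun n : ℕ => φ ((T ^ n) v)) atTop (𝓝 0)) :
    ∃ μ : ℂ, 1 ≤ ‖μ‖ ∧ ∃ u, u ≠ 0 ∧ T u = μ • u := by
  by_contra! hc
  refine h (tendsto_pow_zero_of_roots T T.charpoly.roots (fun α hα => ?_) v ?_ φ)
  · by_contra! h1
    obtain ⟨u, hu⟩ := ((Module.End.hasEigenvalue_iff_isRoot_charpoly T α).2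
      (mem_roots'.1 hα).2).exists_hasEigenvector
    exact hc α h1 u hu.2 hu.apply_eq_smul
  · rw [← (IsAlgClosed.splits T.charpoly).eq_prod_roots_of_monic T.charpoly_monic,
      T.aeval_self_charpoly]
    rfl

/-- The algebraic multiplicity is the dimension of the generalized eigenspace, which is therefore a
line. -/
theorem exists_generator_of_simple_root {V : Type*} [AddCommGroup V] [Module ℂ V]
    [Module.Finite ℂ V] (T : Module.End ℂ V) (l : ℂ)
    (hm : T.charpoly.rootMultiplicity l = 1) :
    ∃ u, u ≠ 0 ∧ T u = l • u ∧ ∀ v, T v = l • v → ∃ c : ℂ, v = c • u := by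
  have hroot : T.charpoly.IsRoot l := by
    have := (Polynomial.rootMultiplicity_pos T.charpoly_monic.ne_zero).1 (hm ▸ one_pos)
    exact this
  obtain ⟨u, hu⟩ := ((Module.End.hasEigenvalue_iff_isRoot_charpoly T l).2
    hroot).exists_hasEigenvector
  have hd : Module.finrank ℂ (T.maxGenEigenspace l) = 1 := by
    rw [LinearMap.finrank_maxGenEigenspace_eq, hm]
  have hsub : ∀ v, T v = l • v → v ∈ T.maxGenEigenspace l := fun v hv =>
    T.genEigenspace_le_maximal l 1 (Module.End.mem_eigenspace_iff.2 hv)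
  refine ⟨u, hu.2, hu.apply_eq_smul, fun v hv => ?_⟩
  obtain ⟨c, hc⟩ := (finrank_eq_one_iff_of_nonzero' (⟨u, hsub u hu.apply_eq_smul⟩ :
    T.maxGenEigenspace l) (fun h => hu.2 (congrArg Subtype.val h))).1 hd ⟨v, hsub v hv⟩
  exact ⟨c, (congrArg Subtype.val hc).symm⟩

/-! ### Mixed transfer maps and words -/

section Words

variable {m n : Type*} [Fintype m] [DecidableEq m] [Fintype n] [DecidableEq n]

/-- The mixed transfer map `X ↦ ∑_μ A_μ X B_μ†`. -/
def transfer (A : Fin 3 → Matrix m m ℂ) (B : Fin 3 → Matrix n n ℂ) :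
    Module.End ℂ (Matrix m n ℂ) where
  toFun X := ∑ μ, A μ * X * (B μ)ᴴ
  map_add' X Y := by simp only [Matrix.mul_add, Matrix.add_mul, Finset.sum_add_distrib]
  map_smul' c X := by
    simp only [Matrix.mul_smul, Matrix.smul_mul, Finset.smul_sum, RingHom.id_apply]

theorem transfer_apply (A : Fin 3 → Matrix m m ℂ) (B : Fin 3 → Matrix n n ℂ)
    (X : Matrix m n ℂ) : transfer A B X = ∑ μ, A μ * X * (B μ)ᴴ := rfl

theorem twistedChannel_eq_transfer (w : Matrix (Fin 3) (Fin 3) ℂ) (A : Fin 3 → Matrix n n ℂ) :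
    twistedChannel w A = transfer (fun ν => ∑ η, w ν η • A η) A := by
  ext1 X
  simp [twistedChannel, transfer_apply, Finset.sum_mul]

theorem channel_eq_transfer (A : Fin 3 → Matrix n n ℂ) : channel A = transfer A A := by
  rw [channel, twistedChannel_eq_transfer]
  congr 1
  ext1 ν
  simp [Matrix.one_apply]

/-- The product of the components of `A` along a word. -/
def wordProd (A : Fin 3 → Matrix n n ℂ) {k : ℕ} (w : Fin k → Fin 3) : Matrix n n ℂ :=
  (List.ofFn fun i => A (w i)).prod

@[simp] theorem wordProd_zero (A : Fin 3 → Matrix n n ℂ) (w : Fin 0 → Fin 3) :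
    wordProd A w = 1 := by simp [wordProd]

theorem wordProd_cons (A : Fin 3 → Matrix n n ℂ) {k : ℕ} (i : Fin 3) (w : Fin k → Fin 3) :
    wordProd A (Fin.cons i w : Fin (k + 1) → Fin 3) = A i * wordProd A w := by
  simp [wordProd, List.ofFn_succ]

theorem sum_words_succ {M : Type*} [AddCommMonoid M] {k : ℕ} (f : (Fin (k + 1) → Fin 3) → M) :
    ∑ w, f w = ∑ i : Fin 3, ∑ w : Fin k → Fin 3, f (Fin.cons i w) := by
  rw [← (Fin.consEquiv (fun _ : Fin (k + 1) => Fin 3)).sum_comp, Fintype.sum_prod_type]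
  rfl

theorem transfer_pow_apply (A : Fin 3 → Matrix m m ℂ) (B : Fin 3 → Matrix n n ℂ) (k : ℕ)
    (X : Matrix m n ℂ) :
    ((transfer A B) ^ k) X = ∑ w : Fin k → Fin 3, wordProd A w * X * (wordProd B w)ᴴ := by
  induction k with
  | zero => simp
  | succ k ih =>
    rw [pow_succ', Module.End.mul_apply, ih, transfer_apply, sum_words_succ]
    refine Finset.sum_congr rfl fun i _ => ?_
    rw [Matrix.mul_sum, Matrix.sum_mul]
    refine Finset.sum_congr rfl fun w _ => ?_
    simp only [wordProd_cons, Matrix.conjTranspose_mul, Matrix.mul_assoc]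

/-- The trace of a linear map on matrices. -/
def mapTrace (T : Module.End ℂ (Matrix m n ℂ)) : ℂ :=
  ∑ i, ∑ j, T (Matrix.single i j 1) i j

/-- This is the overlap of two periodic matrix product states of length `k`: the map `X ↦ P X Q` has
trace `tr P · tr Q`. It links spectral data of transfer maps to traces of words, which do not depend
on a basis. -/
theorem mapTrace_transfer_pow (A : Fin 3 → Matrix m m ℂ) (B : Fin 3 → Matrix n n ℂ) (k : ℕ) :
    mapTrace ((transfer A B) ^ k) =
      ∑ w : Fin k → Fin 3, (wordProd A w).trace * star (wordProd B w).trace := by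
  have h : ∀ (P : Matrix m m ℂ) (Q : Matrix n n ℂ) (i : m) (j : n),
      (P * Matrix.single i j (1 : ℂ) * Q) i j = P i i * Q j j := by
    intro P Q i j
    simp [Matrix.mul_apply, Matrix.single_apply, ite_and]
  simp only [mapTrace, transfer_pow_apply, Matrix.sum_apply, h]
  rw [Finset.sum_congr rfl fun i _ => Finset.sum_comm, Finset.sum_comm]
  refine Finset.sum_congr rfl fun w _ => ?_
  simp [Matrix.trace, Finset.sum_mul, Finset.mul_sum]
  rw [Finset.sum_comm]

theorem tendsto_matrix_iff {α : Type*} {l : Filter α} {f : α → Matrix m n ℂ} {X : Matrix m n ℂ} :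
    Tendsto f l (𝓝 X) ↔ ∀ i j, Tendsto (fun k => f k i j) l (𝓝 (X i j)) := by
  exact tendsto_pi_nhds.trans (forall_congr' fun i => tendsto_pi_nhds)

theorem tendsto_mapTrace {α : Type*} {l : Filter α} {T : α → Module.End ℂ (Matrix m n ℂ)}
    {L : Matrix m n ℂ → Matrix m n ℂ} (h : ∀ X, Tendsto (fun k => T k X) l (𝓝 (L X))) :
    Tendsto (fun k => mapTrace (T k)) l (𝓝 (∑ i, ∑ j, L (Matrix.single i j 1) i j)) :=
  tendsto_finsetSum _ fun i _ => tendsto_finsetSum _ fun j _ =>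
    tendsto_matrix_iff.1 (h _) i j

theorem transfer_posSemidef (A : Fin 3 → Matrix n n ℂ) {X : Matrix n n ℂ} (hX : X.PosSemidef) :
    (transfer A A X).PosSemidef :=
  Matrix.posSemidef_sum _ fun μ _ => hX.mul_mul_conjTranspose_same (A μ)

theorem transfer_pow_posSemidef (A : Fin 3 → Matrix n n ℂ) {X : Matrix n n ℂ} (hX : X.PosSemidef)
    (k : ℕ) : (((transfer A A) ^ k) X).PosSemidef := by
  induction k with
  | zero => simpa using hX
  | succ k ih =>
    rw [pow_succ', Module.End.mul_apply]
    exact transfer_posSemidef A ih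

theorem posSemidef_of_tendsto {α : Type*} {l : Filter α} [l.NeBot] {f : α → Matrix n n ℂ}
    {X : Matrix n n ℂ} (hf : ∀ k, (f k).PosSemidef) (h : Tendsto f l (𝓝 X)) : X.PosSemidef := by
  refine Matrix.PosSemidef.of_dotProduct_mulVec_nonneg ?_ fun x => ?_
  · have h1 : Tendsto (fun k => (f k)ᴴ) l (𝓝 Xᴴ) :=
      (continuous_id.matrix_conjTranspose.tendsto X).comp h
    simp_rw [fun k => (hf k).1.eq] at h1
    exact tendsto_nhds_unique h1 h
  · have h1 : Tendsto (fun k => star x ⬝ᵥ (f k *ᵥ x)) l (𝓝 (star x ⬝ᵥ (X *ᵥ x))) := by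
      have : Continuous fun M : Matrix n n ℂ => star x ⬝ᵥ (M *ᵥ x) := by fun_prop
      exact (this.tendsto X).comp h
    exact ge_of_tendsto' h1 fun k => (hf k).dotProduct_mulVec_nonneg x

/-- Polarization. It transfers statements about positive rank-one matrices, where positivity of the
channel is available, to all matrices by linearity. -/
theorem span_vecMulVec_self :
    Submodule.span ℂ (Set.range fun v : n → ℂ => Matrix.vecMulVec v (star v)) = ⊤ := by
  rw [eq_top_iff]
  intro X _
  rw [Matrix.matrix_eq_sum_single X]
  refine Submodule.sum_mem _ fun i _ => Submodule.sum_mem _ fun j _ => ?_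
  set S := Submodule.span ℂ (Set.range fun v : n → ℂ => Matrix.vecMulVec v (star v))
  have hS : ∀ v : n → ℂ, Matrix.vecMulVec v (star v) ∈ S := fun v => Submodule.subset_span ⟨v, rfl⟩
  set u : n → ℂ := Pi.single i 1
  set v : n → ℂ := Pi.single j 1
  have hv : Matrix.single i j (X i j) = (X i j / 4) • (
      Matrix.vecMulVec (u + v) (star (u + v)) - Matrix.vecMulVec (u - v) (star (u - v)) +
      Complex.I • Matrix.vecMulVec (u + Complex.I • v) (star (u + Complex.I • v)) -
      Complex.I • Matrix.vecMulVec (u - Complex.I • v) (star (u - Complex.I • v))) := by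
    have h1 : Matrix.single i j (X i j) = X i j • Matrix.vecMulVec u v := by
      ext a b
      simp [u, v, Matrix.vecMulVec_apply, Matrix.single_apply, Pi.single_apply, ite_and,
        eq_comm (a := a), eq_comm (a := b)]
      split_ifs <;> rfl
    have hu' : star u = u := by ext a; simp [u, Pi.single_apply, apply_ite]
    have hv' : star v = v := by ext a; simp [v, Pi.single_apply, apply_ite]
    rw [h1]
    simp only [star_add, star_sub, star_smul, hu', hv']
    ext a b
    simp only [Matrix.smul_apply, Matrix.add_apply, Matrix.sub_apply, Matrix.vecMulVec_apply,
      Pi.add_apply, Pi.sub_apply, Pi.smul_apply, smul_eq_mul, Complex.star_def, Complex.conj_I]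
    linear_combination ((1 / 2 : ℂ) * X i j * (u a * v b - v a * u b)) * Complex.I_sq
  rw [hv]
  exact S.smul_mem _ (S.sub_mem (S.add_mem (S.sub_mem (hS _) (hS _)) (S.smul_mem _ (hS _)))
    (S.smul_mem _ (hS _)))

theorem trace_vecMulVec_star_mul (v : n → ℂ) (Y : Matrix n n ℂ) :
    (Matrix.vecMulVec v (star v) * Y).trace = star v ⬝ᵥ (Y *ᵥ v) := by
  rw [Matrix.vecMulVec_mul, Matrix.trace_vecMulVec, dotProduct_comm, Matrix.dotProduct_mulVec]

theorem exists_expectation_ne_zero {Y : Matrix n n ℂ} (hY : Y ≠ 0) :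
    ∃ v : n → ℂ, star v ⬝ᵥ (Y *ᵥ v) ≠ 0 := by
  by_contra! h
  apply hY
  have h2 : ∀ X : Matrix n n ℂ, (X * Y).trace = 0 := by
    intro X
    have hX : X ∈ Submodule.span ℂ (Set.range fun v : n → ℂ => Matrix.vecMulVec v (star v)) := by
      rw [span_vecMulVec_self]; trivial
    induction hX using Submodule.span_induction with
    | mem x hx => obtain ⟨v, rfl⟩ := hx; simp only [trace_vecMulVec_star_mul, h]
    | zero => simp
    | add x y _ _ hx hy => rw [Matrix.add_mul, Matrix.trace_add, hx, hy, add_zero]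
    | smul c x _ hx => rw [Matrix.smul_mul, Matrix.trace_smul, hx, smul_zero]
  ext i j
  have := h2 (Matrix.single j i 1)
  rwa [Matrix.trace_mul_comm, Matrix.trace_mul_single, MulOpposite.op_one, one_smul] at this

/-- The adjoint of a transfer map with respect to the trace pairing. -/
theorem trace_mul_transfer (A : Fin 3 → Matrix n n ℂ) (M X : Matrix n n ℂ) :
    (M * transfer A A X).trace =
      (transfer (fun i => (A i)ᴴ) (fun i => (A i)ᴴ) M * X).trace := by
  simp only [transfer_apply, Finset.mul_sum, Finset.sum_mul, Matrix.trace_sum,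
    Matrix.conjTranspose_conjTranspose]
  refine Finset.sum_congr rfl fun i _ => ?_
  rw [← Matrix.mul_assoc, Matrix.trace_mul_comm]
  simp only [Matrix.mul_assoc]

theorem trace_mul_transfer_pow (A : Fin 3 → Matrix n n ℂ) (M X : Matrix n n ℂ) (k : ℕ) :
    (M * ((transfer A A) ^ k) X).trace =
      (((transfer (fun i => (A i)ᴴ) (fun i => (A i)ᴴ)) ^ k) M * X).trace := by
  induction k generalizing M X with
  | zero => simp
  | succ k ih =>
    rw [pow_succ, Module.End.mul_apply, ih, trace_mul_transfer, pow_succ', Module.End.mul_apply]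

end Words

/-! ### Perron-Frobenius theory for transfer channels -/

section Mixing

variable {n : Type*} [Fintype n] [DecidableEq n]

/-- The iterates of `T` converge pointwise to the projection onto the line spanned by the fixed
point `R`. -/
structure Mixing (T : Module.End ℂ (Matrix n n ℂ)) (R : Matrix n n ℂ) : Prop where
  ne_zero : R ≠ 0
  fixed : T R = R
  tendsto : ∀ X, ∃ k : ℂ, Tendsto (fun j : ℕ => (T ^ j) X) atTop (𝓝 (k • R))

theorem pow_apply_of_fixed {V : Type*} [AddCommGroup V] [Module ℂ V] {T : Module.End ℂ V} {v : V}
    (h : T v = v) (j : ℕ) : (T ^ j) v = v := by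
  induction j with
  | zero => simp
  | succ j ih => rw [pow_succ, Module.End.mul_apply, h, ih]

/-- Taking moduli shows `t n → ‖y‖`, so dividing makes `l⁻ⁿ` converge to a nonzero limit, and a
convergent geometric sequence with nonzero limit has ratio one. -/
theorem eq_one_of_inv_pow_mul_tendsto {l : ℂ} (hl : ‖l‖ = 1) {t : ℕ → ℂ} (ht : ∀ n, 0 ≤ t n)
    {y : ℂ} (hy : y ≠ 0) (h : Tendsto (fun n => (l⁻¹) ^ n * t n) atTop (𝓝 y)) : l = 1 := by
  have h1 : Tendsto t atTop (𝓝 (‖y‖ : ℂ)) := by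
    have h2 := (Complex.continuous_ofReal.tendsto _).comp h.norm
    refine h2.congr fun n => ?_
    simp only [Function.comp, norm_mul, norm_pow, norm_inv, hl, inv_one, one_pow, one_mul]
    exact (Complex.eq_coe_norm_of_nonneg (ht n)).symm
  have hy' : (‖y‖ : ℂ) ≠ 0 := by simpa using hy
  have h3 := h.div h1 hy'
  have h4 : Tendsto (fun n : ℕ => (l⁻¹) ^ n) atTop (𝓝 (y / ‖y‖)) := by
    refine h3.congr' ?_
    filter_upwards [h1.eventually_ne hy'] with n hn
    exact mul_div_cancel_right₀ _ hn
  have h5 := (tendsto_add_atTop_iff_nat 1).2 h4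
  have h6 := h4.const_mul l⁻¹
  simp_rw [← pow_succ'] at h6
  have h7 := tendsto_nhds_unique h5 h6
  have h8 : y / (‖y‖ : ℂ) ≠ 0 := div_ne_zero hy hy'
  have h9 : l⁻¹ = 1 := by
    have : (l⁻¹ - 1) * (y / ‖y‖) = 0 := by linear_combination -h7
    rcases mul_eq_zero.1 this with h | h
    · linear_combination h
    · exact absurd h h8
  simpa using h9

/-- The gap makes the iterates converge to the dominant eigenline up to powers of an eigenvalue `l`
of modulus one. Expectation values of iterates of a positive rank-one matrix are nonnegative, which
forces `l = 1` and gives a positive semidefinite fixed point as a limit. -/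
theorem exists_mixing_of_finiteCorrelationLength {A : Fin 3 → Matrix n n ℂ}
    (hs : spectralRadius ℂ (channel A) = 1) (hF : FiniteCorrelationLength A) :
    ∃ R, R.PosSemidef ∧ Mixing (transfer A A) R := by
  rw [channel_eq_transfer] at hs
  obtain ⟨l, hl0, hm, ho⟩ := hF
  rw [channel_eq_transfer] at hm ho
  set T := transfer A A with hT
  have hspec : ∀ m : ℂ, T.charpoly.IsRoot m → ‖m‖ ≤ ‖l‖ := fun m h => by
    by_cases hml : m = l
    · rw [hml]
    · exact (ho m h hml).le
  have hroot : T.charpoly.IsRoot l :=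
    (Polynomial.rootMultiplicity_pos T.charpoly_monic.ne_zero).1 (hm ▸ one_pos)
  have hl : ‖l‖ = 1 := by
    have h1 : spectralRadius ℂ T = ‖l‖₊ := by
      refine le_antisymm (iSup₂_le fun m h => ?_) ?_
      · exact_mod_cast hspec m ((Module.End.mem_spectrum_iff_isRoot_charpoly T m).1 h)
      · exact le_iSup₂ (f := fun (k : ℂ) (_ : k ∈ spectrum ℂ T) => (‖k‖₊ : ENNReal)) l
          ((Module.End.mem_spectrum_iff_isRoot_charpoly T l).2 hroot)
    rw [hs] at h1
    have h2 : ‖l‖₊ = 1 := by exact_mod_cast h1.symm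
    simpa using congrArg NNReal.toReal h2
  rw [hl] at ho
  obtain ⟨u, hu0, hu, hgen⟩ := exists_generator_of_simple_root T l hm
  have hlim : ∀ X, ∃ k : ℂ, Tendsto (fun j : ℕ => (l⁻¹) ^ j • (T ^ j) X) atTop (𝓝 (k • u)) := by
    intro X
    obtain ⟨Y, hY, hφ⟩ := exists_pow_limit_of_simple_root T l hl hm ho X
    obtain ⟨k, rfl⟩ := hgen Y hY
    exact ⟨k, tendsto_matrix_iff.2 fun i j => hφ (Matrix.entryLinearMap ℂ ℂ i j)⟩
  -- If every positive rank-one matrix decayed, all matrices would by polarization, including the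
  -- eigenvector `u`, whose rescaled iterates are constant.
  have hex : ∃ v : n → ℂ, ∃ k : ℂ, k ≠ 0 ∧ Tendsto (fun j : ℕ => (l⁻¹) ^ j •
      (T ^ j) (Matrix.vecMulVec v (star v))) atTop (𝓝 (k • u)) := by
    by_contra! hc
    have h0 : ∀ X, Tendsto (fun j : ℕ => (l⁻¹) ^ j • (T ^ j) X) atTop (𝓝 0) := by
      intro X
      have hX : X ∈ Submodule.span ℂ (Set.range fun v : n → ℂ => Matrix.vecMulVec v (star v)) := by
        rw [span_vecMulVec_self]; trivial
      induction hX using Submodule.span_induction with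
      | mem x hx =>
        obtain ⟨v, rfl⟩ := hx
        obtain ⟨k, hk⟩ := hlim (Matrix.vecMulVec v (star v))
        by_cases hk0 : k = 0
        · simpa [hk0] using hk
        · exact absurd hk (hc v k hk0)
      | zero => simp
      | add x y _ _ hx hy => simpa using hx.add hy
      | smul c x _ hx => simpa [smul_comm c] using hx.const_smul c
    have hpow : ∀ j : ℕ, (T ^ j) u = l ^ j • u := by
      intro j
      induction j with
      | zero => simp
      | succ j ih => rw [pow_succ', Module.End.mul_apply, ih, map_smul, hu, smul_smul, pow_succ]
    have h1 := h0 u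
    simp_rw [hpow, smul_smul, ← mul_pow, inv_mul_cancel₀ hl0, one_pow, one_smul] at h1
    exact hu0 (tendsto_nhds_unique tendsto_const_nhds h1)
  obtain ⟨v, k, hk0, hk⟩ := hex
  obtain ⟨w, hw⟩ := exists_expectation_ne_zero (smul_ne_zero hk0 hu0)
  have hpsd : ∀ j : ℕ, ((T ^ j) (Matrix.vecMulVec v (star v))).PosSemidef := fun j =>
    transfer_pow_posSemidef A (Matrix.posSemidef_vecMulVec_self_star v) j
  have hl1 : l = 1 := by
    refine eq_one_of_inv_pow_mul_tendsto hl
      (fun j => (hpsd j).dotProduct_mulVec_nonneg w) hw ?_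
    have hc : Continuous fun M : Matrix n n ℂ => star w ⬝ᵥ (M *ᵥ w) := by fun_prop
    refine ((hc.tendsto _).comp hk).congr fun j => ?_
    simp [Matrix.smul_mulVec]
  subst hl1
  simp only [inv_one, one_pow, one_smul] at hlim hk hu
  refine ⟨k • u, posSemidef_of_tendsto hpsd hk, smul_ne_zero hk0 hu0, by rw [map_smul, hu],
    fun X => ?_⟩
  obtain ⟨c, hc⟩ := hlim X
  exact ⟨c / k, by rwa [smul_smul, div_mul_cancel₀ _ hk0]⟩

/-- A mixing transfer map has a positive semidefinite left fixed point which is not orthogonal to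
the right one. -/
theorem Mixing.exists_left_fixed {A : Fin 3 → Matrix n n ℂ} {R : Matrix n n ℂ}
    (h : Mixing (transfer A A) R) :
    ∃ L : Matrix n n ℂ, L.PosSemidef ∧ ∑ μ, (A μ)ᴴ * L * A μ = L ∧ (L * R).trace ≠ 0 := by
  obtain ⟨v, hv⟩ := exists_expectation_ne_zero h.ne_zero
  set M := Matrix.vecMulVec v (star v)
  set S := transfer (fun i => (A i)ᴴ) (fun i => (A i)ᴴ)
  choose κ hκ using h.tendsto
  -- The candidate is the limit of the adjoint iterates of the positive matrix `M`; its entries are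
  -- read off by pairing with matrix units and moving the iterates to the other side.
  set L : Matrix n n ℂ := Matrix.of fun i j => κ (Matrix.single j i 1) * (M * R).trace
  have hL : Tendsto (fun j : ℕ => (S ^ j) M) atTop (𝓝 L) := by
    rw [tendsto_matrix_iff]
    intro a b
    have hc : Continuous fun X : Matrix n n ℂ => (M * X).trace := by fun_prop
    have h1 := (hc.tendsto _).comp (hκ (Matrix.single b a 1))
    simp only [Matrix.mul_smul, Matrix.trace_smul, smul_eq_mul] at h1
    refine h1.congr fun j => ?_
    simp only [Function.comp, trace_mul_transfer_pow]
    rw [Matrix.trace_mul_single, MulOpposite.op_one, one_smul]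
  refine ⟨L, posSemidef_of_tendsto (fun j =>
    transfer_pow_posSemidef _ (Matrix.posSemidef_vecMulVec_self_star v) j) hL, ?_, ?_⟩
  · have hc : Continuous fun X : Matrix n n ℂ => ∑ μ, (A μ)ᴴ * X * A μ := by fun_prop
    refine tendsto_nhds_unique ((hc.tendsto L).comp hL)
      (((tendsto_add_atTop_iff_nat 1).2 hL).congr fun j => ?_)
    rw [pow_succ', Module.End.mul_apply]
    simp only [S, transfer_apply, Matrix.conjTranspose_conjTranspose, Function.comp]
  · have hc : Continuous fun X : Matrix n n ℂ => (X * R).trace := by fun_prop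
    have h1 := (hc.tendsto L).comp hL
    have h2 : (fun j : ℕ => (M * R).trace) = (fun X : Matrix n n ℂ => (X * R).trace) ∘
        fun j => (S ^ j) M := by
      ext j
      simp only [Function.comp, S, ← trace_mul_transfer_pow]
      rw [pow_apply_of_fixed h.fixed]
    rw [← h2] at h1
    rw [← tendsto_nhds_unique tendsto_const_nhds h1, trace_vecMulVec_star_mul]
    exact hv

end Mixing

/-! ### Reduction to the junk space -/

section Junk

variable {d : ℕ}

/-- Partial trace over the protected space. -/
def traceProtected (X : Matrix (Fin 2 × Fin d) (Fin 2 × Fin d) ℂ) : Matrix (Fin d) (Fin d) ℂ :=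
  Matrix.of fun k l => ∑ i, X (i, k) (i, l)

theorem pauli_mul_self (κ : Fin 3) : pauli κ * pauli κ = 1 := by
  fin_cases κ <;> (ext i j; fin_cases i <;> fin_cases j <;> simp [pauli, Matrix.mul_apply])

theorem pauli_conjTranspose (κ : Fin 3) : (pauli κ)ᴴ = pauli κ := by
  fin_cases κ <;> (ext i j; fin_cases i <;> fin_cases j <;> simp [pauli])

theorem pauli_conj (κ ν : Fin 3) :
    pauli κ * pauli ν * pauli κ = (if κ = ν then 1 else -1 : ℂ) • pauli ν := by
  fin_cases κ <;> fin_cases ν <;>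
    (ext i j; fin_cases i <;> fin_cases j <;> simp [pauli, Matrix.mul_apply])

theorem transfer_withProtected_one_kronecker (b : Fin 3 → Matrix (Fin d) (Fin d) ℂ)
    (x : Matrix (Fin d) (Fin d) ℂ) :
    transfer (withProtected b) (withProtected b) ((1 : Matrix (Fin 2) (Fin 2) ℂ) ⊗ₖ x) =
      (1 : Matrix (Fin 2) (Fin 2) ℂ) ⊗ₖ (transfer b b x) := by
  simp only [transfer_apply, withProtected, Matrix.conjTranspose_kronecker,
    ← Matrix.mul_kronecker_mul, Matrix.mul_one, pauli_conjTranspose, pauli_mul_self]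
  ext ⟨i, k⟩ ⟨j, l⟩
  simp [Matrix.sum_apply, Finset.mul_sum]

theorem transfer_withProtected_pow_one_kronecker (b : Fin 3 → Matrix (Fin d) (Fin d) ℂ)
    (x : Matrix (Fin d) (Fin d) ℂ) (j : ℕ) :
    ((transfer (withProtected b) (withProtected b)) ^ j) ((1 : Matrix (Fin 2) (Fin 2) ℂ) ⊗ₖ x) =
      (1 : Matrix (Fin 2) (Fin 2) ℂ) ⊗ₖ (((transfer b b) ^ j) x) := by
  induction j generalizing x with
  | zero => simp
  | succ j ih =>
    rw [pow_succ, Module.End.mul_apply, transfer_withProtected_one_kronecker, ih, pow_succ,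
      Module.End.mul_apply]

/-- Cyclicity of the trace over the qubit cancels the two Pauli factors. Hence the partial trace
intertwines the full transfer map with the junk one. -/
theorem traceProtected_pauli_conj (κ : Fin 3) (a a' : Matrix (Fin d) (Fin d) ℂ)
    (X : Matrix (Fin 2 × Fin d) (Fin 2 × Fin d) ℂ) :
    traceProtected (pauli κ ⊗ₖ a * X * pauli κ ⊗ₖ a') = a * traceProtected X * a' := by
  have hI : ∀ u v w : ℂ, -(Complex.I * u * v * (Complex.I * w)) = u * v * w := fun u v w => by
    linear_combination (-(u * v * w)) * Complex.I_sq
  ext k l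
  fin_cases κ <;>
    simp [traceProtected, pauli, Matrix.mul_apply, Matrix.kroneckerMap_apply,
      Fintype.sum_prod_type, Fin.sum_univ_two, mul_add, add_mul, Finset.sum_add_distrib,
      Finset.sum_mul]
  simp only [← Finset.sum_neg_distrib, hI]

/-- Matrices `1 ⊗ x` are preserved by the full channel, so their convergence yields that of the junk
channel after a partial trace over the qubit. The partial trace of `R` is nonzero because it has the
same trace as the nonzero positive `R`. -/
theorem exists_junk_mixing {b : Fin 3 → Matrix (Fin d) (Fin d) ℂ}
    {R : Matrix (Fin 2 × Fin d) (Fin 2 × Fin d) ℂ} (hR : R.PosSemidef)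
    (h : Mixing (transfer (withProtected b) (withProtected b)) R) :
    ∃ r : Matrix (Fin d) (Fin d) ℂ, r.PosSemidef ∧ Mixing (transfer b b) r := by
  have hr : (traceProtected R).PosSemidef := by
    have h1 : traceProtected R = ∑ i : Fin 2, R.submatrix (fun k => (i, k)) (fun k => (i, k)) := by
      ext k l; simp [traceProtected]
    rw [h1]
    exact Matrix.posSemidef_sum _ fun i _ => hR.submatrix _
  have htr : (traceProtected R).trace = R.trace := by
    simp only [traceProtected, Matrix.trace, Matrix.diag_apply, Matrix.of_apply,
      Fintype.sum_prod_type]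
    rw [Finset.sum_comm]
  have hne : traceProtected R ≠ 0 := by
    intro h0
    rw [h0, Matrix.trace_zero] at htr
    exact h.ne_zero ((hR.trace_eq_zero_iff).1 htr.symm)
  have hcont : Continuous (traceProtected (d := d)) := by
    refine continuous_matrix fun k l => ?_
    simp only [traceProtected, Matrix.of_apply]
    fun_prop
  have hone : ∀ x : Matrix (Fin d) (Fin d) ℂ,
      traceProtected ((1 : Matrix (Fin 2) (Fin 2) ℂ) ⊗ₖ x) = (2 : ℂ) • x := by
    intro x; ext k l; simp [traceProtected, two_mul]
  have hlim : ∀ x, ∃ k : ℂ, Tendsto (fun j : ℕ => ((transfer b b) ^ j) x) atTop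
      (𝓝 (k • traceProtected R)) := by
    intro x
    obtain ⟨k, hk⟩ := h.tendsto ((1 : Matrix (Fin 2) (Fin 2) ℂ) ⊗ₖ x)
    have h1 := ((hcont.tendsto _).comp hk).const_smul (1 / 2 : ℂ)
    refine ⟨k / 2, ?_⟩
    have h2 : (1 / 2 : ℂ) • traceProtected (k • R) = (k / 2) • traceProtected R := by
      ext a b
      simp only [traceProtected, Matrix.smul_apply, Matrix.of_apply, smul_eq_mul, Fin.sum_univ_two]
      ring
    rw [h2] at h1
    refine h1.congr fun j => ?_
    simp only [Function.comp, transfer_withProtected_pow_one_kronecker, hone, smul_smul]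
    norm_num
  refine ⟨traceProtected R, hr, hne, ?_, hlim⟩
  conv_rhs => rw [← h.fixed]
  have hsum : ∀ f : Fin 3 → Matrix (Fin 2 × Fin d) (Fin 2 × Fin d) ℂ,
      traceProtected (∑ μ, f μ) = ∑ μ, traceProtected (f μ) := by
    intro f
    ext k l
    simp only [traceProtected, Matrix.of_apply, Matrix.sum_apply]
    rw [Finset.sum_comm]
  simp only [transfer_apply, withProtected, hsum, Matrix.conjTranspose_kronecker,
    pauli_conjTranspose, traceProtected_pauli_conj]

end Junk

/-! ### Existence of the canonical form -/

/-- A sum of positive semidefinite matrices vanishes only termwise, and each diagonal entry of a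
term is the value of the definite form `x` at a conjugated row of `B μ`. -/
theorem sum_mul_conjTranspose_eq_zero {m n : Type*} [Fintype m] [Fintype n] [DecidableEq n]
    {x : Matrix n n ℂ} (hx : x.PosDef) {B : Fin 3 → Matrix m n ℂ}
    (h : ∑ μ, B μ * x * (B μ)ᴴ = 0) (μ : Fin 3) : B μ = 0 := by
  have hnn : ∀ ν, (B ν * x * (B ν)ᴴ).PosSemidef := fun ν =>
    hx.posSemidef.mul_mul_conjTranspose_same _
  have htr : ∑ ν, (B ν * x * (B ν)ᴴ).trace = 0 := by rw [← Matrix.trace_sum, h, Matrix.trace_zero]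
  have h1 := (Finset.sum_eq_zero_iff_of_nonneg fun ν _ => (hnn ν).trace_nonneg).1 htr μ
    (Finset.mem_univ _)
  have h2 : B μ * x * (B μ)ᴴ = 0 := ((hnn μ).trace_eq_zero_iff).1 h1
  ext i j
  by_contra hij
  have hv : star (B μ i) ≠ 0 := fun h0 => hij (by
    have := congrFun h0 j
    simpa using this)
  have h3 := hx.dotProduct_mulVec_pos hv
  have h4 : (B μ * x * (B μ)ᴴ) i i = star (star (B μ i)) ⬝ᵥ (x *ᵥ star (B μ i)) := by
    rw [Matrix.mul_assoc, Matrix.mul_apply', star_star]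
    rfl
  rw [← h4, h2] at h3
  simp at h3

theorem trace_fromBlocks_eq {m n : Type*} [Fintype m] [Fintype n] (A : Matrix m m ℂ)
    (B : Matrix m n ℂ) (C : Matrix n m ℂ) (D : Matrix n n ℂ) :
    (Matrix.fromBlocks A B C D).trace = A.trace + D.trace := by
  simp [Matrix.trace, Fintype.sum_sum_type]

/-- Separates the support of `H` from its kernel. The bijection of index sets only records that the
two dimensions add up to `n`. -/
theorem exists_diagonalization {n : ℕ} {H : Matrix (Fin n) (Fin n) ℂ} (hH : H.PosSemidef) :
    ∃ (p q : ℕ) (_ : Fin n ≃ Fin p ⊕ Fin q) (P : Matrix (Fin p ⊕ Fin q) (Fin n) ℂ)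
      (δ : Fin p → ℝ), P * Pᴴ = 1 ∧ Pᴴ * P = 1 ∧ (∀ i, 0 < δ i) ∧
      P * H * Pᴴ = Matrix.fromBlocks (Matrix.diagonal fun i => (δ i : ℂ)) 0 0 0 := by
  classical
  set ev := hH.1.eigenvalues
  set V : Matrix (Fin n) (Fin n) ℂ := (hH.1.eigenvectorUnitary).1 with hV
  have hV1 : Vᴴ * V = 1 := Unitary.coe_star_mul_self hH.1.eigenvectorUnitary
  have hV2 : V * Vᴴ = 1 := Unitary.coe_mul_star_self hH.1.eigenvectorUnitary
  have hsp : H = V * Matrix.diagonal (fun i => (ev i : ℂ)) * Vᴴ := by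
    conv_lhs => rw [hH.1.spectral_theorem, Unitary.conjStarAlgAut_apply]
    rfl
  let e : Fin n ≃ Fin (Fintype.card {i // 0 < ev i}) ⊕ Fin (Fintype.card {i // ¬ 0 < ev i}) :=
    (Equiv.sumCompl fun i => 0 < ev i).symm.trans
      (Equiv.sumCongr (Fintype.equivFin _) (Fintype.equivFin _))
  refine ⟨_, _, e, Vᴴ.submatrix e.symm id, fun i => ev ((Fintype.equivFin _).symm i).1, ?_, ?_,
    fun i => ((Fintype.equivFin {i // 0 < ev i}).symm i).2, ?_⟩
  · rw [Matrix.conjTranspose_submatrix, ← Matrix.submatrix_mul _ _ _ _ _ Function.bijective_id,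
      Matrix.conjTranspose_conjTranspose, hV1, Matrix.submatrix_one_equiv]
  · rw [Matrix.conjTranspose_submatrix, Matrix.conjTranspose_conjTranspose,
      ← Matrix.submatrix_mul _ _ _ _ _ e.symm.bijective, hV2, Matrix.submatrix_id_id]
  · have h1 : Vᴴ.submatrix e.symm id * H * (Vᴴ.submatrix e.symm id)ᴴ =
        (Matrix.diagonal fun i => (ev i : ℂ)).submatrix e.symm e.symm := by
      have : Vᴴ * H * V = Matrix.diagonal fun i => (ev i : ℂ) := by
        conv_lhs => rw [hsp]
        rw [Matrix.mul_assoc, Matrix.mul_assoc, hV1, Matrix.mul_one, ← Matrix.mul_assoc, hV1,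
          Matrix.one_mul]
      rw [← this, Matrix.conjTranspose_submatrix, Matrix.conjTranspose_conjTranspose]
      ext i j
      simp [Matrix.mul_apply]
    rw [h1]
    ext (i | i) (j | j)
    · by_cases hij : i = j
      · subst hij; simp [e]
      · simp [e, Subtype.val_inj, hij]
    · have hne : ((Fintype.equivFin {i // 0 < ev i}).symm i).1 ≠
          ((Fintype.equivFin {i // ¬ 0 < ev i}).symm j).1 := fun h =>
        ((Fintype.equivFin {i // ¬ 0 < ev i}).symm j).2 (h ▸ ((Fintype.equivFin _).symm i).2)
      simp [e, hne]
    · have hne : ((Fintype.equivFin {i // ¬ 0 < ev i}).symm i).1 ≠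
          ((Fintype.equivFin {i // 0 < ev i}).symm j).1 := fun h =>
        ((Fintype.equivFin {i // ¬ 0 < ev i}).symm i).2 (h ▸ ((Fintype.equivFin _).symm j).2)
      simp [e, hne]
    · have h0 : ev ((Fintype.equivFin {i // ¬ 0 < ev i}).symm i).1 = 0 :=
        le_antisymm (not_lt.1 ((Fintype.equivFin {i // ¬ 0 < ev i}).symm i).2)
          (hH.eigenvalues_nonneg _)
      simp [e, Matrix.diagonal_apply, h0]

theorem posDef_diagonal_ofReal {p : ℕ} {δ : Fin p → ℝ} (h : ∀ i, 0 < δ i) :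
    (Matrix.diagonal fun i => (δ i : ℂ)).PosDef :=
  Matrix.PosDef.diagonal fun i => by exact_mod_cast h i

/-- Splitting off the support of the left fixed point of a right-canonical tensor. -/
theorem exists_left_block {D : ℕ} {b : Fin 3 → Matrix (Fin D) (Fin D) ℂ}
    {l : Matrix (Fin D) (Fin D) ℂ} (hl : l.PosSemidef) (hb : ∑ μ, b μ * (b μ)ᴴ = 1)
    (hfix : ∑ μ, (b μ)ᴴ * l * b μ = l) (htr : l.trace ≠ 0) :
    ∃ (d q : ℕ) (_ : Fin D ≃ Fin d ⊕ Fin q) (P : Matrix (Fin d ⊕ Fin q) (Fin D) ℂ)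
      (c : Fin 3 → Matrix (Fin d) (Fin d) ℂ) (x : Matrix (Fin d) (Fin d) ℂ),
      P * Pᴴ = 1 ∧ Pᴴ * P = 1 ∧ x.PosDef ∧ x.trace ≠ 0 ∧
      ∑ μ, c μ * (c μ)ᴴ = 1 ∧ ∑ μ, (c μ)ᴴ * x * c μ = x ∧
      ∀ μ, ∃ (v : Matrix (Fin q) (Fin d) ℂ) (s : Matrix (Fin q) (Fin q) ℂ),
        P * b μ * Pᴴ = Matrix.fromBlocks (c μ) 0 v s := by
  obtain ⟨d, q, e, P, δ, hP1, hP2, hδ, hd⟩ := exists_diagonalization hl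
  set x : Matrix (Fin d) (Fin d) ℂ := Matrix.diagonal fun i => (δ i : ℂ)
  have hx : x.PosDef := posDef_diagonal_ofReal hδ
  set B : Fin 3 → Matrix (Fin d ⊕ Fin q) (Fin d ⊕ Fin q) ℂ := fun μ => P * b μ * Pᴴ with hB
  have hBc : ∀ μ, (B μ)ᴴ = P * (b μ)ᴴ * Pᴴ := fun μ => by
    simp [hB, Matrix.conjTranspose_mul, Matrix.mul_assoc]
  have hB1 : ∑ μ, B μ * (B μ)ᴴ = 1 := by
    have : ∀ μ, B μ * (B μ)ᴴ = P * (b μ * (b μ)ᴴ) * Pᴴ := fun μ => by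
      rw [hBc]
      calc P * b μ * Pᴴ * (P * (b μ)ᴴ * Pᴴ) = P * b μ * (Pᴴ * P) * (b μ)ᴴ * Pᴴ := by
            simp only [Matrix.mul_assoc]
        _ = _ := by rw [hP2, Matrix.mul_one]; simp only [Matrix.mul_assoc]
    simp_rw [this]
    rw [← Matrix.sum_mul, ← Matrix.mul_sum, hb, Matrix.mul_one, hP1]
  have hB2 : ∑ μ, (B μ)ᴴ * Matrix.fromBlocks x 0 0 0 * B μ = Matrix.fromBlocks x 0 0 0 := by
    have : ∀ μ, (B μ)ᴴ * Matrix.fromBlocks x 0 0 0 * B μ = P * ((b μ)ᴴ * l * b μ) * Pᴴ :=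
      fun μ => by
      rw [hBc, ← hd]
      calc P * (b μ)ᴴ * Pᴴ * (P * l * Pᴴ) * (P * b μ * Pᴴ) =
            P * (b μ)ᴴ * (Pᴴ * P) * l * (Pᴴ * P) * b μ * Pᴴ := by simp only [Matrix.mul_assoc]
        _ = _ := by rw [hP2, Matrix.mul_one, Matrix.mul_one]; simp only [Matrix.mul_assoc]
    simp_rw [this]
    rw [← Matrix.sum_mul, ← Matrix.mul_sum, hfix, hd]
  -- The left fixed point vanishes on the kernel block. The lower right corner of its equation thus
  -- says that a sum of positive terms built from the upper right blocks is zero.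
  have h12 : ∀ μ, (B μ).toBlocks₁₂ = 0 := by
    have h22 : ∑ μ, ((B μ).toBlocks₁₂)ᴴ * x * ((B μ).toBlocks₁₂)ᴴᴴ = 0 := by
      have h := congrArg Matrix.toBlocks₂₂ hB2
      rw [Matrix.toBlocks_fromBlocks₂₂] at h
      rw [← h]
      ext i j
      simp only [Matrix.toBlocks₂₂, Matrix.of_apply, Matrix.sum_apply]
      refine Finset.sum_congr rfl fun μ _ => ?_
      conv_rhs => rw [← Matrix.fromBlocks_toBlocks (B μ), Matrix.fromBlocks_conjTranspose,
        Matrix.fromBlocks_multiply, Matrix.fromBlocks_multiply, Matrix.fromBlocks_apply₂₂]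
      simp
    intro μ
    have := sum_mul_conjTranspose_eq_zero hx h22 μ
    simpa using this
  have hblk : ∀ μ, B μ = Matrix.fromBlocks (B μ).toBlocks₁₁ 0 (B μ).toBlocks₂₁ (B μ).toBlocks₂₂ :=
    fun μ => by
      conv_lhs => rw [← Matrix.fromBlocks_toBlocks (B μ), h12]
  refine ⟨d, q, e, P, fun μ => (B μ).toBlocks₁₁, x, hP1, hP2, hx, ?_, ?_, ?_,
    fun μ => ⟨_, _, hblk μ⟩⟩
  · have h1 : (P * l * Pᴴ).trace = l.trace := by
      rw [Matrix.trace_mul_comm, ← Matrix.mul_assoc, hP2, Matrix.one_mul]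
    rw [hd, trace_fromBlocks_eq, Matrix.trace_zero, add_zero] at h1
    rwa [h1]
  · have h := congrArg Matrix.toBlocks₁₁ hB1
    rw [← Matrix.fromBlocks_one, Matrix.toBlocks_fromBlocks₁₁] at h
    rw [← h]
    ext i j
    simp only [Matrix.toBlocks₁₁, Matrix.of_apply, Matrix.sum_apply]
    refine Finset.sum_congr rfl fun μ _ => ?_
    conv_rhs => rw [hblk μ, Matrix.fromBlocks_conjTranspose,
      Matrix.fromBlocks_multiply, Matrix.fromBlocks_apply₁₁]
    simp [Matrix.toBlocks₁₁]
  · have h := congrArg Matrix.toBlocks₁₁ hB2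
    rw [Matrix.toBlocks_fromBlocks₁₁] at h
    conv_rhs => rw [← h]
    ext i j
    simp only [Matrix.toBlocks₁₁, Matrix.of_apply, Matrix.sum_apply]
    refine Finset.sum_congr rfl fun μ _ => ?_
    conv_rhs => rw [hblk μ, Matrix.fromBlocks_conjTranspose, Matrix.fromBlocks_multiply,
      Matrix.fromBlocks_multiply, Matrix.fromBlocks_apply₁₁]
    simp [Matrix.toBlocks₁₁]

/-- Restricting to the support of the right fixed point. -/
theorem exists_right_block {D : ℕ} {b : Fin 3 → Matrix (Fin D) (Fin D) ℂ}
    {r l : Matrix (Fin D) (Fin D) ℂ} (hr : r.PosSemidef) (hl : l.PosSemidef)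
    (hrf : ∑ μ, b μ * r * (b μ)ᴴ = r) (hlf : ∑ μ, (b μ)ᴴ * l * b μ = l)
    (htr : (l * r).trace ≠ 0) :
    ∃ (d q : ℕ) (_ : Fin D ≃ Fin d ⊕ Fin q) (P : Matrix (Fin d ⊕ Fin q) (Fin D) ℂ)
      (P' : Matrix (Fin D) (Fin d ⊕ Fin q) ℂ)
      (c : Fin 3 → Matrix (Fin d) (Fin d) ℂ) (x : Matrix (Fin d) (Fin d) ℂ),
      P * P' = 1 ∧ P' * P = 1 ∧ x.PosSemidef ∧ x.trace ≠ 0 ∧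
      ∑ μ, c μ * (c μ)ᴴ = 1 ∧ ∑ μ, (c μ)ᴴ * x * c μ = x ∧
      ∀ μ, ∃ (v : Matrix (Fin d) (Fin q) ℂ) (s : Matrix (Fin q) (Fin q) ℂ),
        P * b μ * P' = Matrix.fromBlocks (c μ) v 0 s := by
  obtain ⟨d, q, e, P, δ, hP1, hP2, hδ, hd⟩ := exists_diagonalization hr
  set x : Matrix (Fin d) (Fin d) ℂ := Matrix.diagonal fun i => (δ i : ℂ)
  have hx : x.PosDef := posDef_diagonal_ofReal hδ
  -- Conjugating by the square root of the right fixed point turns that fixed point into the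
  -- identity, as canonical form demands.
  set s : Matrix (Fin d) (Fin d) ℂ := Matrix.diagonal fun i => ((Real.sqrt (δ i) : ℝ) : ℂ)
  set s' : Matrix (Fin d) (Fin d) ℂ := Matrix.diagonal fun i => ((Real.sqrt (δ i) : ℝ) : ℂ)⁻¹
  have hsq : ∀ i, ((Real.sqrt (δ i) : ℝ) : ℂ) ≠ 0 := fun i => by
    exact_mod_cast (Real.sqrt_pos.2 (hδ i)).ne'
  have hss : s * s = x := by
    simp only [s, x, Matrix.diagonal_mul_diagonal]
    congr 1; ext i
    exact_mod_cast Real.mul_self_sqrt (hδ i).le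
  have hs1 : s * s' = 1 := by
    simp only [s, s', Matrix.diagonal_mul_diagonal]
    simp [mul_inv_cancel₀ (hsq _)]
  have hs2 : s' * s = 1 := by
    simp only [s, s', Matrix.diagonal_mul_diagonal]
    simp [inv_mul_cancel₀ (hsq _)]
  have hsc : sᴴ = s := by
    simp only [s, Matrix.diagonal_conjTranspose]
    congr 1; ext i; simp
  have hsc' : s'ᴴ = s' := by
    simp only [s', Matrix.diagonal_conjTranspose]
    congr 1; ext i; simp
  set B : Fin 3 → Matrix (Fin d ⊕ Fin q) (Fin d ⊕ Fin q) ℂ := fun μ => P * b μ * Pᴴ with hB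
  have hBc : ∀ μ, (B μ)ᴴ = P * (b μ)ᴴ * Pᴴ := fun μ => by
    simp [hB, Matrix.conjTranspose_mul, Matrix.mul_assoc]
  set l' := P * l * Pᴴ with hl'
  have hconj : ∀ u v w : Matrix (Fin D) (Fin D) ℂ,
      P * u * Pᴴ * (P * v * Pᴴ) * (P * w * Pᴴ) = P * (u * v * w) * Pᴴ := fun u v w => by
    calc P * u * Pᴴ * (P * v * Pᴴ) * (P * w * Pᴴ) =
          P * u * (Pᴴ * P) * v * (Pᴴ * P) * w * Pᴴ := by simp only [Matrix.mul_assoc]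
      _ = _ := by rw [hP2, Matrix.mul_one, Matrix.mul_one]; simp only [Matrix.mul_assoc]
  have hB1 : ∑ μ, B μ * Matrix.fromBlocks x 0 0 0 * (B μ)ᴴ = Matrix.fromBlocks x 0 0 0 := by
    have : ∀ μ, B μ * Matrix.fromBlocks x 0 0 0 * (B μ)ᴴ = P * (b μ * r * (b μ)ᴴ) * Pᴴ :=
      fun μ => by rw [hBc, ← hd, hconj]
    simp_rw [this]
    rw [← Matrix.sum_mul, ← Matrix.mul_sum, hrf, hd]
  have hB2 : ∑ μ, (B μ)ᴴ * l' * B μ = l' := by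
    have : ∀ μ, (B μ)ᴴ * l' * B μ = P * ((b μ)ᴴ * l * b μ) * Pᴴ :=
      fun μ => by rw [hBc, hconj]
    simp_rw [this]
    rw [← Matrix.sum_mul, ← Matrix.mul_sum, hlf]
  -- The support of the right fixed point is an invariant subspace of all components, by the same
  -- positivity argument in the lower right corner.
  have h21 : ∀ μ, (B μ).toBlocks₂₁ = 0 := by
    have h22 : ∑ μ, (B μ).toBlocks₂₁ * x * ((B μ).toBlocks₂₁)ᴴ = 0 := by
      have h := congrArg Matrix.toBlocks₂₂ hB1
      rw [Matrix.toBlocks_fromBlocks₂₂] at h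
      rw [← h]
      ext i j
      simp only [Matrix.toBlocks₂₂, Matrix.of_apply, Matrix.sum_apply]
      refine Finset.sum_congr rfl fun μ _ => ?_
      conv_rhs => rw [← Matrix.fromBlocks_toBlocks (B μ), Matrix.fromBlocks_conjTranspose,
        Matrix.fromBlocks_multiply, Matrix.fromBlocks_multiply, Matrix.fromBlocks_apply₂₂]
      simp
    exact sum_mul_conjTranspose_eq_zero hx h22
  have hblk : ∀ μ, B μ = Matrix.fromBlocks (B μ).toBlocks₁₁ (B μ).toBlocks₁₂ 0 (B μ).toBlocks₂₂ :=
    fun μ => by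
      conv_lhs => rw [← Matrix.fromBlocks_toBlocks (B μ), h21]
  set c₀ : Fin 3 → Matrix (Fin d) (Fin d) ℂ := fun μ => (B μ).toBlocks₁₁ with hc₀
  have hc1 : ∑ μ, c₀ μ * x * (c₀ μ)ᴴ = x := by
    have h := congrArg Matrix.toBlocks₁₁ hB1
    rw [Matrix.toBlocks_fromBlocks₁₁] at h
    conv_rhs => rw [← h]
    ext i j
    simp only [hc₀, Matrix.toBlocks₁₁, Matrix.of_apply, Matrix.sum_apply]
    refine Finset.sum_congr rfl fun μ _ => ?_
    conv_rhs => rw [hblk μ, Matrix.fromBlocks_conjTranspose, Matrix.fromBlocks_multiply,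
      Matrix.fromBlocks_multiply, Matrix.fromBlocks_apply₁₁]
    simp [Matrix.toBlocks₁₁]
  have hc2 : ∑ μ, (c₀ μ)ᴴ * l'.toBlocks₁₁ * c₀ μ = l'.toBlocks₁₁ := by
    have h := congrArg Matrix.toBlocks₁₁ hB2
    conv_rhs => rw [← h]
    ext i j
    rw [Matrix.sum_apply]
    change _ = (∑ μ, (B μ)ᴴ * l' * B μ) (Sum.inl i) (Sum.inl j)
    rw [Matrix.sum_apply]
    refine Finset.sum_congr rfl fun μ _ => ?_
    conv_rhs => rw [hblk μ, ← Matrix.fromBlocks_toBlocks l', Matrix.fromBlocks_conjTranspose,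
      Matrix.fromBlocks_multiply, Matrix.fromBlocks_multiply, Matrix.fromBlocks_apply₁₁]
    simp [hc₀]
  have hl11 : l'.toBlocks₁₁.PosSemidef :=
    (hl.mul_mul_conjTranspose_same P).submatrix Sum.inl
  set G : Matrix (Fin d ⊕ Fin q) (Fin d ⊕ Fin q) ℂ := Matrix.fromBlocks s 0 0 1 with hG
  set G' : Matrix (Fin d ⊕ Fin q) (Fin d ⊕ Fin q) ℂ := Matrix.fromBlocks s' 0 0 1 with hG'
  have hGG' : G * G' = 1 := by
    rw [hG, hG', Matrix.fromBlocks_multiply]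
    simp [hs1]
  have hG'G : G' * G = 1 := by
    rw [hG, hG', Matrix.fromBlocks_multiply]
    simp [hs2]
  refine ⟨d, q, e, G' * P, Pᴴ * G,
    fun μ => s' * c₀ μ * s, s * l'.toBlocks₁₁ * s, ?_, ?_, ?_, ?_, ?_, ?_, fun μ =>
    ⟨s' * (B μ).toBlocks₁₂, (B μ).toBlocks₂₂, ?_⟩⟩
  · rw [Matrix.mul_assoc, ← Matrix.mul_assoc P, hP1, Matrix.one_mul, hG'G]
  · rw [Matrix.mul_assoc, ← Matrix.mul_assoc G, hGG', Matrix.one_mul, hP2]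
  · have := hl11.mul_mul_conjTranspose_same s
    rwa [hsc] at this
  · have h1 : (l' * Matrix.fromBlocks x 0 0 0).trace = (l * r).trace := by
      rw [hl', ← hd]
      calc (P * l * Pᴴ * (P * r * Pᴴ)).trace = (P * (l * (Pᴴ * P) * r * Pᴴ)).trace := by
            simp only [Matrix.mul_assoc]
        _ = _ := by
          rw [hP2, Matrix.mul_one, Matrix.trace_mul_comm, Matrix.mul_assoc, hP2, Matrix.mul_one]
    rw [← Matrix.fromBlocks_toBlocks l', Matrix.fromBlocks_multiply, trace_fromBlocks_eq] at h1
    simp only [Matrix.mul_zero, add_zero, Matrix.trace_zero] at h1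
    rw [Matrix.trace_mul_comm, ← Matrix.mul_assoc, hss, Matrix.trace_mul_comm, h1]
    exact htr
  · have : ∀ μ, s' * c₀ μ * s * (s' * c₀ μ * s)ᴴ = s' * (c₀ μ * x * (c₀ μ)ᴴ) * s' := fun μ => by
      rw [← hss]
      simp only [Matrix.conjTranspose_mul, hsc, hsc', Matrix.mul_assoc]
    simp_rw [this]
    rw [← Matrix.sum_mul, ← Matrix.mul_sum, hc1, ← hss, ← Matrix.mul_assoc, hs2, Matrix.one_mul,
      hs1]
  · have : ∀ μ, (s' * c₀ μ * s)ᴴ * (s * l'.toBlocks₁₁ * s) * (s' * c₀ μ * s) =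
        s * ((c₀ μ)ᴴ * l'.toBlocks₁₁ * c₀ μ) * s := fun μ => by
      calc (s' * c₀ μ * s)ᴴ * (s * l'.toBlocks₁₁ * s) * (s' * c₀ μ * s) =
          s * (c₀ μ)ᴴ * (s' * s) * l'.toBlocks₁₁ * (s * s') * c₀ μ * s := by
            simp only [Matrix.conjTranspose_mul, hsc, hsc', Matrix.mul_assoc]
        _ = _ := by rw [hs1, hs2, Matrix.mul_one, Matrix.mul_one]; simp only [Matrix.mul_assoc]
    simp_rw [this]
    rw [← Matrix.sum_mul, ← Matrix.mul_sum, hc2]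
  · calc G' * P * b μ * (Pᴴ * G) = G' * B μ * G := by simp only [hB, Matrix.mul_assoc]
      _ = _ := by
        conv_lhs => rw [hblk μ, hG, hG', Matrix.fromBlocks_multiply, Matrix.fromBlocks_multiply]
        simp [hc₀]

theorem isCanonical_withProtected {d : ℕ} {c : Fin 3 → Matrix (Fin d) (Fin d) ℂ}
    {x : Matrix (Fin d) (Fin d) ℂ} (hx : x.PosDef) (htr : x.trace ≠ 0)
    (h1 : ∑ μ, c μ * (c μ)ᴴ = 1) (h2 : ∑ μ, (c μ)ᴴ * x * c μ = x) :
    ∃ Λ, IsCanonical (withProtected c) Λ := by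
  have hpos : 0 < x.trace := lt_of_le_of_ne hx.posSemidef.trace_nonneg htr.symm
  have hk : (0 : ℂ) < (2 * x.trace)⁻¹ := by
    have h3 : x.trace = (x.trace.re : ℂ) := by
      rw [Complex.ext_iff]; simp [(Complex.pos_iff.1 hpos).2.symm]
    have h4 := (Complex.pos_iff.1 hpos).1
    rw [h3]
    have : (0 : ℝ) < (2 * x.trace.re)⁻¹ := by positivity
    exact_mod_cast this
  refine ⟨(2 * x.trace)⁻¹ • ((1 : Matrix (Fin 2) (Fin 2) ℂ) ⊗ₖ x), ?_, ?_, ?_, ?_⟩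
  · simp only [withProtected, Matrix.conjTranspose_kronecker, ← Matrix.mul_kronecker_mul,
      pauli_conjTranspose, pauli_mul_self]
    rw [← Matrix.one_kronecker_one, ← h1]
    ext ⟨i, k⟩ ⟨j, l⟩
    simp [Matrix.sum_apply, Finset.mul_sum]
  · exact (Matrix.PosDef.one.kronecker hx).smul hk
  · rw [Matrix.trace_smul, Matrix.trace_kronecker, Matrix.trace_one]
    simp only [Fintype.card_fin, smul_eq_mul, Nat.cast_ofNat]
    field_simp
  · simp only [withProtected, Matrix.conjTranspose_kronecker, Matrix.mul_smul, Matrix.smul_mul,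
      ← Matrix.mul_kronecker_mul, pauli_conjTranspose, Matrix.mul_one, pauli_mul_self]
    rw [← Finset.smul_sum]
    congr 1
    conv_rhs => rw [← h2]
    ext ⟨i, k⟩ ⟨j, l⟩
    simp [Matrix.sum_apply, Finset.mul_sum]

/-- Restricting to the support of the right fixed point and rescaling makes the tensor right
canonical. Passing to the support of the left fixed point keeps this property, since the component
blocks leaving that support vanish, and makes the left fixed point definite. -/
theorem exists_isCanonicalFormOf {D : ℕ} {b : Fin 3 → Matrix (Fin D) (Fin D) ℂ}
    {r : Matrix (Fin D) (Fin D) ℂ} (hr : r.PosSemidef) (hm : Mixing (transfer b b) r) :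
    ∃ (d : ℕ) (c : Fin 3 → Matrix (Fin d) (Fin d) ℂ)
      (Λ : Matrix (Fin 2 × Fin d) (Fin 2 × Fin d) ℂ), IsCanonicalFormOf b c Λ := by
  obtain ⟨l, hl, hlf, htr⟩ := hm.exists_left_fixed
  obtain ⟨d₁, q, e₁, P, P', c₁, x₁, hP1, hP2, hx₁, htr₁, hr₁, hl₁, hb⟩ :=
    exists_right_block hr hl hm.fixed hlf htr
  obtain ⟨d, p, e₂, Q, c, x, hQ1, hQ2, hx, htrx, hrc, hlc, hc⟩ :=
    exists_left_block hx₁ hr₁ hl₁ htr₁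
  obtain ⟨Λ, hΛ⟩ := isCanonical_withProtected hx htrx hrc hlc
  -- The second reduction is block lower triangular. Moving its discarded block `p` to the front
  -- makes the whole form upper triangular.
  let ε : Fin p ⊕ (Fin d ⊕ Fin q) ≃ (Fin d ⊕ Fin p) ⊕ Fin q :=
    (Equiv.sumAssoc _ _ _).symm.trans (Equiv.sumCongr (Equiv.sumComm _ _) (Equiv.refl _))
  let e : Fin D ≃ Fin p ⊕ (Fin d ⊕ Fin q) :=
    (e₁.trans (Equiv.sumCongr e₂ (Equiv.refl _))).trans ε.symm
  set G : Matrix ((Fin d ⊕ Fin p) ⊕ Fin q) (Fin d₁ ⊕ Fin q) ℂ := Matrix.fromBlocks Q 0 0 1 with hG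
  set G' : Matrix (Fin d₁ ⊕ Fin q) ((Fin d ⊕ Fin p) ⊕ Fin q) ℂ :=
    Matrix.fromBlocks Qᴴ 0 0 1 with hG'
  set S : Matrix (Fin D) (Fin D) ℂ := (G * P).submatrix (fun i => ε (e i)) id with hS
  set S' : Matrix (Fin D) (Fin D) ℂ := (P' * G').submatrix id (fun i => ε (e i)) with hS'
  have hSS' : S * S' = 1 := by
    rw [hS, hS', ← Matrix.submatrix_mul _ _ _ _ _ Function.bijective_id, Matrix.mul_assoc,
      ← Matrix.mul_assoc P, hP1, Matrix.one_mul, hG, hG', Matrix.fromBlocks_multiply]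
    simp only [hQ1, Matrix.mul_zero, Matrix.zero_mul, add_zero, zero_add, Matrix.mul_one,
      Matrix.fromBlocks_one]
    exact Matrix.submatrix_one_equiv (e.trans ε)
  have hS'S : S' * S = 1 := mul_eq_one_comm.1 hSS'
  refine ⟨d, c, Λ, hΛ, p, q, e, ⟨S, S', hSS', hS'S⟩, fun μ => ?_⟩
  obtain ⟨v, s, hvs⟩ := hb μ
  obtain ⟨v₂, s₂, hvs₂⟩ := hc μ
  refine ⟨s₂, Matrix.fromCols v₂ ((Q * v).toRows₂), (Q * v).toRows₁, s, ?_⟩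
  have hprod : G * P * b μ * (P' * G') =
      Matrix.fromBlocks (Matrix.fromBlocks (c μ) 0 v₂ s₂) (Q * v) 0 s := by
    calc G * P * b μ * (P' * G') = G * (P * b μ * P') * G' := by simp only [Matrix.mul_assoc]
      _ = _ := by
        rw [hvs, hG, hG', Matrix.fromBlocks_multiply, Matrix.fromBlocks_multiply, ← hvs₂]
        simp
  have hconj : S * b μ * S' =
      (Matrix.fromBlocks (Matrix.fromBlocks (c μ) 0 v₂ s₂) (Q * v) 0 s :
        Matrix ((Fin d ⊕ Fin p) ⊕ Fin q) ((Fin d ⊕ Fin p) ⊕ Fin q) ℂ).submatrix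
        (fun i => ε (e i)) (fun i => ε (e i)) := by
    rw [← hprod]
    ext i j
    simp [hS, hS', Matrix.mul_apply]
  change Matrix.reindex e e (S * b μ * S') = _
  rw [hconj]
  ext (i | i | i) (j | j | j) <;> simp [ε, Matrix.toRows₁, Matrix.toRows₂]

/-! ### Normal tensors -/

section Normal

variable {m n : Type*} [Fintype m] [DecidableEq m] [Fintype n] [DecidableEq n]

/-- A canonical tensor whose transfer channel converges to its fixed point. -/
structure IsNormal (A : Fin 3 → Matrix n n ℂ) (Λ : Matrix n n ℂ) : Prop where
  canonical : IsCanonical A Λ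
  tendsto : ∀ X, Tendsto (fun j : ℕ => ((transfer A A) ^ j) X) atTop (𝓝 ((Λ * X).trace • 1))

/-- The hypothesis concerns all words, since compressing single letters to a block is not
multiplicative in general. It holds for the diagonal blocks of a triangular form. -/
theorem transfer_pow_compress {A : Fin 3 → Matrix n n ℂ} {C : Fin 3 → Matrix m m ℂ}
    {Q : Matrix m n ℂ} {J : Matrix n m ℂ}
    (h : ∀ {k : ℕ} (w : Fin k → Fin 3), Q * wordProd A w * J = wordProd C w) (k : ℕ)
    (X : Matrix m m ℂ) :
    ((transfer C C) ^ k) X = Q * ((transfer A A) ^ k) (J * X * Jᴴ) * Qᴴ := by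
  simp only [transfer_pow_apply, Matrix.mul_sum, Matrix.sum_mul]
  refine Finset.sum_congr rfl fun w _ => ?_
  rw [← h w]
  simp only [Matrix.conjTranspose_mul, Matrix.mul_assoc]

theorem transfer_pow_compress_eq_zero {l : Type*} [Fintype l] [DecidableEq l]
    {A : Fin 3 → Matrix n n ℂ} {Q : Matrix m n ℂ} {J : Matrix n l ℂ}
    (h : ∀ {k : ℕ} (w : Fin k → Fin 3), Q * wordProd A w * J = 0) (k : ℕ) (X : Matrix l l ℂ) :
    Q * ((transfer A A) ^ k) (J * X * Jᴴ) * Qᴴ = 0 := by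
  simp only [transfer_pow_apply, Matrix.mul_sum, Matrix.sum_mul]
  refine Finset.sum_eq_zero fun w _ => ?_
  have : Q * (wordProd A w * (J * X * Jᴴ) * (wordProd A w)ᴴ) * Qᴴ =
      (Q * wordProd A w * J) * X * (Jᴴ * (wordProd A w)ᴴ * Qᴴ) := by
    simp only [Matrix.mul_assoc]
  rw [this, h w, Matrix.zero_mul, Matrix.zero_mul]

theorem IsCanonical.transfer_one {A : Fin 3 → Matrix n n ℂ} {Λ : Matrix n n ℂ}
    (h : IsCanonical A Λ) : transfer A A 1 = 1 := by
  simp only [transfer_apply, Matrix.mul_one, h.right_fixed]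

theorem trace_mul_transfer_of_left_fixed {A : Fin 3 → Matrix n n ℂ} {Λ : Matrix n n ℂ}
    (h : ∑ μ, (A μ)ᴴ * Λ * A μ = Λ) (X : Matrix n n ℂ) :
    (Λ * transfer A A X).trace = (Λ * X).trace := by
  rw [trace_mul_transfer, transfer_apply]
  simp only [Matrix.conjTranspose_conjTranspose, h]

theorem trace_mul_transfer_pow_of_left_fixed {A : Fin 3 → Matrix n n ℂ} {Λ : Matrix n n ℂ}
    (h : ∑ μ, (A μ)ᴴ * Λ * A μ = Λ) (X : Matrix n n ℂ) (j : ℕ) :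
    (Λ * ((transfer A A) ^ j) X).trace = (Λ * X).trace := by
  induction j with
  | zero => simp
  | succ j ih => rw [pow_succ', Module.End.mul_apply, trace_mul_transfer_of_left_fixed h, ih]

theorem tendsto_compress {α : Type*} {f : Filter α} {F : α → Matrix n n ℂ} {R : Matrix n n ℂ}
    (h : Tendsto F f (𝓝 R)) (Q : Matrix m n ℂ) :
    Tendsto (fun a => Q * F a * Qᴴ) f (𝓝 (Q * R * Qᴴ)) := by
  have hc : Continuous fun X : Matrix n n ℂ => Q * X * Qᴴ := by fun_prop
  exact (hc.tendsto R).comp h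

theorem IsCanonical.nonempty {A : Fin 3 → Matrix n n ℂ} {Λ : Matrix n n ℂ}
    (h : IsCanonical A Λ) : Nonempty n := by
  by_contra hn
  rw [not_nonempty_iff] at hn
  have := h.left_trace
  simp [Matrix.trace] at this

/-- A canonical compression of a mixing tensor is normal. -/
theorem Mixing.isNormal_compress {A : Fin 3 → Matrix n n ℂ} {R : Matrix n n ℂ}
    (hR : Mixing (transfer A A) R) {C : Fin 3 → Matrix m m ℂ} {Λ : Matrix m m ℂ}
    (hC : IsCanonical C Λ) {Q : Matrix m n ℂ} {J : Matrix n m ℂ}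
    (h : ∀ {k : ℕ} (w : Fin k → Fin 3), Q * wordProd A w * J = wordProd C w) :
    IsNormal C Λ ∧ Q * R * Qᴴ ≠ 0 := by
  have hlim : ∀ X, ∃ k : ℂ, Tendsto (fun j : ℕ => ((transfer C C) ^ j) X) atTop
      (𝓝 (k • (Q * R * Qᴴ))) := by
    intro X
    obtain ⟨k, hk⟩ := hR.tendsto (J * X * Jᴴ)
    refine ⟨k, ?_⟩
    simp_rw [transfer_pow_compress h]
    simpa using tendsto_compress hk Q
  obtain ⟨k₁, hk₁⟩ := hlim 1
  -- The iterates of the identity are constant, so the compressed fixed point must be a nonzero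
  -- multiple of the identity.
  simp_rw [pow_apply_of_fixed hC.transfer_one] at hk₁
  have h1 : (1 : Matrix m m ℂ) = k₁ • (Q * R * Qᴴ) := tendsto_nhds_unique tendsto_const_nhds hk₁
  have := hC.nonempty
  have hk0 : k₁ ≠ 0 := by
    rintro rfl
    rw [zero_smul] at h1
    exact one_ne_zero h1
  have hQ : Q * R * Qᴴ = k₁⁻¹ • 1 := by rw [h1, smul_smul, inv_mul_cancel₀ hk0, one_smul]
  refine ⟨⟨hC, fun X => ?_⟩, by rw [hQ]; exact smul_ne_zero (inv_ne_zero hk0) one_ne_zero⟩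
  obtain ⟨k, hk⟩ := hlim X
  rw [hQ, smul_smul] at hk
  have hc : Continuous fun Y : Matrix m m ℂ => (Λ * Y).trace := by fun_prop
  have h2 := (hc.tendsto _).comp hk
  simp only [Function.comp_def, trace_mul_transfer_pow_of_left_fixed hC.left_fixed] at h2
  have h3 := tendsto_nhds_unique tendsto_const_nhds h2
  rw [Matrix.mul_smul, Matrix.trace_smul, Matrix.mul_one, hC.left_trace, smul_eq_mul, mul_one] at h3
  rwa [h3]

theorem IsNormal.eq_smul_one {A : Fin 3 → Matrix n n ℂ} {Λ X : Matrix n n ℂ} (h : IsNormal A Λ)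
    (hX : transfer A A X = X) : X = (Λ * X).trace • 1 := by
  have h1 := h.tendsto X
  simp_rw [pow_apply_of_fixed hX] at h1
  exact tendsto_nhds_unique tendsto_const_nhds h1

/-- The limiting projection `X ↦ tr(ΛX) 1` has trace `tr Λ = 1`. -/
theorem IsNormal.tendsto_mapTrace {A : Fin 3 → Matrix n n ℂ} {Λ : Matrix n n ℂ}
    (h : IsNormal A Λ) :
    Tendsto (fun j : ℕ => mapTrace ((transfer A A) ^ j)) atTop (𝓝 1) := by
  have h1 := SPTO.tendsto_mapTrace h.tendsto
  have h2 : ∑ i, ∑ j, ((Λ * Matrix.single i j (1 : ℂ)).trace • (1 : Matrix n n ℂ)) i j =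
      Λ.trace := by
    simp only [Matrix.trace_mul_single, MulOpposite.op_one, one_smul, Matrix.smul_apply,
      Matrix.one_apply, smul_eq_mul, mul_ite, mul_one, mul_zero, Finset.sum_ite_eq,
      Finset.mem_univ, if_true]
    rfl
  rwa [h2, h.canonical.left_trace] at h1

/-- If all traces of words of a normal tensor are asymptotically invariant under a permutation of
the physical basis, then the permutation is implemented by a unitary of the virtual space. -/
theorem IsNormal.exists_unitary_of_tendsto {A : Fin 3 → Matrix n n ℂ} {Λ : Matrix n n ℂ}
    (h : IsNormal A Λ) (s : Equiv.Perm (Fin 3))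
    (htr : Tendsto (fun j : ℕ => mapTrace ((transfer (fun i => A (s i)) A) ^ j)) atTop (𝓝 1)) :
    ∃ V : Matrix n n ℂ, V * Vᴴ = 1 ∧ Vᴴ * V = 1 ∧ ∀ i, A (s i) * V = V * A i := by
  set M := transfer (fun i => A (s i)) A with hM
  -- An overlap tending to one excludes pointwise decay of the mixed iterates, so the mixed map has
  -- an eigenvalue `μ` of modulus at least one.
  have hne : ∃ X i j, ¬ Tendsto (fun k : ℕ => (M ^ k) X i j) atTop (𝓝 0) := by
    by_contra! hc
    have h0 := SPTO.tendsto_mapTrace (T := fun k : ℕ => M ^ k) (L := fun _ => 0)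
      fun X => tendsto_matrix_iff.2 fun i j => hc X i j
    simp only [Matrix.zero_apply, Finset.sum_const_zero] at h0
    exact zero_ne_one (tendsto_nhds_unique h0 htr)
  obtain ⟨X, a, b, hX⟩ := hne
  obtain ⟨μ, hμ, V, hV0, hV⟩ :=
    exists_eigenvalue_of_not_tendsto_zero M X (Matrix.entryLinearMap ℂ ℂ a b) hX
  have hΛ := h.canonical.left_pos
  have hpos : (Vᴴ * Λ * V).trace ≠ 0 := by
    intro h0
    have h1 := ((hΛ.posSemidef.conjTranspose_mul_mul_same V).trace_eq_zero_iff).1 h0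
    have h2 := sum_mul_conjTranspose_eq_zero hΛ (B := fun _ => Vᴴ) (by simp [h1]) 0
    exact hV0 (by simpa using h2)
  have hnn : 0 ≤ (Vᴴ * Λ * V).trace := (hΛ.posSemidef.conjTranspose_mul_mul_same V).trace_nonneg
  -- `B` is the failure of `V` to intertwine the two tensors. Its `Λ`-weighted square norm is `(1 -
  -- |μ|²) tr(V† Λ V)`. Nonnegativity together with `|μ| ≥ 1` gives `|μ| = 1` and then `B = 0`.
  set B : Fin 3 → Matrix n n ℂ := fun i => A (s i) * V - μ • (V * A i) with hB
  have hBsum : ∑ i, B i * (B i)ᴴ = transfer A A (V * Vᴴ) - (μ * star μ) • (V * Vᴴ) := by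
    have e1 : ∑ i, A (s i) * V * (Vᴴ * (A (s i))ᴴ) = transfer A A (V * Vᴴ) := by
      rw [transfer_apply, ← Equiv.sum_comp s fun i => A i * (V * Vᴴ) * (A i)ᴴ]
      simp only [Matrix.mul_assoc]
    have e2 : ∑ i, A (s i) * V * ((A i)ᴴ * Vᴴ) = μ • (V * Vᴴ) := by
      rw [hM, transfer_apply] at hV
      rw [← Matrix.smul_mul, ← hV, Matrix.sum_mul]
      simp only [Matrix.mul_assoc]
    have e3 : ∑ i, V * A i * (Vᴴ * (A (s i))ᴴ) = star μ • (V * Vᴴ) := by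
      have := congrArg Matrix.conjTranspose e2
      simpa [Matrix.conjTranspose_sum, Matrix.conjTranspose_mul, Matrix.conjTranspose_smul,
        Matrix.mul_assoc] using this
    have e4 : ∑ i, V * A i * ((A i)ᴴ * Vᴴ) = V * Vᴴ := by
      have : ∀ i, V * A i * ((A i)ᴴ * Vᴴ) = V * (A i * (A i)ᴴ) * Vᴴ := fun i => by
        simp only [Matrix.mul_assoc]
      simp_rw [this]
      rw [← Matrix.sum_mul, ← Matrix.mul_sum, h.canonical.right_fixed, Matrix.mul_one]
    simp only [hB, Matrix.conjTranspose_sub, Matrix.conjTranspose_smul, Matrix.conjTranspose_mul,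
      Matrix.mul_sub, Matrix.sub_mul, Matrix.smul_mul, Matrix.mul_smul, Finset.sum_sub_distrib,
      ← Finset.smul_sum, e1, e2, e3, e4]
    module
  have htrB : (∑ i, (B i)ᴴ * Λ * B i).trace = (1 - μ * star μ) * (Vᴴ * Λ * V).trace := by
    have e1 : (∑ i, (B i)ᴴ * Λ * B i).trace = (Λ * ∑ i, B i * (B i)ᴴ).trace := by
      rw [Matrix.trace_sum, Matrix.mul_sum, Matrix.trace_sum]
      refine Finset.sum_congr rfl fun i _ => ?_
      rw [Matrix.mul_assoc, Matrix.trace_mul_comm, Matrix.mul_assoc]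
    have e2 : (Λ * (V * Vᴴ)).trace = (Vᴴ * Λ * V).trace := by
      rw [← Matrix.mul_assoc, Matrix.trace_mul_comm, Matrix.mul_assoc]
    rw [e1, hBsum, Matrix.mul_sub, Matrix.trace_sub,
      trace_mul_transfer_of_left_fixed h.canonical.left_fixed, Matrix.mul_smul, Matrix.trace_smul,
      e2, smul_eq_mul]
    ring
  have hBpsd : (∑ i, (B i)ᴴ * Λ * B i).PosSemidef :=
    Matrix.posSemidef_sum _ fun i _ => hΛ.posSemidef.conjTranspose_mul_mul_same _
  have hμμ : μ * star μ = ((‖μ‖ ^ 2 : ℝ) : ℂ) := by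
    rw [Complex.star_def, Complex.mul_conj, Complex.normSq_eq_norm_sq]
  have hμ1 : ‖μ‖ = 1 := by
    have h1 := hBpsd.trace_nonneg
    rw [htrB, hμμ] at h1
    have h2 : (Vᴴ * Λ * V).trace = ((Vᴴ * Λ * V).trace.re : ℂ) := by
      rw [Complex.ext_iff]; simp [(Complex.nonneg_iff.1 hnn).2.symm]
    have h3 : 0 < (Vᴴ * Λ * V).trace.re :=
      (Complex.pos_iff.1 (lt_of_le_of_ne hnn hpos.symm)).1
    rw [h2] at h1
    have h4 : 0 ≤ (1 - ‖μ‖ ^ 2) * (Vᴴ * Λ * V).trace.re := by exact_mod_cast h1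
    have h5 : 0 ≤ 1 - ‖μ‖ ^ 2 := nonneg_of_mul_nonneg_left h4 h3
    nlinarith
  have hint : ∀ i, A (s i) * V = μ • (V * A i) := by
    have h0 : ∑ i, (B i)ᴴ * Λ * B i = 0 := by
      refine (hBpsd.trace_eq_zero_iff).1 ?_
      rw [htrB, hμμ, hμ1]; simp
    intro i
    have := sum_mul_conjTranspose_eq_zero hΛ (B := fun i => (B i)ᴴ) (by simpa using h0) i
    rw [Matrix.conjTranspose_eq_zero] at this
    exact sub_eq_zero.1 this
  -- Exact intertwining makes `V V†` a fixed point of the channel, hence scalar by normality; a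
  -- rescaling of `V` is then unitary.
  have hfix : transfer A A (V * Vᴴ) = V * Vᴴ := by
    have h0 : ∑ i, B i * (B i)ᴴ = 0 := Finset.sum_eq_zero fun i _ => by
      simp [hB, hint i]
    rw [hBsum, hμμ, hμ1, sub_eq_zero] at h0
    simpa using h0
  have hVV := h.eq_smul_one hfix
  set κ := (Λ * (V * Vᴴ)).trace
  have hκ : κ = (Vᴴ * Λ * V).trace := by
    rw [← Matrix.trace_mul_cycle, Matrix.mul_assoc]
  have hκr : κ = (κ.re : ℂ) := by
    rw [Complex.ext_iff, hκ]; simp [(Complex.nonneg_iff.1 hnn).2.symm]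
  have hκpos : 0 < κ.re := by
    rw [hκ]; exact (Complex.pos_iff.1 (lt_of_le_of_ne hnn hpos.symm)).1
  set t : ℂ := ((Real.sqrt κ.re : ℝ) : ℂ)⁻¹ with ht
  have htt : t * star t * κ = 1 := by
    have h1 : t * star t = (κ.re : ℂ)⁻¹ := by
      rw [ht, Complex.star_def, map_inv₀, Complex.conj_ofReal, ← mul_inv, ← Complex.ofReal_mul,
        Real.mul_self_sqrt hκpos.le]
    rw [h1, ← hκr, inv_mul_cancel₀]
    rw [hκ]; exact hpos
  set W := t • V with hW
  have hWW : W * Wᴴ = 1 := by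
    rw [hW, Matrix.conjTranspose_smul, Matrix.smul_mul, Matrix.mul_smul, hVV, smul_smul, smul_smul,
      htt, one_smul]
  have hWW' : Wᴴ * W = 1 := mul_eq_one_comm.1 hWW
  have hintW : ∀ i, A (s i) * W = μ • (W * A i) := fun i => by
    rw [hW, Matrix.mul_smul, hint, Matrix.smul_mul, smul_comm]
  have hword : ∀ {k : ℕ} (w : Fin k → Fin 3),
      wordProd (fun i => A (s i)) w * W = μ ^ k • (W * wordProd A w) := by
    intro k
    induction k with
    | zero => intro w; simp
    | succ k ih =>
      intro w
      rw [← Fin.cons_self_tail w, wordProd_cons, wordProd_cons, Matrix.mul_assoc, ih,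
        Matrix.mul_smul, ← Matrix.mul_assoc, hintW, Matrix.smul_mul, smul_smul, pow_succ,
        Matrix.mul_assoc]
  have hwtr : ∀ {k : ℕ} (w : Fin k → Fin 3),
      (wordProd (fun i => A (s i)) w).trace = μ ^ k * (wordProd A w).trace := by
    intro k w
    calc (wordProd (fun i => A (s i)) w).trace
        = (wordProd (fun i => A (s i)) w * W * Wᴴ).trace := by
          rw [Matrix.mul_assoc, hWW, Matrix.mul_one]
      _ = _ := by
          rw [hword, Matrix.smul_mul, Matrix.trace_smul, Matrix.trace_mul_comm, ← Matrix.mul_assoc,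
            hWW', Matrix.one_mul, smul_eq_mul]
  -- The phase left over in the intertwining relation appears as `μᵏ` in the ratio of two overlaps
  -- that both tend to one.
  have hμpow : Tendsto (fun k : ℕ => μ ^ k) atTop (𝓝 1) := by
    have h1 : ∀ k : ℕ, mapTrace (M ^ k) = μ ^ k * mapTrace ((transfer A A) ^ k) := by
      intro k
      rw [hM, mapTrace_transfer_pow, mapTrace_transfer_pow, Finset.mul_sum]
      refine Finset.sum_congr rfl fun w _ => ?_
      rw [hwtr, mul_assoc]
    have h2 := htr.div h.tendsto_mapTrace one_ne_zero
    rw [div_one] at h2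
    refine h2.congr' ?_
    filter_upwards [h.tendsto_mapTrace.eventually_ne one_ne_zero] with k hk
    rw [Pi.div_apply, h1, mul_div_cancel_right₀ _ hk]
  have hμeq : μ = 1 := by
    have h1 := (tendsto_add_atTop_iff_nat 1).2 hμpow
    have h2 := hμpow.const_mul μ
    simp_rw [← pow_succ'] at h2
    simpa using (tendsto_nhds_unique h1 h2).symm
  refine ⟨W, hWW, hWW', fun i => ?_⟩
  rw [hintW, hμeq, one_smul]

end Normal

/-! ### The canonical form of a mixing tensor -/

theorem IsCanonicalFormOf.exists_block_words {D d : ℕ} {b : Fin 3 → Matrix (Fin D) (Fin D) ℂ}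
    {c : Fin 3 → Matrix (Fin d) (Fin d) ℂ} {Λ : Matrix (Fin 2 × Fin d) (Fin 2 × Fin d) ℂ}
    (h : IsCanonicalFormOf b c Λ) :
    ∃ (p q : ℕ) (P : Matrix (Fin p ⊕ (Fin d ⊕ Fin q)) (Fin D) ℂ)
      (P' : Matrix (Fin D) (Fin p ⊕ (Fin d ⊕ Fin q)) ℂ)
      (s : Fin 3 → Matrix (Fin p) (Fin p) ℂ) (z : Fin 3 → Matrix (Fin q) (Fin q) ℂ),
      P' * P = 1 ∧ ∀ {k : ℕ} (w : Fin k → Fin 3), ∃ t v, P * wordProd b w * P' =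
        Matrix.fromBlocks (wordProd s w) t 0
          (Matrix.fromBlocks (wordProd c w) v 0 (wordProd z w)) := by
  obtain ⟨-, p, q, e, g, hb⟩ := h
  choose s t v z hb using hb
  have hg1 : g.1 * (g⁻¹).1 = 1 := by rw [← Units.val_mul, mul_inv_cancel, Units.val_one]
  have hg2 : (g⁻¹).1 * g.1 = 1 := by rw [← Units.val_mul, inv_mul_cancel, Units.val_one]
  have hPP : g.1.submatrix e.symm id * (g⁻¹).1.submatrix id e.symm = 1 := by
    rw [← Matrix.submatrix_mul _ _ _ _ _ Function.bijective_id, hg1, Matrix.submatrix_one_equiv]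
  have hPP' : (g⁻¹).1.submatrix id e.symm * g.1.submatrix e.symm id = 1 := by
    rw [← Matrix.submatrix_mul _ _ _ _ _ e.symm.bijective, hg2, Matrix.submatrix_id_id]
  refine ⟨p, q, g.1.submatrix e.symm id, (g⁻¹).1.submatrix id e.symm, s, z, hPP', ?_⟩
  set P := g.1.submatrix e.symm id
  set P' := (g⁻¹).1.submatrix id e.symm
  have hb' : ∀ μ, P * b μ * P' =
      Matrix.fromBlocks (s μ) (t μ) 0 (Matrix.fromBlocks (c μ) (v μ) 0 (z μ)) := fun μ => by
    rw [← hb]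
    ext i j
    simp [P, P', Matrix.mul_apply]
  intro k
  induction k with
  | zero =>
    intro w
    exact ⟨0, 0, by simp [hPP]⟩
  | succ k ih =>
    intro w
    obtain ⟨t', v', hw⟩ := ih (Fin.tail w)
    rw [← Fin.cons_self_tail w]
    simp only [wordProd_cons]
    have : P * (b (w 0) * wordProd b (Fin.tail w)) * P' =
        (P * b (w 0) * P') * (P * wordProd b (Fin.tail w) * P') := by
      calc P * (b (w 0) * wordProd b (Fin.tail w)) * P' =
          P * (b (w 0) * (1 : Matrix (Fin D) (Fin D) ℂ) * wordProd b (Fin.tail w)) * P' := by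
            rw [Matrix.mul_one]
        _ = _ := by rw [← hPP']; simp only [Matrix.mul_assoc]
    rw [this, hb', hw, Matrix.fromBlocks_multiply, Matrix.fromBlocks_multiply]
    simp only [Matrix.mul_zero, Matrix.zero_mul, add_zero, zero_add]
    exact ⟨_, _, rfl⟩

/-! ### Splitting off the protected qubit -/

section Kronecker

variable {d : ℕ}

/-- Commuting with `σ_z` kills the off-diagonal blocks and commuting with `σ_x` equates the diagonal
ones. -/
theorem eq_one_kronecker_of_commute {X : Matrix (Fin 2 × Fin d) (Fin 2 × Fin d) ℂ}
    (h0 : (pauli 0 ⊗ₖ (1 : Matrix (Fin d) (Fin d) ℂ)) * X =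
      X * (pauli 0 ⊗ₖ (1 : Matrix (Fin d) (Fin d) ℂ)))
    (h2 : (pauli 2 ⊗ₖ (1 : Matrix (Fin d) (Fin d) ℂ)) * X =
      X * (pauli 2 ⊗ₖ (1 : Matrix (Fin d) (Fin d) ℂ))) :
    X = (1 : Matrix (Fin 2) (Fin 2) ℂ) ⊗ₖ X.submatrix (fun k => (0, k)) (fun k => (0, k)) := by
  have hx := fun i j => congrFun (congrFun h0 i) j
  have hz := fun i j => congrFun (congrFun h2 i) j
  simp only [Matrix.mul_apply, Matrix.kroneckerMap_apply, Fintype.sum_prod_type, pauli,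
    Matrix.one_apply, Fin.sum_univ_two] at hx hz
  ext ⟨i, k⟩ ⟨j, l⟩
  have hx1 := hx (0, k) (1, l)
  have hz1 := hz (0, k) (1, l)
  have hz2 := hz (1, k) (0, l)
  simp at hx1 hz1 hz2
  fin_cases i <;> fin_cases j <;> simp
  · linear_combination (-1 / 2 : ℂ) * hz1.symm
  · linear_combination (-1 / 2 : ℂ) * hz2
  · exact hx1

theorem wordProd_withProtected (b : Fin 3 → Matrix (Fin d) (Fin d) ℂ) {k : ℕ}
    (w : Fin k → Fin 3) :
    wordProd (withProtected b) w = wordProd pauli w ⊗ₖ wordProd b w := by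
  induction k with
  | zero => simp
  | succ k ih =>
    rw [← Fin.cons_self_tail w, wordProd_cons, wordProd_cons, wordProd_cons, ih,
      Matrix.mul_kronecker_mul]
    rfl

theorem kronecker_one_injective {x y : Matrix (Fin d) (Fin d) ℂ}
    (h : (1 : Matrix (Fin 2) (Fin 2) ℂ) ⊗ₖ x = (1 : Matrix (Fin 2) (Fin 2) ℂ) ⊗ₖ y) : x = y := by
  ext k l
  simpa using congrFun (congrFun h (0, k)) (0, l)

theorem one_kronecker_sum (f : Fin 3 → Matrix (Fin d) (Fin d) ℂ) :
    (1 : Matrix (Fin 2) (Fin 2) ℂ) ⊗ₖ (∑ μ, f μ) = ∑ μ, (1 : Matrix (Fin 2) (Fin 2) ℂ) ⊗ₖ f μ := by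
  ext ⟨i, k⟩ ⟨j, l⟩
  simp [Matrix.sum_apply, Finset.mul_sum]

/-- A Pauli matrix commutes or anticommutes with each component, and the sign occurs twice in the
channel. Pauli conjugation is thus a symmetry whatever the junk components are. -/
theorem transfer_withProtected_pauli_conj (c : Fin 3 → Matrix (Fin d) (Fin d) ℂ) (ν : Fin 3)
    (X : Matrix (Fin 2 × Fin d) (Fin 2 × Fin d) ℂ) :
    transfer (withProtected c) (withProtected c)
      (pauli ν ⊗ₖ (1 : Matrix (Fin d) (Fin d) ℂ) * X * pauli ν ⊗ₖ (1 : Matrix (Fin d) (Fin d) ℂ)) =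
    pauli ν ⊗ₖ (1 : Matrix (Fin d) (Fin d) ℂ) *
      transfer (withProtected c) (withProtected c) X *
      pauli ν ⊗ₖ (1 : Matrix (Fin d) (Fin d) ℂ) := by
  set S : Matrix (Fin 2 × Fin d) (Fin 2 × Fin d) ℂ := pauli ν ⊗ₖ (1 : Matrix (Fin d) (Fin d) ℂ)
    with hS
  have hSS : S * S = 1 := by
    rw [hS, ← Matrix.mul_kronecker_mul, pauli_mul_self, Matrix.mul_one, Matrix.one_kronecker_one]
  have hSc : Sᴴ = S := by
    rw [hS, Matrix.conjTranspose_kronecker, pauli_conjTranspose, Matrix.conjTranspose_one]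
  have hcomm : ∀ μ, ∃ ε : ℂ, ε * star ε = 1 ∧
      withProtected c μ * S = ε • (S * withProtected c μ) := by
    intro μ
    refine ⟨if ν = μ then 1 else -1, by split_ifs <;> simp, ?_⟩
    have h1 : S * withProtected c μ * S = (if ν = μ then 1 else -1 : ℂ) • withProtected c μ := by
      rw [hS, withProtected, ← Matrix.mul_kronecker_mul, ← Matrix.mul_kronecker_mul, pauli_conj,
        Matrix.one_mul, Matrix.mul_one, Matrix.smul_kronecker]
    rw [← Matrix.mul_smul, ← h1, ← Matrix.mul_assoc, ← Matrix.mul_assoc, hSS, Matrix.one_mul]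
  rw [transfer_apply, transfer_apply, Matrix.mul_sum, Matrix.sum_mul]
  refine Finset.sum_congr rfl fun μ _ => ?_
  obtain ⟨ε, hε, h⟩ := hcomm μ
  have h' : S * (withProtected c μ)ᴴ = star ε • ((withProtected c μ)ᴴ * S) := by
    have := congrArg Matrix.conjTranspose h
    simpa only [Matrix.conjTranspose_mul, Matrix.conjTranspose_smul, hSc] using this
  calc withProtected c μ * (S * X * S) * (withProtected c μ)ᴴ =
      (withProtected c μ * S) * X * (S * (withProtected c μ)ᴴ) := by simp only [Matrix.mul_assoc]
    _ = (ε * star ε) • (S * withProtected c μ * X * ((withProtected c μ)ᴴ * S)) := by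
      rw [h, h', Matrix.smul_mul, Matrix.smul_mul, Matrix.mul_smul, smul_smul]
    _ = _ := by rw [hε, one_smul]; simp only [Matrix.mul_assoc]

/-- The fixed point of a normal tensor on (protected space) ⊗ (junk space) is maximally mixed on
the protected space. -/
theorem IsNormal.exists_junk {c : Fin 3 → Matrix (Fin d) (Fin d) ℂ}
    {Λ : Matrix (Fin 2 × Fin d) (Fin 2 × Fin d) ℂ} (h : IsNormal (withProtected c) Λ) :
    ∃ l : Matrix (Fin d) (Fin d) ℂ, IsNormal c l ∧
      Λ = (1 / 2 : ℂ) • ((1 : Matrix (Fin 2) (Fin 2) ℂ) ⊗ₖ l) := by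
  have hne := h.canonical.nonempty
  -- The limit of the iterates is a scalar matrix, unchanged by Pauli conjugation, so the functional
  -- `X ↦ tr(ΛX)` inherits the symmetry of the channel.
  have htr : ∀ ν X, (Λ * (pauli ν ⊗ₖ (1 : Matrix (Fin d) (Fin d) ℂ) * X *
      pauli ν ⊗ₖ (1 : Matrix (Fin d) (Fin d) ℂ))).trace = (Λ * X).trace := by
    intro ν X
    set S : Matrix (Fin 2 × Fin d) (Fin 2 × Fin d) ℂ := pauli ν ⊗ₖ (1 : Matrix (Fin d) (Fin d) ℂ)
      with hS
    have hSS : S * S = 1 := by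
      rw [hS, ← Matrix.mul_kronecker_mul, pauli_mul_self, Matrix.mul_one, Matrix.one_kronecker_one]
    have hSc : Sᴴ = S := by
      rw [hS, Matrix.conjTranspose_kronecker, pauli_conjTranspose, Matrix.conjTranspose_one]
    have hpow : ∀ j : ℕ, ((transfer (withProtected c) (withProtected c)) ^ j) (S * X * S) =
        S * ((transfer (withProtected c) (withProtected c)) ^ j) X * S := by
      intro j
      induction j with
      | zero => simp
      | succ j ih =>
        rw [pow_succ', Module.End.mul_apply, ih, transfer_withProtected_pauli_conj,
          Module.End.mul_apply]
    have h1 := h.tendsto (S * X * S)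
    simp_rw [hpow] at h1
    have h2 := tendsto_compress (h.tendsto X) S
    rw [hSc] at h2
    have h3 := tendsto_nhds_unique h1 h2
    rw [Matrix.mul_smul, Matrix.smul_mul, Matrix.mul_one, hSS] at h3
    have h4 := congrFun (congrFun h3 hne.some) hne.some
    simpa using h4
  have hcomm : ∀ ν, (pauli ν ⊗ₖ (1 : Matrix (Fin d) (Fin d) ℂ)) * Λ =
      Λ * (pauli ν ⊗ₖ (1 : Matrix (Fin d) (Fin d) ℂ)) := by
    intro ν
    set S : Matrix (Fin 2 × Fin d) (Fin 2 × Fin d) ℂ := pauli ν ⊗ₖ (1 : Matrix (Fin d) (Fin d) ℂ)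
      with hS
    have hSS : S * S = 1 := by
      rw [hS, ← Matrix.mul_kronecker_mul, pauli_mul_self, Matrix.mul_one, Matrix.one_kronecker_one]
    have h1 : S * Λ * S = Λ := by
      ext i j
      have h2 := htr ν (Matrix.single j i 1)
      rw [Matrix.trace_mul_single, MulOpposite.op_one, one_smul] at h2
      rw [← h2, ← Matrix.mul_assoc, Matrix.trace_mul_comm, ← Matrix.mul_assoc, ← Matrix.mul_assoc,
        Matrix.trace_mul_single, MulOpposite.op_one, one_smul]
    conv_rhs => rw [← h1]
    rw [Matrix.mul_assoc (S * Λ), hSS, Matrix.mul_one]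
  set l₀ := Λ.submatrix (fun k : Fin d => ((0 : Fin 2), k)) (fun k => (0, k)) with hl₀
  have hΛ₀ : Λ = (1 : Matrix (Fin 2) (Fin 2) ℂ) ⊗ₖ l₀ :=
    eq_one_kronecker_of_commute (hcomm 0) (hcomm 2)
  have hΛ : Λ = (1 / 2 : ℂ) • ((1 : Matrix (Fin 2) (Fin 2) ℂ) ⊗ₖ ((2 : ℂ) • l₀)) := by
    rw [Matrix.kronecker_smul, smul_smul, ← hΛ₀]; norm_num
  have hl₀pos : l₀.PosDef :=
    h.canonical.left_pos.submatrix (fun a b hab => (Prod.ext_iff.1 hab).2)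
  have hcan : IsCanonical c ((2 : ℂ) • l₀) := by
    refine ⟨?_, hl₀pos.smul (by norm_num), ?_, ?_⟩
    · apply kronecker_one_injective
      have := h.canonical.right_fixed
      simp only [withProtected, Matrix.conjTranspose_kronecker, ← Matrix.mul_kronecker_mul,
        pauli_conjTranspose, pauli_mul_self, ← one_kronecker_sum] at this
      rw [this, Matrix.one_kronecker_one]
    · have := h.canonical.left_trace
      rw [hΛ₀, Matrix.trace_kronecker, Matrix.trace_one] at this
      simpa using this
    · rw [← Finset.sum_congr rfl fun μ _ => (by
        rw [Matrix.mul_smul, Matrix.smul_mul] :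
        (2 : ℂ) • ((c μ)ᴴ * l₀ * c μ) = (c μ)ᴴ * ((2 : ℂ) • l₀) * c μ), ← Finset.smul_sum]
      congr 1
      apply kronecker_one_injective
      have := h.canonical.left_fixed
      rw [hΛ₀] at this
      simpa only [withProtected, Matrix.conjTranspose_kronecker, ← Matrix.mul_kronecker_mul,
        pauli_conjTranspose, Matrix.mul_one, pauli_mul_self, ← one_kronecker_sum] using this
  refine ⟨(2 : ℂ) • l₀, ⟨hcan, fun x => ?_⟩, hΛ⟩
  have h1 := h.tendsto ((1 : Matrix (Fin 2) (Fin 2) ℂ) ⊗ₖ x)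
  simp_rw [transfer_withProtected_pow_one_kronecker] at h1
  have h2 : (Λ * ((1 : Matrix (Fin 2) (Fin 2) ℂ) ⊗ₖ x)).trace = ((2 : ℂ) • l₀ * x).trace := by
    rw [hΛ₀, ← Matrix.mul_kronecker_mul, Matrix.trace_kronecker, Matrix.mul_one, Matrix.trace_one,
      Matrix.smul_mul, Matrix.trace_smul]
    simp
  rw [h2] at h1
  rw [tendsto_matrix_iff] at h1 ⊢
  intro k l
  simpa [Matrix.one_apply] using h1 (0, k) (0, l)

end Kronecker

/-! ### Traces of words of the fixed point and of its canonical block -/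

section Form

variable {D d : ℕ} {b : Fin 3 → Matrix (Fin D) (Fin D) ℂ} {c : Fin 3 → Matrix (Fin d) (Fin d) ℂ}
  {Λ : Matrix (Fin 2 × Fin d) (Fin 2 × Fin d) ℂ}

theorem IsCanonicalFormOf.isNormal {R : Matrix (Fin 2 × Fin D) (Fin 2 × Fin D) ℂ}
    (hR : Mixing (transfer (withProtected b) (withProtected b)) R)
    (h : IsCanonicalFormOf b c Λ) : IsNormal (withProtected c) Λ := by
  obtain ⟨p, q, P, P', s, z, -, hw⟩ := h.exists_block_words
  refine (hR.isNormal_compress h.1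
    (Q := (1 : Matrix (Fin 2) (Fin 2) ℂ) ⊗ₖ P.submatrix (fun i => Sum.inr (Sum.inl i)) id)
    (J := (1 : Matrix (Fin 2) (Fin 2) ℂ) ⊗ₖ P'.submatrix id (fun i => Sum.inr (Sum.inl i)))
    fun w => ?_).1
  rw [wordProd_withProtected, ← Matrix.mul_kronecker_mul, ← Matrix.mul_kronecker_mul,
    Matrix.one_mul, Matrix.mul_one, wordProd_withProtected]
  congr 1
  obtain ⟨t, v, hw⟩ := hw w
  have : P.submatrix (fun i => Sum.inr (Sum.inl i)) id * wordProd b w *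
      P'.submatrix id (fun i => Sum.inr (Sum.inl i)) =
      (P * wordProd b w * P').submatrix (fun i => Sum.inr (Sum.inl i))
        (fun i => Sum.inr (Sum.inl i)) := by
    ext i j; simp [Matrix.mul_apply]
  rw [this, hw]
  ext i j; simp

/-- The traces of the words of a mixing tensor and of its canonical form agree asymptotically. -/
theorem IsCanonicalFormOf.tendsto_trace_sub {r : Matrix (Fin D) (Fin D) ℂ}
    {x : Matrix (Fin d) (Fin d) ℂ}
    (hr : Mixing (transfer b b) r) (h : IsCanonicalFormOf b c Λ) (hc : IsNormal c x) :
    Tendsto (fun j : ℕ => ∑ w : Fin j → Fin 3,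
      ‖(wordProd b w).trace - (wordProd c w).trace‖ ^ 2) atTop (𝓝 0) := by
  obtain ⟨p, q, P, P', s, z, hPP, hw⟩ := h.exists_block_words
  set Qs := P.submatrix (Sum.inl : Fin p → _) id with hQs
  set Js := P'.submatrix id (Sum.inl : Fin p → Fin p ⊕ (Fin d ⊕ Fin q)) with hJs
  set Qc := P.submatrix (fun i : Fin d => (Sum.inr (Sum.inl i) : Fin p ⊕ (Fin d ⊕ Fin q))) id
    with hQc
  set Jc := P'.submatrix id (fun i : Fin d => (Sum.inr (Sum.inl i) : Fin p ⊕ (Fin d ⊕ Fin q)))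
    with hJc
  set Qz := P.submatrix (fun i : Fin q => (Sum.inr (Sum.inr i) : Fin p ⊕ (Fin d ⊕ Fin q))) id
    with hQz
  set Jz := P'.submatrix id (fun i : Fin q => (Sum.inr (Sum.inr i) : Fin p ⊕ (Fin d ⊕ Fin q)))
    with hJz
  have hsub : ∀ {α β : Type} [Fintype α] [Fintype β] (f : α → Fin p ⊕ (Fin d ⊕ Fin q))
      (g : β → Fin p ⊕ (Fin d ⊕ Fin q)) (M : Matrix (Fin D) (Fin D) ℂ),
      P.submatrix f id * M * P'.submatrix id g = (P * M * P').submatrix f g := by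
    intro α β _ _ f g M
    ext i j; simp [Matrix.mul_apply]
  have hss : ∀ {k : ℕ} (w : Fin k → Fin 3), Qs * wordProd b w * Js = wordProd s w := fun w => by
    obtain ⟨t, v, hw⟩ := hw w
    rw [hQs, hJs, hsub, hw]; ext i j; simp
  have hcc : ∀ {k : ℕ} (w : Fin k → Fin 3), Qc * wordProd b w * Jc = wordProd c w := fun w => by
    obtain ⟨t, v, hw⟩ := hw w
    rw [hQc, hJc, hsub, hw]; ext i j; simp
  have hzz : ∀ {k : ℕ} (w : Fin k → Fin 3), Qz * wordProd b w * Jz = wordProd z w := fun w => by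
    obtain ⟨t, v, hw⟩ := hw w
    rw [hQz, hJz, hsub, hw]; ext i j; simp
  have hcs : ∀ {k : ℕ} (w : Fin k → Fin 3), Qc * wordProd b w * Js = 0 := fun w => by
    obtain ⟨t, v, hw⟩ := hw w
    rw [hQc, hJs, hsub, hw]; ext i j; simp
  have hzc : ∀ {k : ℕ} (w : Fin k → Fin 3), Qz * wordProd b w * Jc = 0 := fun w => by
    obtain ⟨t, v, hw⟩ := hw w
    rw [hQz, hJc, hsub, hw]; ext i j; simp
  have htrace : ∀ {k : ℕ} (w : Fin k → Fin 3), (wordProd b w).trace - (wordProd c w).trace =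
      (wordProd s w).trace + (wordProd z w).trace := fun w => by
    have h1 : (wordProd b w).trace = (P * wordProd b w * P').trace := by
      rw [Matrix.trace_mul_comm, ← Matrix.mul_assoc, hPP, Matrix.one_mul]
    obtain ⟨t, v, hw⟩ := hw w
    rw [h1, hw, trace_fromBlocks_eq, trace_fromBlocks_eq]
    ring
  have hQr : Qc * r * Qcᴴ ≠ 0 := (hr.isNormal_compress hc.canonical hcc).2
  -- Words starting in the invariant block `s` never reach `c`, whereas the fixed point `r` has a
  -- nonzero `c` component; so the limit multiple of `r` is zero.
  have hslim : ∀ y, Tendsto (fun j : ℕ => ((transfer s s) ^ j) y) atTop (𝓝 0) := by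
    intro y
    obtain ⟨k, hk⟩ := hr.tendsto (Js * y * Jsᴴ)
    have h1 := tendsto_compress hk Qc
    simp_rw [transfer_pow_compress_eq_zero hcs] at h1
    have h2 := tendsto_nhds_unique tendsto_const_nhds h1
    rw [Matrix.mul_smul, Matrix.smul_mul] at h2
    have hk0 : k = 0 := (smul_eq_zero.1 h2.symm).resolve_right hQr
    simp_rw [transfer_pow_compress hss]
    simpa [hk0] using tendsto_compress hk Qs
  have hzlim : ∀ y, Tendsto (fun j : ℕ => ((transfer z z) ^ j) y) atTop (𝓝 0) := by
    -- Iterating from the block `c` produces a nonzero multiple of `r` without ever entering `z`;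
    -- hence `r` has no component there.
    have hQz0 : Qz * r * Qzᴴ = 0 := by
      obtain ⟨k, hk⟩ := hr.tendsto (Jc * (1 : Matrix (Fin d) (Fin d) ℂ) * Jcᴴ)
      have h1 := tendsto_compress hk Qz
      simp_rw [transfer_pow_compress_eq_zero hzc] at h1
      have h2 := tendsto_nhds_unique tendsto_const_nhds h1
      rw [Matrix.mul_smul, Matrix.smul_mul] at h2
      refine (smul_eq_zero.1 h2.symm).resolve_left ?_
      rintro rfl
      have h3 := tendsto_compress hk Qc
      simp_rw [← transfer_pow_compress hcc, pow_apply_of_fixed hc.canonical.transfer_one] at h3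
      have h4 := tendsto_nhds_unique tendsto_const_nhds h3
      have := hc.canonical.nonempty
      simp at h4
    intro y
    obtain ⟨k, hk⟩ := hr.tendsto (Jz * y * Jzᴴ)
    simp_rw [transfer_pow_compress hzz]
    have h1 := tendsto_compress hk Qz
    rwa [Matrix.mul_smul, Matrix.smul_mul, hQz0, smul_zero] at h1
  have hnorm : ∀ {e : ℕ} (y : Fin 3 → Matrix (Fin e) (Fin e) ℂ),
      (∀ Y, Tendsto (fun j : ℕ => ((transfer y y) ^ j) Y) atTop (𝓝 0)) →
      Tendsto (fun j : ℕ => ∑ w : Fin j → Fin 3, ‖(wordProd y w).trace‖ ^ 2) atTop (𝓝 0) := by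
    intro e y hy
    have h1 := (tendsto_mapTrace hy).norm
    simp only [Matrix.zero_apply, Finset.sum_const_zero, norm_zero] at h1
    refine h1.congr fun j => ?_
    rw [mapTrace_transfer_pow]
    have : ∑ w : Fin j → Fin 3, (wordProd y w).trace * star (wordProd y w).trace =
        ((∑ w : Fin j → Fin 3, ‖(wordProd y w).trace‖ ^ 2 : ℝ) : ℂ) := by
      push_cast
      refine Finset.sum_congr rfl fun w _ => ?_
      rw [Complex.star_def, Complex.mul_conj, Complex.normSq_eq_norm_sq]
      push_cast; rfl
    rw [this, Complex.norm_real, Real.norm_of_nonneg (by positivity)]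
  have hbound := ((hnorm s hslim).add (hnorm z hzlim)).const_mul 2
  rw [add_zero, mul_zero] at hbound
  refine squeeze_zero (fun j => by positivity) (fun j => ?_) hbound
  rw [← Finset.sum_add_distrib, Finset.mul_sum]
  refine Finset.sum_le_sum fun w _ => ?_
  rw [htrace]
  have h1 := norm_add_le (wordProd s w).trace (wordProd z w).trace
  have h2 := norm_nonneg ((wordProd s w).trace + (wordProd z w).trace)
  nlinarith [sq_nonneg (‖(wordProd s w).trace‖ - ‖(wordProd z w).trace‖)]

/-- A permutation of the physical basis which preserves the traces of all words of a mixing tensor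
is implemented by a unitary on its canonical form. -/
theorem IsCanonicalFormOf.exists_unitary {r : Matrix (Fin D) (Fin D) ℂ}
    {x : Matrix (Fin d) (Fin d) ℂ}
    (hr : Mixing (transfer b b) r) (h : IsCanonicalFormOf b c Λ) (hc : IsNormal c x)
    (s : Equiv.Perm (Fin 3))
    (hs : ∀ {k : ℕ} (w : Fin k → Fin 3),
      (wordProd (fun i => b (s i)) w).trace = (wordProd b w).trace) :
    ∃ V : Matrix (Fin d) (Fin d) ℂ, V * Vᴴ = 1 ∧ Vᴴ * V = 1 ∧ ∀ i, c (s i) * V = V * c i := by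
  refine hc.exists_unitary_of_tendsto s ?_
  have hdiff := h.tendsto_trace_sub hr hc
  have hperm : ∀ (a : ∀ k, (Fin k → Fin 3) → ℝ) (j : ℕ),
      ∑ w : Fin j → Fin 3, a j (s ∘ w) = ∑ w : Fin j → Fin 3, a j w := fun a j =>
    Equiv.sum_comp (Equiv.arrowCongr (Equiv.refl (Fin j)) s) (a j)
  have hword : ∀ {e : ℕ} (y : Fin 3 → Matrix (Fin e) (Fin e) ℂ) {k : ℕ} (w : Fin k → Fin 3),
      wordProd (fun i => y (s i)) w = wordProd y (s ∘ w) := fun y k w => rfl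
  have hT := hc.tendsto_mapTrace
  have hreal : ∀ j : ℕ, mapTrace ((transfer c c) ^ j) =
      ((∑ w : Fin j → Fin 3, ‖(wordProd c w).trace‖ ^ 2 : ℝ) : ℂ) := by
    intro j
    rw [mapTrace_transfer_pow]
    push_cast
    refine Finset.sum_congr rfl fun w _ => ?_
    rw [Complex.star_def, Complex.mul_conj, Complex.normSq_eq_norm_sq]
    push_cast; rfl
  have hN : Tendsto (fun j : ℕ => ∑ w : Fin j → Fin 3, ‖(wordProd c w).trace‖ ^ 2) atTop
      (𝓝 1) := by
    have h1 := (Complex.continuous_re.tendsto _).comp hT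
    simp only [Function.comp_def, hreal, Complex.ofReal_re, Complex.one_re] at h1
    exact h1
  set u : ∀ k, (Fin k → Fin 3) → ℂ := fun k w =>
    (wordProd (fun i => c (s i)) w).trace - (wordProd c w).trace with hu
  -- The traces for `b` are exactly invariant, so the defect for `c` at a word is a difference of
  -- two approximation errors, at the word and at its permuted copy.
  have hU : Tendsto (fun j : ℕ => ∑ w : Fin j → Fin 3, ‖u j w‖ ^ 2) atTop (𝓝 0) := by
    have h4 := hdiff.const_mul 4
    rw [mul_zero] at h4
    refine squeeze_zero (fun j => by positivity) (fun j => ?_) h4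
    set δ : ∀ k, (Fin k → Fin 3) → ℂ := fun k w => (wordProd b w).trace - (wordProd c w).trace
    have h5 : ∀ w : Fin j → Fin 3, ‖u j w‖ ^ 2 ≤ 2 * (‖δ j w‖ ^ 2 + ‖δ j (s ∘ w)‖ ^ 2) := by
      intro w
      have h6 : u j w = δ j w - δ j (s ∘ w) := by
        simp only [hu, δ, hword, ← hs w]
        ring
      rw [h6]
      have h7 := norm_sub_le (δ j w) (δ j (s ∘ w))
      have h8 := norm_nonneg (δ j w - δ j (s ∘ w))
      nlinarith [sq_nonneg (‖δ j w‖ - ‖δ j (s ∘ w)‖)]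
    refine (Finset.sum_le_sum fun w _ => h5 w).trans (le_of_eq ?_)
    rw [← Finset.mul_sum, Finset.sum_add_distrib, hperm (fun k w => ‖δ k w‖ ^ 2)]
    ring
  have hsplit : ∀ j : ℕ, mapTrace ((transfer (fun i => c (s i)) c) ^ j) =
      (∑ w : Fin j → Fin 3, u j w * star (wordProd c w).trace) + mapTrace ((transfer c c) ^ j) := by
    intro j
    rw [mapTrace_transfer_pow, mapTrace_transfer_pow, ← Finset.sum_add_distrib]
    refine Finset.sum_congr rfl fun w _ => ?_
    simp only [hu]
    ring
  simp_rw [hsplit]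
  -- Cauchy-Schwarz over words: the defects tend to zero in square sum while the traces for `c` have
  -- square sum tending to one.
  have hzero : Tendsto (fun j : ℕ => ∑ w : Fin j → Fin 3, u j w * star (wordProd c w).trace) atTop
      (𝓝 0) := by
    have h1 := (hU.mul hN).sqrt
    rw [zero_mul, Real.sqrt_zero] at h1
    refine squeeze_zero_norm (fun j => ?_) h1
    refine (norm_sum_le _ _).trans ?_
    apply Real.le_sqrt_of_sq_le
    simp only [norm_mul, norm_star]
    exact Finset.sum_mul_sq_le_sq_mul_sq _ _ _
  simpa using hzero.add hT

end Form

/-! ### The string order parameter -/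

section StringOrder

variable {d : ℕ}

/-- The equality case of Cauchy-Schwarz for the faithful state `l`: with `t = tr(lV)`, the
`l`-weighted square norm of `V - t` is `1 - |t|²`. -/
theorem IsNormal.norm_trace_mul_unitary_sq {n : Type*} [Fintype n] [DecidableEq n]
    {A : Fin 3 → Matrix n n ℂ} {l V : Matrix n n ℂ} (h : IsNormal A l) (hV : V * Vᴴ = 1) :
    ‖(l * V).trace‖ ^ 2 ≤ 1 ∧ (‖(l * V).trace‖ ^ 2 = 1 → V = (l * V).trace • 1) := by
  set t := (l * V).trace with ht
  set B := V - t • 1 with hB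
  have hl := h.canonical.left_pos
  have h1 : (Bᴴ * l * B).trace = ((1 - ‖t‖ ^ 2 : ℝ) : ℂ) := by
    have e1 : (Bᴴ * l * B).trace = (l * (B * Bᴴ)).trace := by
      rw [Matrix.mul_assoc, Matrix.trace_mul_comm, Matrix.mul_assoc]
    have e2 : (l * Vᴴ).trace = star t := by
      rw [ht, ← Matrix.trace_conjTranspose, Matrix.conjTranspose_mul, hl.1.eq, Matrix.trace_mul_comm]
    have e3 : B * Bᴴ = 1 - star t • V - t • Vᴴ + (t * star t) • 1 := by
      rw [hB, Matrix.conjTranspose_sub, Matrix.conjTranspose_smul, Matrix.conjTranspose_one,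
        Matrix.sub_mul, Matrix.mul_sub, Matrix.mul_sub, hV]
      simp only [Matrix.smul_mul, Matrix.mul_smul, Matrix.one_mul, Matrix.mul_one, smul_smul]
      rw [mul_comm (star t) t]
      abel
    rw [e1, e3]
    simp only [Matrix.mul_add, Matrix.mul_sub, Matrix.mul_smul, Matrix.mul_one, Matrix.trace_add,
      Matrix.trace_sub, Matrix.trace_smul, h.canonical.left_trace, e2, ← ht, smul_eq_mul]
    have e4 : t * star t = ((‖t‖ ^ 2 : ℝ) : ℂ) := by
      rw [Complex.star_def, Complex.mul_conj, Complex.normSq_eq_norm_sq]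
    rw [mul_comm (star t) t, e4]
    push_cast
    ring
  have hpsd := hl.posSemidef.conjTranspose_mul_mul_same B
  refine ⟨?_, fun h2 => ?_⟩
  · have := hpsd.trace_nonneg
    rw [h1] at this
    have : (0 : ℝ) ≤ 1 - ‖t‖ ^ 2 := by exact_mod_cast this
    linarith
  · rw [h2, sub_self, Complex.ofReal_zero] at h1
    have h3 := (hpsd.trace_eq_zero_iff).1 h1
    have h4 := sum_mul_conjTranspose_eq_zero hl (B := fun _ => Bᴴ) (by simp [h3]) 0
    rw [Matrix.conjTranspose_eq_zero] at h4
    exact sub_eq_zero.1 h4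

/-- For `Y = T ⊗ V` the twisted channel is `X ↦ Y E(Y† X)`, so its iterates on `1 = Y Y†` telescope
to `Y Eⁿ(Y†)`. The limit is `|tr ΛY|² = |tr T|² |tr lV|² / 4`. The form of `hw` keeps the signs of
the rotation on the Pauli side, so the junk components are merely permuted. -/
theorem tendsto_stringExpectation {c : Fin 3 → Matrix (Fin d) (Fin d) ℂ}
    {Λ : Matrix (Fin 2 × Fin d) (Fin 2 × Fin d) ℂ} {l V : Matrix (Fin d) (Fin d) ℂ}
    (hN : IsNormal (withProtected c) Λ) (hl : l.IsHermitian)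
    (hΛ : Λ = (1 / 2 : ℂ) • ((1 : Matrix (Fin 2) (Fin 2) ℂ) ⊗ₖ l)) {s : Equiv.Perm (Fin 3)}
    (hV : V * Vᴴ = 1) (hcV : ∀ i, c (s i) * V = V * c i) {w : Matrix (Fin 3) (Fin 3) ℂ}
    {T : Matrix (Fin 2) (Fin 2) ℂ} (hT : T * Tᴴ = 1) (htr : ‖T.trace‖ ^ 2 = 2)
    (hw : ∀ ν η, w ν η • pauli η = if η = s ν then T * pauli ν * Tᴴ else 0) :
    Tendsto (stringExpectation (withProtected c) Λ w) atTop
      (𝓝 ((‖(l * V).trace‖ ^ 2 / 2 : ℝ) : ℂ)) := by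
  set Y : Matrix (Fin 2 × Fin d) (Fin 2 × Fin d) ℂ := T ⊗ₖ V with hY
  have hYY : Yᴴ * Y = 1 := by
    rw [hY, Matrix.conjTranspose_kronecker, ← Matrix.mul_kronecker_mul, mul_eq_one_comm.1 hT,
      mul_eq_one_comm.1 hV, Matrix.one_kronecker_one]
  have hA : ∀ ν, ∑ η, w ν η • withProtected c η = Y * withProtected c ν * Yᴴ := by
    intro ν
    have h1 : ∀ η, w ν η • withProtected c η =
        if η = s ν then (T * pauli ν * Tᴴ) ⊗ₖ c (s ν) else 0 := by
      intro η
      rw [withProtected, ← Matrix.smul_kronecker, hw]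
      split_ifs with h
      · rw [h]
      · rw [Matrix.zero_kronecker]
    have h2 : c (s ν) = V * c ν * Vᴴ := by
      rw [← hcV, Matrix.mul_assoc, hV, Matrix.mul_one]
    simp_rw [h1]
    rw [Finset.sum_ite_eq' Finset.univ, if_pos (Finset.mem_univ _), h2, hY, withProtected,
      Matrix.conjTranspose_kronecker, ← Matrix.mul_kronecker_mul, ← Matrix.mul_kronecker_mul]
  have hE : ∀ X, twistedChannel w (withProtected c) X =
      Y * transfer (withProtected c) (withProtected c) (Yᴴ * X) := by
    intro X
    rw [twistedChannel_eq_transfer]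
    simp only [transfer_apply, hA, Matrix.mul_sum]
    exact Finset.sum_congr rfl fun ν _ => by simp only [Matrix.mul_assoc]
  have hEn : ∀ (n : ℕ) (X), ((twistedChannel w (withProtected c)) ^ n) (Y * X) =
      Y * ((transfer (withProtected c) (withProtected c)) ^ n) X := by
    intro n X
    induction n with
    | zero => simp
    | succ n ih =>
      rw [pow_succ', Module.End.mul_apply, ih, hE, ← Matrix.mul_assoc Yᴴ, hYY, Matrix.one_mul,
        pow_succ', Module.End.mul_apply]
  have hYY' : Y * Yᴴ = 1 := mul_eq_one_comm.1 hYY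
  have h1 := hN.tendsto Yᴴ
  have hc : Continuous fun X : Matrix (Fin 2 × Fin d) (Fin 2 × Fin d) ℂ => (Λ * (Y * X)).trace := by
    fun_prop
  have h2 := (hc.tendsto _).comp h1
  have h3 : (fun X : Matrix (Fin 2 × Fin d) (Fin 2 × Fin d) ℂ => (Λ * (Y * X)).trace) ∘
      (fun j : ℕ => ((transfer (withProtected c) (withProtected c)) ^ j) Yᴴ) =
      stringExpectation (withProtected c) Λ w := by
    ext n
    simp only [Function.comp, stringExpectation, ← hEn, hYY']
  rw [h3] at h2
  convert h2 using 2
  have e1 : (Λ * Y).trace = (1 / 2 : ℂ) * (T.trace * (l * V).trace) := by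
    rw [hΛ, hY, Matrix.smul_mul, ← Matrix.mul_kronecker_mul, Matrix.trace_smul,
      Matrix.trace_kronecker, Matrix.one_mul, smul_eq_mul]
  have e2 : (Λ * Yᴴ).trace = star (Λ * Y).trace := by
    have hΛh : Λᴴ = Λ := by
      rw [hΛ, Matrix.conjTranspose_smul, Matrix.conjTranspose_kronecker, Matrix.conjTranspose_one,
        hl.eq]
      simp
    rw [← Matrix.trace_conjTranspose, Matrix.conjTranspose_mul, hΛh, Matrix.trace_mul_comm]
  rw [Matrix.mul_smul, Matrix.mul_smul, Matrix.trace_smul, Matrix.mul_one, e2, e1, smul_eq_mul,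
    mul_comm, Complex.star_def, Complex.mul_conj, Complex.normSq_eq_norm_sq, norm_mul, norm_mul]
  congr 1
  rw [mul_pow, mul_pow, htr]
  norm_num
  ring

/-- The spin-1/2 rotation by `-π / 2` about the axis `κ`. -/
def quarterTurn (κ : Fin 3) : Matrix (Fin 2) (Fin 2) ℂ :=
  (((Real.sqrt 2 : ℝ) : ℂ)⁻¹) • (1 + Complex.I • pauli κ)

theorem sqrt_two_inv_mul_self :
    (((Real.sqrt 2 : ℝ) : ℂ)⁻¹) * (((Real.sqrt 2 : ℝ) : ℂ)⁻¹) = 1 / 2 := by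
  rw [← mul_inv, ← Complex.ofReal_mul, Real.mul_self_sqrt (by norm_num)]
  norm_num

theorem quarterTurn_conjTranspose (κ : Fin 3) :
    (quarterTurn κ)ᴴ = (((Real.sqrt 2 : ℝ) : ℂ)⁻¹) • (1 - Complex.I • pauli κ) := by
  simp [quarterTurn, Matrix.conjTranspose_smul, Matrix.conjTranspose_add, pauli_conjTranspose,
    sub_eq_add_neg]

theorem quarterTurn_mul_conjTranspose (κ : Fin 3) : quarterTurn κ * (quarterTurn κ)ᴴ = 1 := by
  rw [quarterTurn_conjTranspose, quarterTurn, Matrix.smul_mul, Matrix.mul_smul, smul_smul,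
    sqrt_two_inv_mul_self]
  have : (1 + Complex.I • pauli κ) * (1 - Complex.I • pauli κ) = (2 : ℂ) • 1 := by
    rw [Matrix.add_mul, Matrix.mul_sub, Matrix.mul_sub]
    simp only [Matrix.mul_one, Matrix.one_mul, Matrix.smul_mul, Matrix.mul_smul, pauli_mul_self,
      smul_smul, Complex.I_mul_I]
    module
  rw [this, smul_smul]
  norm_num

theorem trace_pauli (κ : Fin 3) : (pauli κ).trace = 0 := by
  fin_cases κ <;> simp [pauli, Matrix.trace_fin_two]

theorem norm_trace_quarterTurn_sq (κ : Fin 3) : ‖(quarterTurn κ).trace‖ ^ 2 = 2 := by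
  rw [quarterTurn, Matrix.trace_smul, Matrix.trace_add, Matrix.trace_smul, trace_pauli,
    Matrix.trace_one, smul_eq_mul, norm_mul, norm_inv, Complex.norm_real,
    Real.norm_of_nonneg (Real.sqrt_nonneg 2), mul_pow, inv_pow, Real.sq_sqrt (by norm_num)]
  norm_num

theorem quarterTurn_conj (κ : Fin 3) (X : Matrix (Fin 2) (Fin 2) ℂ) :
    quarterTurn κ * X * (quarterTurn κ)ᴴ = (1 / 2 : ℂ) •
      (X + pauli κ * X * pauli κ + Complex.I • (pauli κ * X - X * pauli κ)) := by
  rw [quarterTurn_conjTranspose, quarterTurn, Matrix.smul_mul, Matrix.smul_mul, Matrix.mul_smul,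
    smul_smul, sqrt_two_inv_mul_self]
  congr 1
  simp only [Matrix.add_mul, Matrix.mul_sub, Matrix.mul_one, Matrix.one_mul, Matrix.smul_mul,
    Matrix.mul_smul]
  linear_combination (norm := module) (-Complex.I_sq) • (pauli κ * X * pauli κ)

/-- The twisted channel sums over the second index of the rotation matrix, that is, it applies the
transposed rotation to the components. This is why the qubit turns by `-π/2`. -/
theorem spinOne_rotZ_smul_pauli (ν η : Fin 3) : spinOne rotZ ν η • pauli η =
    if η = Equiv.swap 0 1 ν then quarterTurn 2 * pauli ν * (quarterTurn 2)ᴴ else 0 := by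
  rw [quarterTurn_conj]
  have hs0 : Equiv.swap (0 : Fin 3) 1 0 = 1 := by decide
  have hs1 : Equiv.swap (0 : Fin 3) 1 1 = 0 := by decide
  have hs2 : Equiv.swap (0 : Fin 3) 1 2 = 2 := by decide
  fin_cases ν <;> fin_cases η <;> simp [hs0, hs1, hs2, spinOne, rotZ, pauli] <;> norm_num <;>
    first
    | ring1
    | linear_combination Complex.I_sq

theorem spinOne_rotX_smul_pauli (ν η : Fin 3) : spinOne rotX ν η • pauli η =
    if η = Equiv.swap 1 2 ν then quarterTurn 0 * pauli ν * (quarterTurn 0)ᴴ else 0 := by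
  rw [quarterTurn_conj]
  have hs0 : Equiv.swap (1 : Fin 3) 2 0 = 0 := by decide
  have hs1 : Equiv.swap (1 : Fin 3) 2 1 = 2 := by decide
  have hs2 : Equiv.swap (1 : Fin 3) 2 2 = 1 := by decide
  fin_cases ν <;> fin_cases η <;> simp [hs0, hs1, hs2, spinOne, rotX, pauli] <;> norm_num <;>
    first
    | ring1
    | linear_combination Complex.I_sq
    | exact ⟨by linear_combination -Complex.I_sq, by linear_combination Complex.I_sq⟩

end StringOrder

/-! ### Gate fidelity -/

section Fidelity

variable {d : ℕ}

theorem pauli_succ_mul (κ : Fin 3) : pauli (κ + 1) * pauli κ = (-Complex.I) • pauli (κ + 2) := by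
  fin_cases κ <;> (ext i j; fin_cases i <;> fin_cases j <;> simp [pauli, Matrix.mul_apply])

theorem pauli_succ_mul_succ_succ (κ : Fin 3) :
    pauli (κ + 1) * pauli (κ + 2) = Complex.I • pauli κ := by
  fin_cases κ <;> (ext i j; fin_cases i <;> fin_cases j <;> simp [pauli, Matrix.mul_apply])

theorem pauli_mul_succ (κ : Fin 3) :
    pauli κ * pauli (κ + 1) = Complex.I • pauli (κ + 2) := by
  fin_cases κ <;> (ext i j; fin_cases i <;> fin_cases j <;> simp [pauli, Matrix.mul_apply])

/-- The target unitary has the same coefficients as the measurement outcome. This is what lets equal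
junk components factor out. -/
theorem byproduct_mul_rotation (κ : Fin 3) (Θ : ℝ) :
    pauli (κ + 1) * qubitRotation κ Θ = (Real.cos (Θ / 2) : ℂ) • pauli (κ + 1) -
      (Real.sin (Θ / 2) : ℂ) • pauli (κ + 2) := by
  rw [qubitRotation, Matrix.mul_sub, Matrix.mul_smul, Matrix.mul_smul, Matrix.mul_one,
    pauli_succ_mul, smul_smul]
  congr 2
  linear_combination (-(Real.sin (Θ / 2) : ℂ)) * Complex.I_sq

theorem measured_outcome (c : Fin 3 → Matrix (Fin d) (Fin d) ℂ) (κ : Fin 3) (Θ : ℝ) :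
    measured (withProtected c) (outcome κ Θ) =
      (Real.cos (Θ / 2) : ℂ) • (pauli (κ + 1) ⊗ₖ c (κ + 1)) -
      (Real.sin (Θ / 2) : ℂ) • (pauli (κ + 2) ⊗ₖ c (κ + 2)) := by
  have h : ∀ f : Fin 3 → Matrix (Fin 2 × Fin d) (Fin 2 × Fin d) ℂ,
      ∑ μ, star (outcome κ Θ μ) • f μ = (Real.cos (Θ / 2) : ℂ) • f (κ + 1) -
        (Real.sin (Θ / 2) : ℂ) • f (κ + 2) := by
    intro f
    have hs : ∀ (a : Fin 3) (x : ℝ) (μ : Fin 3),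
        star ((Pi.single a (x : ℂ) : Fin 3 → ℂ) μ) = if μ = a then (x : ℂ) else 0 := by
      intro a x μ
      rw [Pi.single_apply]
      split_ifs <;> simp
    simp only [outcome, Pi.sub_apply, star_sub, hs, sub_smul, Finset.sum_sub_distrib, ite_smul,
      zero_smul, Finset.sum_ite_eq', Finset.mem_univ, if_true]
  exact h _

theorem byproduct_rotation_unitary (κ : Fin 3) (Θ : ℝ) :
    (pauli (κ + 1) * qubitRotation κ Θ)ᴴ * (pauli (κ + 1) * qubitRotation κ Θ) = 1 := by
  have h1 : (qubitRotation κ Θ)ᴴ = (Real.cos (Θ / 2) : ℂ) • 1 +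
      (Complex.I * (Real.sin (Θ / 2) : ℂ)) • pauli κ := by
    simp only [qubitRotation, Matrix.conjTranspose_sub, Matrix.conjTranspose_smul,
      Matrix.conjTranspose_one, pauli_conjTranspose, Complex.star_def, map_mul,
      Complex.conj_ofReal, Complex.conj_I]
    module
  have h2 : (Real.cos (Θ / 2) : ℂ) ^ 2 + (Real.sin (Θ / 2) : ℂ) ^ 2 = 1 := by
    exact_mod_cast Real.cos_sq_add_sin_sq (Θ / 2)
  rw [Matrix.conjTranspose_mul, pauli_conjTranspose, Matrix.mul_assoc, ← Matrix.mul_assoc (pauli _),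
    pauli_mul_self, Matrix.one_mul, h1, qubitRotation]
  simp only [Matrix.add_mul, Matrix.mul_sub, Matrix.mul_one, Matrix.one_mul, Matrix.smul_mul,
    Matrix.mul_smul, pauli_mul_self]
  linear_combination (norm := module) h2 • (1 : Matrix (Fin 2) (Fin 2) ℂ) -
    ((Real.sin (Θ / 2) : ℂ) ^ 2 * Complex.I_sq) • (1 : Matrix (Fin 2) (Fin 2) ℂ)

/-- Undoing the byproduct and the rotation after the measurement. -/
theorem byproduct_conjTranspose_mul_measured (c : Fin 3 → Matrix (Fin d) (Fin d) ℂ) (κ : Fin 3)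
    (Θ : ℝ) :
    (pauli (κ + 1) * qubitRotation κ Θ)ᴴ ⊗ₖ (1 : Matrix (Fin d) (Fin d) ℂ) *
      measured (withProtected c) (outcome κ Θ) =
    (1 : Matrix (Fin 2) (Fin 2) ℂ) ⊗ₖ (((Real.cos (Θ / 2) : ℂ) ^ 2) • c (κ + 1) +
      ((Real.sin (Θ / 2) : ℂ) ^ 2) • c (κ + 2)) +
    (Complex.I * Real.cos (Θ / 2) * Real.sin (Θ / 2)) •
      (pauli κ ⊗ₖ (c (κ + 1) - c (κ + 2))) := by
  have h1 : (pauli (κ + 1) * qubitRotation κ Θ)ᴴ * pauli (κ + 1) =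
      (Real.cos (Θ / 2) : ℂ) • 1 + (Complex.I * Real.sin (Θ / 2)) • pauli κ := by
    rw [byproduct_mul_rotation, Matrix.conjTranspose_sub, Matrix.conjTranspose_smul,
      Matrix.conjTranspose_smul, pauli_conjTranspose, pauli_conjTranspose, Matrix.sub_mul,
      Matrix.smul_mul, Matrix.smul_mul, pauli_mul_self]
    have : pauli (κ + 2) * pauli (κ + 1) = (-Complex.I) • pauli κ := by
      have h := congrArg Matrix.conjTranspose (pauli_succ_mul_succ_succ κ)
      simpa [Matrix.conjTranspose_mul, pauli_conjTranspose, Matrix.conjTranspose_smul] using h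
    rw [this]
    simp only [Complex.star_def, Complex.conj_ofReal]
    module
  have h2 : (pauli (κ + 1) * qubitRotation κ Θ)ᴴ * pauli (κ + 2) =
      (Complex.I * Real.cos (Θ / 2)) • pauli κ - (Real.sin (Θ / 2) : ℂ) • 1 := by
    rw [byproduct_mul_rotation, Matrix.conjTranspose_sub, Matrix.conjTranspose_smul,
      Matrix.conjTranspose_smul, pauli_conjTranspose, pauli_conjTranspose, Matrix.sub_mul,
      Matrix.smul_mul, Matrix.smul_mul, pauli_mul_self, pauli_succ_mul_succ_succ]
    simp only [Complex.star_def, Complex.conj_ofReal]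
    module
  rw [measured_outcome, Matrix.mul_sub, Matrix.mul_smul, Matrix.mul_smul,
    ← Matrix.mul_kronecker_mul, ← Matrix.mul_kronecker_mul, h1, h2, Matrix.one_mul, Matrix.one_mul]
  ext ⟨i, k⟩ ⟨j, m⟩
  simp only [Matrix.add_apply, Matrix.sub_apply, Matrix.smul_apply, Matrix.kroneckerMap_apply,
    smul_eq_mul]
  ring

theorem trace_traceJunk_mul (M : Matrix (Fin 2 × Fin d) (Fin 2 × Fin d) ℂ)
    (X : Matrix (Fin 2) (Fin 2) ℂ) :
    (traceJunk M * X).trace = (M * (X ⊗ₖ (1 : Matrix (Fin d) (Fin d) ℂ))).trace := by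
  simp only [Matrix.trace, Matrix.diag_apply, Matrix.mul_apply, traceJunk, Matrix.of_apply,
    Fintype.sum_prod_type, Matrix.kroneckerMap_apply, Finset.sum_mul, Matrix.one_apply, mul_ite,
    mul_one, mul_zero, Finset.sum_ite_eq', Finset.mem_univ, if_true]
  exact Finset.sum_congr rfl fun i _ => Finset.sum_comm

theorem gateFidelity_eq (c : Fin 3 → Matrix (Fin d) (Fin d) ℂ) (ρJ : Matrix (Fin d) (Fin d) ℂ)
    (κ : Fin 3) (Θ : ℝ) (ρP : Matrix (Fin 2) (Fin 2) ℂ) :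
    gateFidelity c ρJ κ Θ ρP =
      ((measured (withProtected c) (outcome κ Θ) * (ρP ⊗ₖ ρJ) *
        (measured (withProtected c) (outcome κ Θ))ᴴ).trace)⁻¹ *
      (measured (withProtected c) (outcome κ Θ) * (ρP ⊗ₖ ρJ) *
        (measured (withProtected c) (outcome κ Θ))ᴴ *
        (((pauli (κ + 1) * qubitRotation κ Θ) * ρP * (pauli (κ + 1) * qubitRotation κ Θ)ᴴ) ⊗ₖ
          (1 : Matrix (Fin d) (Fin d) ℂ))).trace := by
  simp only [gateFidelity, postMeasurement]
  rw [trace_traceJunk_mul, Matrix.smul_mul, Matrix.trace_smul, smul_eq_mul]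

/-- If both transverse components vanished, only `σ_κ ⊗ c_κ` would remain and `σ_κ ⊗ 1` would be a
second, traceless fixed point. Nonvanishing ensures that the measurement outcome has positive
probability. -/
theorem IsNormal.component_ne_zero {c : Fin 3 → Matrix (Fin d) (Fin d) ℂ}
    {Λ : Matrix (Fin 2 × Fin d) (Fin 2 × Fin d) ℂ} (h : IsNormal (withProtected c) Λ)
    {κ : Fin 3} (hκ : c (κ + 1) = c (κ + 2)) : c (κ + 1) ≠ 0 := by
  intro h1
  have h2 : c (κ + 2) = 0 := hκ ▸ h1
  have hne := h.canonical.nonempty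
  set X : Matrix (Fin 2 × Fin d) (Fin 2 × Fin d) ℂ := pauli κ ⊗ₖ (1 : Matrix (Fin d) (Fin d) ℂ)
    with hX
  have hother : ∀ μ, μ ≠ κ → withProtected c μ = 0 := by
    intro μ hμ
    have : c μ = 0 := by
      have h3 : μ = κ + 1 ∨ μ = κ + 2 := by
        revert hμ; fin_cases κ <;> fin_cases μ <;> decide
      rcases h3 with h3 | h3 <;> rw [h3] <;> assumption
    rw [withProtected, this, Matrix.kronecker_zero]
  have hsum : ∀ f : Fin 3 → Matrix (Fin 2 × Fin d) (Fin 2 × Fin d) ℂ, (∀ μ, μ ≠ κ → f μ = 0) →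
      ∑ μ, f μ = f κ := fun f hf => Finset.sum_eq_single κ (fun μ _ hμ => hf μ hμ) (by simp)
  have hr := h.canonical.right_fixed
  rw [hsum _ fun μ hμ => by rw [hother μ hμ, Matrix.zero_mul]] at hr
  have hcomm : withProtected c κ * X = X * withProtected c κ := by
    rw [hX, withProtected, ← Matrix.mul_kronecker_mul, ← Matrix.mul_kronecker_mul, Matrix.one_mul,
      Matrix.mul_one]
  have hfix : transfer (withProtected c) (withProtected c) X = X := by
    rw [transfer_apply, hsum _ fun μ hμ => by rw [hother μ hμ, Matrix.zero_mul, Matrix.zero_mul],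
      hcomm, Matrix.mul_assoc, hr, Matrix.mul_one]
  have hX1 := h.eq_smul_one hfix
  have hXX : X * X = 1 := by
    rw [hX, ← Matrix.mul_kronecker_mul, pauli_mul_self, Matrix.mul_one, Matrix.one_kronecker_one]
  have htr := congrArg Matrix.trace hX1
  rw [hX, Matrix.trace_kronecker, trace_pauli, zero_mul, Matrix.trace_smul, Matrix.trace_one,
    smul_eq_mul] at htr
  have hcard : ((Fintype.card (Fin 2 × Fin d) : ℕ) : ℂ) ≠ 0 := by
    exact_mod_cast Fintype.card_ne_zero
  have hk := (mul_eq_zero.1 htr.symm).resolve_right hcard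
  rw [hk, zero_smul] at hX1
  rw [hX1, Matrix.zero_mul] at hXX
  exact zero_ne_one hXX

theorem vecMulVec_star_mul_self {v : Fin 2 → ℂ} (hv : star v ⬝ᵥ v = 1) :
    Matrix.vecMulVec v (star v) * Matrix.vecMulVec v (star v) = Matrix.vecMulVec v (star v) := by
  rw [Matrix.vecMulVec_mul_vecMulVec, hv, one_smul]

/-- The measured operator factors as the target unitary tensored with one junk matrix, so a product
state stays a product and the qubit evolves exactly as desired. -/
theorem perfectRotation_of_eq {c : Fin 3 → Matrix (Fin d) (Fin d) ℂ}
    {Λ : Matrix (Fin 2 × Fin d) (Fin 2 × Fin d) ℂ} (h : IsNormal (withProtected c) Λ)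
    {ρJ : Matrix (Fin d) (Fin d) ℂ} (hρ : ρJ.PosDef)
    {κ : Fin 3} (hκ : c (κ + 1) = c (κ + 2)) (Θ : ℝ) : PerfectRotation c ρJ κ Θ := by
  intro v hv
  rw [gateFidelity_eq]
  set V := pauli (κ + 1) * qubitRotation κ Θ with hV
  have hVV : Vᴴ * V = 1 := byproduct_rotation_unitary κ Θ
  set ρP := Matrix.vecMulVec v (star v) with hρP
  have hK : measured (withProtected c) (outcome κ Θ) = V ⊗ₖ c (κ + 1) := by
    rw [measured_outcome, hV, byproduct_mul_rotation, ← hκ]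
    ext ⟨i, k⟩ ⟨j, m⟩
    simp only [Matrix.sub_apply, Matrix.smul_apply, Matrix.kroneckerMap_apply, smul_eq_mul]
    ring
  have htr : ρP.trace = 1 := by rw [hρP, Matrix.trace_vecMulVec, dotProduct_comm, hv]
  have htrV : (V * ρP * Vᴴ).trace = 1 := by
    rw [Matrix.trace_mul_comm, ← Matrix.mul_assoc, hVV, Matrix.one_mul, htr]
  have hsq : V * ρP * Vᴴ * (V * ρP * Vᴴ) = V * ρP * Vᴴ := by
    calc V * ρP * Vᴴ * (V * ρP * Vᴴ) = V * ρP * (Vᴴ * V) * ρP * Vᴴ := by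
          simp only [Matrix.mul_assoc]
      _ = V * (ρP * ρP) * Vᴴ := by rw [hVV, Matrix.mul_one, Matrix.mul_assoc V]
      _ = _ := by rw [hρP, vecMulVec_star_mul_self hv]
  have hne : (c (κ + 1) * ρJ * (c (κ + 1))ᴴ).trace ≠ 0 := by
    intro h0
    have h1 := ((hρ.posSemidef.mul_mul_conjTranspose_same (c (κ + 1))).trace_eq_zero_iff).1 h0
    exact h.component_ne_zero hκ
      (sum_mul_conjTranspose_eq_zero hρ (B := fun _ => c (κ + 1)) (by simp [h1]) 0)
  rw [hK, Matrix.conjTranspose_kronecker, ← Matrix.mul_kronecker_mul, ← Matrix.mul_kronecker_mul,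
    ← Matrix.mul_kronecker_mul, Matrix.trace_kronecker, Matrix.trace_kronecker, hsq, htrV,
    Matrix.mul_one, one_mul, inv_mul_cancel₀ hne]

theorem exists_pauli_eigenvector (κ : Fin 3) : ∃ v : Fin 2 → ℂ, star v ⬝ᵥ v = 1 ∧
    Matrix.vecMulVec v (star v) = (1 / 2 : ℂ) • (1 + pauli κ) := by
  have h2 := sqrt_two_inv_mul_self
  set t := (((Real.sqrt 2 : ℝ) : ℂ)⁻¹) with ht
  have hst : (starRingEnd ℂ) t = t := by rw [ht, map_inv₀, Complex.conj_ofReal]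
  fin_cases κ
  · refine ⟨![t, t], ?_, ?_⟩
    · simp [dotProduct, Fin.sum_univ_two, hst, h2]; norm_num
    · ext i j
      fin_cases i <;> fin_cases j <;> simp [Matrix.vecMulVec_apply, pauli, hst, h2]
  · refine ⟨![t, Complex.I * t], ?_, ?_⟩
    · simp [dotProduct, Fin.sum_univ_two, hst]
      linear_combination 2 * h2 - t * t * Complex.I_sq
    · ext i j
      fin_cases i <;> fin_cases j <;> simp [Matrix.vecMulVec_apply, pauli, hst, h2]
      · first
        | linear_combination (-Complex.I) * h2
        | linear_combination Complex.I * h2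
      · linear_combination Complex.I * h2
      · linear_combination h2 - t * t * Complex.I_sq
  · refine ⟨![1, 0], ?_, ?_⟩
    · simp [dotProduct, Fin.sum_univ_two]
    · ext i j
      fin_cases i <;> fin_cases j <;> simp [Matrix.vecMulVec_apply, pauli]
      norm_num

/-- The test state is the `+1` eigenvector of `σ_{κ+1}`. Since `σ_κ` anticommutes with `σ_{κ+1}`,
the error term sends it to the orthogonal state, where perfect fidelity leaves no weight. -/
theorem eq_of_perfectRotation {c : Fin 3 → Matrix (Fin d) (Fin d) ℂ}
    {ρJ : Matrix (Fin d) (Fin d) ℂ} (hρ : ρJ.PosDef) {κ : Fin 3} {Θ : ℝ}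
    (hΘ : Real.cos (Θ / 2) * Real.sin (Θ / 2) ≠ 0) (h : PerfectRotation c ρJ κ Θ) :
    c (κ + 1) = c (κ + 2) := by
  obtain ⟨v, hv, hvp⟩ := exists_pauli_eigenvector (κ + 1)
  have hF := h v hv
  rw [gateFidelity_eq] at hF
  have hNK := byproduct_conjTranspose_mul_measured c κ Θ
  have hVV : (pauli (κ + 1) * qubitRotation κ Θ)ᴴ * (pauli (κ + 1) * qubitRotation κ Θ) = 1 :=
    byproduct_rotation_unitary κ Θ
  set V := pauli (κ + 1) * qubitRotation κ Θ with hV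
  set K := measured (withProtected c) (outcome κ Θ) with hK
  have hVV' : V * Vᴴ = 1 := mul_eq_one_comm.1 hVV
  set p := Matrix.vecMulVec v (star v) with hp
  set p' : Matrix (Fin 2) (Fin 2) ℂ := 1 - p with hp'
  set M := K * (p ⊗ₖ ρJ) * Kᴴ with hM
  -- An outcome of probability zero would have fidelity zero, by the convention `0⁻¹ = 0`.
  have ht0 : M.trace ≠ 0 := by
    intro h0
    rw [h0, _root_.inv_zero, zero_mul] at hF
    exact zero_ne_one hF
  have h1 : (M * ((V * p * Vᴴ) ⊗ₖ (1 : Matrix (Fin d) (Fin d) ℂ))).trace = M.trace := by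
    field_simp at hF
    exact hF
  have h2 : (M * ((V * p' * Vᴴ) ⊗ₖ (1 : Matrix (Fin d) (Fin d) ℂ))).trace = 0 := by
    have : V * p' * Vᴴ = 1 - V * p * Vᴴ := by
      rw [hp', Matrix.mul_sub, Matrix.sub_mul, Matrix.mul_one, hVV']
    have hsub : (1 - V * p * Vᴴ) ⊗ₖ (1 : Matrix (Fin d) (Fin d) ℂ) =
        1 - (V * p * Vᴴ) ⊗ₖ (1 : Matrix (Fin d) (Fin d) ℂ) := by
      rw [← Matrix.one_kronecker_one]
      ext ⟨i, a⟩ ⟨j, b⟩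
      simp only [Matrix.sub_apply, Matrix.kroneckerMap_apply, sub_mul]
    rw [this, hsub, Matrix.mul_sub, Matrix.trace_sub, h1,
      Matrix.mul_one, sub_self]
  set δ := c (κ + 1) - c (κ + 2) with hδ
  set k : ℂ := Complex.I * Real.cos (Θ / 2) * Real.sin (Θ / 2) with hk
  have hpp : p * p = p := vecMulVec_star_mul_self hv
  have hpc : pᴴ = p := by rw [hp, Matrix.conjTranspose_vecMulVec, star_star]
  have hpp' : p' * p = 0 := by rw [hp', Matrix.sub_mul, Matrix.one_mul, hpp, sub_self]
  have hp'p' : p' * p' = p' := by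
    conv_lhs => rw [hp']
    rw [Matrix.mul_sub, Matrix.mul_one, ← hp', hpp', sub_zero]
  have hp'c : p'ᴴ = p' := by rw [hp', Matrix.conjTranspose_sub, Matrix.conjTranspose_one, hpc]
  have hpσ : pauli κ * p = p' * pauli κ := by
    rw [hp', hvp, Matrix.mul_smul, Matrix.mul_add, Matrix.mul_one, pauli_mul_succ, Matrix.sub_mul,
      Matrix.one_mul, Matrix.smul_mul, Matrix.add_mul, Matrix.one_mul, pauli_succ_mul]
    module
  set B : Matrix (Fin 2 × Fin d) (Fin 2 × Fin d) ℂ := (p' * pauli κ) ⊗ₖ (k • δ) with hB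
  set Q : Matrix (Fin 2 × Fin d) (Fin 2 × Fin d) ℂ :=
    (p' * Vᴴ) ⊗ₖ (1 : Matrix (Fin d) (Fin d) ℂ) with hQ
  set Z : Matrix (Fin 2 × Fin d) (Fin 2 × Fin d) ℂ :=
    K * (p ⊗ₖ (1 : Matrix (Fin d) (Fin d) ℂ)) with hZ
  -- After undoing the target unitary, the part acting trivially on the qubit is removed by `p' p =
  -- 0`; only the `σ_κ` term, proportional to the difference of the junk components, passes to the
  -- orthogonal state.
  have hBeq : Q * Z = B := by
    have e0 : Q = (p' ⊗ₖ (1 : Matrix (Fin d) (Fin d) ℂ)) *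
        (Vᴴ ⊗ₖ (1 : Matrix (Fin d) (Fin d) ℂ)) := by
      rw [← Matrix.mul_kronecker_mul, Matrix.one_mul]
    rw [e0, hZ, ← Matrix.mul_assoc, Matrix.mul_assoc _ _ K, hNK, Matrix.mul_add, Matrix.add_mul,
      ← Matrix.mul_kronecker_mul, ← Matrix.mul_kronecker_mul,
      Matrix.mul_one, hpp', Matrix.zero_kronecker, zero_add, Matrix.mul_smul, Matrix.smul_mul,
      ← Matrix.mul_kronecker_mul, ← Matrix.mul_kronecker_mul, Matrix.mul_assoc, hpσ,
      ← Matrix.mul_assoc, hp'p', Matrix.one_mul, Matrix.mul_one, ← Matrix.kronecker_smul]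
  set X : Matrix (Fin 2 × Fin d) (Fin 2 × Fin d) ℂ := (1 : Matrix (Fin 2) (Fin 2) ℂ) ⊗ₖ ρJ with hX
  have h3 : (B * X * Bᴴ).trace = 0 := by
    have e1 : Z * X * Zᴴ = M := by
      have : (p ⊗ₖ (1 : Matrix (Fin d) (Fin d) ℂ)) * X *
          (p ⊗ₖ (1 : Matrix (Fin d) (Fin d) ℂ))ᴴ = p ⊗ₖ ρJ := by
        rw [Matrix.conjTranspose_kronecker, Matrix.conjTranspose_one, hpc, hX,
          ← Matrix.mul_kronecker_mul, ← Matrix.mul_kronecker_mul, Matrix.mul_one, hpp,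
          Matrix.one_mul, Matrix.mul_one]
      rw [hM, ← this, hZ, Matrix.conjTranspose_mul]
      simp only [Matrix.mul_assoc]
    have e2 : Qᴴ * Q = (V * p' * Vᴴ) ⊗ₖ (1 : Matrix (Fin d) (Fin d) ℂ) := by
      rw [hQ, Matrix.conjTranspose_kronecker, ← Matrix.mul_kronecker_mul,
        Matrix.conjTranspose_mul p' Vᴴ, Matrix.conjTranspose_conjTranspose V, hp'c,
        Matrix.conjTranspose_one, Matrix.mul_one, ← Matrix.mul_assoc, Matrix.mul_assoc V p' p',
        hp'p']
    calc (B * X * Bᴴ).trace = (Q * (Z * X * Zᴴ * Qᴴ)).trace := by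
          rw [← hBeq, Matrix.conjTranspose_mul Q Z]
          simp only [Matrix.mul_assoc]
      _ = (M * (Qᴴ * Q)).trace := by
          rw [Matrix.trace_mul_comm, e1, Matrix.mul_assoc]
      _ = 0 := by rw [e2, h2]
  have hone : X.PosDef := Matrix.PosDef.one.kronecker hρ
  have hB0 : B = 0 := by
    have h4 := ((hone.posSemidef.mul_mul_conjTranspose_same B).trace_eq_zero_iff).1 h3
    exact sum_mul_conjTranspose_eq_zero hone (B := fun _ => B) (by simp [h4]) 0
  have hk0 : k ≠ 0 := by
    rw [hk, mul_assoc, ← Complex.ofReal_mul]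
    exact mul_ne_zero Complex.I_ne_zero (by exact_mod_cast hΘ)
  have hpσ0 : (p' * pauli κ) ≠ 0 := by
    intro h0
    have h5 : p' = 0 := by
      have := congrArg (· * pauli κ) h0
      simpa [Matrix.mul_assoc, pauli_mul_self] using this
    have h6 := congrArg Matrix.trace h5
    rw [hp', Matrix.trace_sub, Matrix.trace_one, hp, Matrix.trace_vecMulVec, dotProduct_comm, hv,
      Matrix.trace_zero] at h6
    norm_num at h6
  obtain ⟨i, hi⟩ := Function.ne_iff.1 hpσ0
  obtain ⟨j, hij⟩ := Function.ne_iff.1 hi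
  ext a b
  have h7 := congrFun (congrFun hB0 (i, a)) (j, b)
  rw [hB, Matrix.kroneckerMap_apply, Matrix.smul_apply, smul_eq_mul, Matrix.zero_apply] at h7
  have h8 := ((mul_eq_zero.1 h7).resolve_left hij)
  have h9 := (mul_eq_zero.1 h8).resolve_left hk0
  exact sub_eq_zero.1 h9

end Fidelity

/-! ### Euler angles -/

theorem qubitRotation_two (α : ℝ) : qubitRotation 2 α =
    !![Complex.exp (-(α / 2) * Complex.I), 0; 0, Complex.exp ((α / 2) * Complex.I)] := by
  have e1 : Complex.exp (-(α / 2) * Complex.I) =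
      Complex.cos (α / 2) - Complex.I * Complex.sin (α / 2) := by
    rw [Complex.exp_mul_I, Complex.cos_neg, Complex.sin_neg]; ring
  rw [e1, Complex.exp_mul_I]
  ext i j
  fin_cases i <;> fin_cases j <;> simp [qubitRotation, pauli]
  ring

theorem qubitRotation_zero (β : ℝ) : qubitRotation 0 β =
    !![(Real.cos (β / 2) : ℂ), -(Complex.I * Real.sin (β / 2));
      -(Complex.I * Real.sin (β / 2)), (Real.cos (β / 2) : ℂ)] := by
  ext i j
  fin_cases i <;> fin_cases j <;> simp [qubitRotation, pauli]

theorem exists_euler_angles {G : Matrix (Fin 2) (Fin 2) ℂ}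
    (hG : G ∈ Matrix.specialUnitaryGroup (Fin 2) ℂ) :
    ∃ α β γ : ℝ, G = qubitRotation 2 α * qubitRotation 0 β * qubitRotation 2 γ := by
  obtain ⟨hU, hdet⟩ := Matrix.mem_specialUnitaryGroup_iff.1 hG
  have hU1 : G * Gᴴ = 1 := Matrix.mem_unitaryGroup_iff.1 hU
  have hinv : Gᴴ = G.adjugate := by
    calc Gᴴ = G.adjugate * G * Gᴴ := by
          rw [Matrix.adjugate_mul, hdet, one_smul, Matrix.one_mul]
      _ = _ := by rw [Matrix.mul_assoc, hU1, Matrix.mul_one]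
  rw [Matrix.adjugate_fin_two] at hinv
  have h11 : G 1 1 = star (G 0 0) := by
    simpa using (congrFun (congrFun hinv 0) 0).symm
  have h01 : G 0 1 = -star (G 1 0) := by
    have := congrFun (congrFun hinv 0) 1
    simp at this
    rw [Complex.star_def, this, neg_neg]
  set a := G 0 0 with ha
  set b := G 1 0 with hb
  have hab : ‖a‖ ^ 2 + ‖b‖ ^ 2 = 1 := by
    have h1 := hdet
    rw [Matrix.det_fin_two, ← ha, ← hb, h11, h01] at h1
    have h2 : a * star a + b * star b = 1 := by linear_combination h1
    rw [Complex.star_def, Complex.mul_conj, Complex.mul_conj, Complex.normSq_eq_norm_sq,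
      Complex.normSq_eq_norm_sq] at h2
    exact_mod_cast h2
  have hcos : Real.cos (Real.arccos ‖a‖) = ‖a‖ :=
    Real.cos_arccos (by linarith [norm_nonneg a]) (by nlinarith [norm_nonneg a, sq_nonneg ‖b‖])
  have hsin : Real.sin (Real.arccos ‖a‖) = ‖b‖ := by
    rw [Real.sin_arccos, show 1 - ‖a‖ ^ 2 = ‖b‖ ^ 2 by linarith, Real.sqrt_sq (norm_nonneg b)]
  -- The first column of the product is `cos(β/2) e^{-i(α+γ)/2}` and `-i sin(β/2) e^{i(α-γ)/2}`;
  -- matching moduli and arguments with `a` and `b` gives these angles. A vanishing entry does no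
  -- harm, as its phase is multiplied by zero.
  refine ⟨b.arg + Real.pi / 2 - a.arg, 2 * Real.arccos ‖a‖, -a.arg - b.arg - Real.pi / 2, ?_⟩
  rw [qubitRotation_two, qubitRotation_two, qubitRotation_zero,
    show 2 * Real.arccos ‖a‖ / 2 = Real.arccos ‖a‖ by ring, hcos, hsin]
  have hea := Complex.norm_mul_exp_arg_mul_I a
  have heb := Complex.norm_mul_exp_arg_mul_I b
  have hea' : star a = ‖a‖ * Complex.exp (-(a.arg * Complex.I)) := by
    conv_lhs => rw [← hea]
    rw [Complex.star_def, map_mul, Complex.conj_ofReal, ← Complex.exp_conj, map_mul,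
      Complex.conj_ofReal, Complex.conj_I, mul_neg]
  have heb' : star b = ‖b‖ * Complex.exp (-(b.arg * Complex.I)) := by
    conv_lhs => rw [← heb]
    rw [Complex.star_def, map_mul, Complex.conj_ofReal, ← Complex.exp_conj, map_mul,
      Complex.conj_ofReal, Complex.conj_I, mul_neg]
  have hpi : Complex.exp ((Real.pi / 2 : ℂ) * Complex.I) = Complex.I := Complex.exp_pi_div_two_mul_I
  have hpi' : Complex.exp (-((Real.pi / 2 : ℂ) * Complex.I)) = -Complex.I := by
    rw [Complex.exp_neg, hpi, Complex.inv_I]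
  have hprod : ∀ x y z : ℂ, Complex.exp x * z * Complex.exp y = z * Complex.exp (x + y) := by
    intro x y z; rw [Complex.exp_add]; ring
  ext i j
  fin_cases i <;> fin_cases j <;>
    simp only [Matrix.mul_apply, Fin.sum_univ_two, Matrix.of_apply, Matrix.cons_val', Fin.zero_eta,
      Fin.mk_one, Matrix.cons_val_zero, Matrix.cons_val_one, Matrix.cons_val_fin_one, zero_mul,
      mul_zero, add_zero, zero_add, hprod]
  · rw [← ha]
    conv_lhs => rw [← hea]
    congr 2
    push_cast
    ring
  · rw [h01, heb', show (-((b.arg + Real.pi / 2 - a.arg : ℝ) / 2 : ℂ) * Complex.I +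
      (-a.arg - b.arg - Real.pi / 2 : ℝ) / 2 * Complex.I) =
      -(b.arg * Complex.I) + -((Real.pi / 2 : ℂ) * Complex.I) by push_cast; ring, Complex.exp_add,
      hpi']
    linear_combination (-(‖b‖ * Complex.exp (-(b.arg * Complex.I)))) * Complex.I_sq
  · rw [← hb]
    conv_lhs => rw [← heb]
    rw [show ((b.arg + Real.pi / 2 - a.arg : ℝ) / 2 * Complex.I +
      -((-a.arg - b.arg - Real.pi / 2 : ℝ) / 2 : ℂ) * Complex.I) =
      b.arg * Complex.I + (Real.pi / 2 : ℂ) * Complex.I by push_cast; ring, Complex.exp_add, hpi]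
    linear_combination (‖b‖ * Complex.exp (b.arg * Complex.I)) * Complex.I_sq
  · rw [h11, hea']
    congr 2
    push_cast
    ring

/-- A gate whose Euler angles are all generic. -/
theorem exists_generic_gate : ∃ G ∈ Matrix.specialUnitaryGroup (Fin 2) ℂ, ∀ α β γ : ℝ,
    G = qubitRotation 2 α * qubitRotation 0 β * qubitRotation 2 γ →
    Real.cos (β / 2) * Real.sin (β / 2) ≠ 0 ∧
    (Real.cos (α / 2) * Real.sin (α / 2) ≠ 0 ∨ Real.cos (γ / 2) * Real.sin (γ / 2) ≠ 0) := by
  -- Only the corner entry `(1 + i)/2 = cos(β/2) e^{-i(α+γ)/2}` matters. Its modulus gives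
  -- `cos²(β/2) = 1/2`; if `α` and `γ` were both degenerate, the entry would be real or purely
  -- imaginary.
  refine ⟨!![(1 + Complex.I) / 2, (-1 + Complex.I) / 2; (1 + Complex.I) / 2, (1 - Complex.I) / 2],
    ?_, ?_⟩
  · rw [Matrix.mem_specialUnitaryGroup_iff, Matrix.mem_unitaryGroup_iff]
    constructor
    · ext i j
      fin_cases i <;> fin_cases j <;>
        simp [Matrix.mul_apply, Fin.sum_univ_two, Matrix.star_apply] <;> ring_nf <;>
        simp [Complex.conj_ofNat] <;> norm_num
    · rw [Matrix.det_fin_two_of]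
      linear_combination (-1 / 2 : ℂ) * Complex.I_sq
  · intro α β γ h
    have h00 := congrFun (congrFun h 0) 0
    rw [qubitRotation_zero] at h00
    simp [qubitRotation, pauli, Matrix.mul_apply, Fin.sum_univ_two, -Complex.ofReal_cos,
      -Complex.ofReal_sin] at h00
    have hre := congrArg Complex.re h00
    have him := congrArg Complex.im h00
    simp [-Complex.ofReal_cos, -Complex.ofReal_sin] at hre him
    set x := Real.cos (α / 2)
    set y := Real.sin (α / 2)
    set u := Real.cos (γ / 2)
    set w := Real.sin (γ / 2)
    have e1 : x ^ 2 + y ^ 2 = 1 := Real.cos_sq_add_sin_sq _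
    have e2 : u ^ 2 + w ^ 2 = 1 := Real.cos_sq_add_sin_sq _
    have e3 : Real.cos (β / 2) ^ 2 + Real.sin (β / 2) ^ 2 = 1 := Real.cos_sq_add_sin_sq _
    set C := Real.cos (β / 2)
    set S := Real.sin (β / 2)
    have e4 : C ^ 2 = 1 / 2 := by
      have : C ^ 2 * ((x ^ 2 + y ^ 2) * (u ^ 2 + w ^ 2)) = 1 / 2 := by
        linear_combination (-(x * C * u - y * C * w) - 2⁻¹) * hre +
          ((x * C * w) + (y * C * u) - 2⁻¹) * him
      rwa [e1, e2, one_mul, mul_one] at this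
    refine ⟨fun h0 => ?_, ?_⟩
    · have : C ^ 2 * S ^ 2 = 0 := by rw [← mul_pow, h0]; norm_num
      rw [show S ^ 2 = 1 - C ^ 2 by linarith, e4] at this
      norm_num at this
    · by_contra! hc
      have : (1 / 4 : ℝ) = 0 := by
        linear_combination (1 / 2 : ℝ) * hre + (x * C * u - y * C * w) * him -
          C ^ 2 * (u ^ 2 - w ^ 2) * hc.1 - C ^ 2 * (x ^ 2 - y ^ 2) * hc.2
      norm_num at this

/-! ### Symmetry of the renormalization fixed points -/

section Symmetry

variable {D : ℕ}

theorem continuous_trace_wordProd {n : Type*} [Fintype n] [DecidableEq n] {k : ℕ}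
    (w : Fin k → Fin 3) :
    Continuous fun B : Fin 3 → Matrix n n ℂ => (wordProd B w).trace := by
  have h : Continuous fun B : Fin 3 → Matrix n n ℂ => wordProd B w := by
    induction k with
    | zero => simpa using continuous_const
    | succ k ih =>
      rw [← Fin.cons_self_tail w]
      simp only [wordProd_cons]
      exact (continuous_apply (w 0)).matrix_mul (ih _)
  exact h.matrix_trace

theorem trace_wordProd_conj {n : Type*} [Fintype n] [DecidableEq n] {B C : Fin 3 → Matrix n n ℂ}
    {P P' : Matrix n n ℂ} (hP : P * P' = 1) (h : ∀ μ, C μ = P * B μ * P') {k : ℕ}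
    (w : Fin k → Fin 3) : (wordProd C w).trace = (wordProd B w).trace := by
  have hP' : P' * P = 1 := mul_eq_one_comm.1 hP
  have hw : wordProd C w = P * wordProd B w * P' := by
    induction k with
    | zero => simp [hP]
    | succ k ih =>
      rw [← Fin.cons_self_tail w, wordProd_cons, wordProd_cons, ih, h]
      calc P * B (w 0) * P' * (P * wordProd B (Fin.tail w) * P') =
          P * B (w 0) * (P' * P) * wordProd B (Fin.tail w) * P' := by simp only [Matrix.mul_assoc]
        _ = _ := by rw [hP', Matrix.mul_one]; simp only [Matrix.mul_assoc]
  rw [hw, Matrix.trace_mul_comm, ← Matrix.mul_assoc, hP', Matrix.one_mul]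

/-- As `s` fixes `κ`, the unitary commutes with the buffer `a κ ^ m` and permutes the buffered
tensors. The basis changes `g k` need not converge, so only quantities independent of them, such as
traces of words, can be passed to the limit. -/
theorem IsRGFixedPoint.trace_wordProd_perm {a b : Fin 3 → Matrix (Fin D) (Fin D) ℂ} {κ : Fin 3}
    (hb : IsRGFixedPoint a κ b) {s : Equiv.Perm (Fin 3)} (hs : s κ = κ)
    {V : Matrix (Fin D) (Fin D) ℂ} (hV : Vᴴ * V = 1) (hVV : V * Vᴴ = 1)
    (ha : ∀ i, V * a i * Vᴴ = a (s i)) {k : ℕ} (w : Fin k → Fin 3) :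
    (wordProd (fun i => b (s i)) w).trace = (wordProd b w).trace := by
  obtain ⟨-, m, r, g, -, -, hlim⟩ := hb
  set B : ℕ → Fin 3 → Matrix (Fin D) (Fin D) ℂ := fun j μ =>
    (r j : ℂ) • ((g j).1 * buffered a κ (m j) μ * ((g j)⁻¹).1) with hB
  have h1 : Tendsto B atTop (𝓝 b) := tendsto_pi_nhds.2 hlim
  have h2 : Tendsto (fun j i => B j (s i)) atTop (𝓝 fun i => b (s i)) :=
    tendsto_pi_nhds.2 fun i => hlim (s i)
  have h3 := ((continuous_trace_wordProd w).tendsto _).comp h1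
  have h4 := ((continuous_trace_wordProd w).tendsto _).comp h2
  refine tendsto_nhds_unique h4 (h3.congr fun j => ?_)
  simp only [Function.comp]
  have hg1 : (g j).1 * ((g j)⁻¹).1 = 1 := by rw [← Units.val_mul, mul_inv_cancel, Units.val_one]
  have hg2 : ((g j)⁻¹).1 * (g j).1 = 1 := by rw [← Units.val_mul, inv_mul_cancel, Units.val_one]
  have hpow : ∀ e : ℕ, a κ ^ e = V * a κ ^ e * Vᴴ := by
    intro e
    induction e with
    | zero => simp [hVV]
    | succ e ih =>
      have h5 : a κ = V * a κ * Vᴴ := by rw [ha, hs]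
      calc a κ ^ (e + 1) = a κ ^ e * a κ := pow_succ _ _
        _ = (V * a κ ^ e * Vᴴ) * (V * a κ * Vᴴ) := by rw [← ih, ← h5]
        _ = V * a κ ^ e * (Vᴴ * V) * a κ * Vᴴ := by simp only [Matrix.mul_assoc]
        _ = _ := by rw [hV, Matrix.mul_one, pow_succ]; simp only [Matrix.mul_assoc]
  have hbuf : ∀ i, buffered a κ (m j) (s i) = V * buffered a κ (m j) i * Vᴴ := by
    intro i
    rw [buffered, ← ha i, hpow (m j)]
    calc V * a κ ^ m j * Vᴴ * (V * a i * Vᴴ) * (V * a κ ^ m j * Vᴴ) =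
        V * a κ ^ m j * (Vᴴ * V) * a i * (Vᴴ * V) * a κ ^ m j * Vᴴ := by
          simp only [Matrix.mul_assoc]
      _ = _ := by
        rw [hV, Matrix.mul_one, Matrix.mul_one, buffered]; simp only [Matrix.mul_assoc]
  symm
  refine trace_wordProd_conj (P := (g j).1 * V * ((g j)⁻¹).1)
    (P' := (g j).1 * Vᴴ * ((g j)⁻¹).1) ?_ (fun μ => ?_) w
  · calc (g j).1 * V * ((g j)⁻¹).1 * ((g j).1 * Vᴴ * ((g j)⁻¹).1) =
        (g j).1 * V * (((g j)⁻¹).1 * (g j).1) * Vᴴ * ((g j)⁻¹).1 := by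
          simp only [Matrix.mul_assoc]
      _ = (g j).1 * (V * Vᴴ) * ((g j)⁻¹).1 := by
        rw [hg2, Matrix.mul_one]; simp only [Matrix.mul_assoc]
      _ = 1 := by rw [hVV, Matrix.mul_one, hg1]
  · simp only [hB, hbuf]
    calc (r j : ℂ) • ((g j).1 * (V * buffered a κ (m j) μ * Vᴴ) * ((g j)⁻¹).1) =
        (r j : ℂ) • ((g j).1 * V * (1 : Matrix (Fin D) (Fin D) ℂ) * buffered a κ (m j) μ *
          (1 : Matrix (Fin D) (Fin D) ℂ) * Vᴴ * ((g j)⁻¹).1) := by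
          rw [Matrix.mul_one, Matrix.mul_one]; simp only [Matrix.mul_assoc]
      _ = _ := by
        rw [← hg2, Matrix.mul_smul, Matrix.smul_mul]; simp only [Matrix.mul_assoc]

/-- A symmetry which permutes the axes up to signs acts on the junk components by permutation. -/
theorem IsProtectedJunk.exists_junk_unitary {N : ℕ} {A : Fin 3 → Matrix (Fin N) (Fin N) ℂ}
    {U : octahedral → Matrix.unitaryGroup (Fin N) ℂ} (hA : IsSPTOState A U)
    {W : Matrix (Fin 2 × Fin D) (Fin N) ℂ} {a : Fin 3 → Matrix (Fin D) (Fin D) ℂ}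
    (h : IsProtectedJunk A U W a) (g : octahedral) (s : Equiv.Perm (Fin 3)) (ε : Fin 3 → ℂ)
    (hε : ∀ i, ε i ≠ 0) (hg : ∀ j i, spinOne g.1 j i = if j = s i then ε i else 0) :
    ∃ V : Matrix (Fin D) (Fin D) ℂ, Vᴴ * V = 1 ∧ V * Vᴴ = 1 ∧ ∀ i, V * a i * Vᴴ = a (s i) := by
  obtain ⟨S, V, hS, hSV⟩ := h.symmetry g
  have hV1 : V.1ᴴ * V.1 = 1 := Matrix.mem_unitaryGroup_iff'.1 V.2
  have hV2 : V.1 * V.1ᴴ = 1 := Matrix.mem_unitaryGroup_iff.1 V.2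
  refine ⟨V.1, hV1, hV2, fun i => ?_⟩
  have hsum : ∀ {n : Type} [Fintype n] (f : Fin 3 → Matrix n n ℂ),
      ∑ j, spinOne g.1 j i • f j = ε i • f (s i) := by
    intro n _ f
    simp only [hg, ite_smul, zero_smul, Finset.sum_ite_eq', Finset.mem_univ, if_true]
  have h1 : W * ((U g).1 * A i * ((U g).1)ᴴ) * Wᴴ = ε i • withProtected a (s i) := by
    rw [hA.covariant, hsum, Matrix.mul_smul, Matrix.smul_mul, h.components]
  have h2 : W * ((U g).1 * A i * ((U g).1)ᴴ) * Wᴴ =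
      (W * (U g).1 * Wᴴ) * (W * A i * Wᴴ) * (W * (U g).1 * Wᴴ)ᴴ := by
    rw [Matrix.conjTranspose_mul, Matrix.conjTranspose_mul, Matrix.conjTranspose_conjTranspose]
    calc W * ((U g).1 * A i * ((U g).1)ᴴ) * Wᴴ =
        W * (U g).1 * (1 : Matrix (Fin N) (Fin N) ℂ) * A i * (1 : Matrix (Fin N) (Fin N) ℂ) *
          ((U g).1)ᴴ * Wᴴ := by
          rw [Matrix.mul_one, Matrix.mul_one]; simp only [Matrix.mul_assoc]
      _ = _ := by rw [← h.unitary_right]; simp only [Matrix.mul_assoc]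
  rw [h2, hSV, h.components, Matrix.conjTranspose_kronecker, withProtected,
    ← Matrix.mul_kronecker_mul, ← Matrix.mul_kronecker_mul, hS, hsum, withProtected,
    Matrix.smul_kronecker] at h1
  -- The tensor and the Pauli matrices transform with the same sign, which cancels and leaves a pure
  -- permutation of the junk factors.
  have h3 := smul_right_injective _ (hε i) h1
  have h4 := congrArg (fun X => (pauli (s i) ⊗ₖ (1 : Matrix (Fin D) (Fin D) ℂ)) * X) h3
  simp only [← Matrix.mul_kronecker_mul, pauli_mul_self, Matrix.one_mul] at h4
  exact kronecker_one_injective h4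

end Symmetry

/-! ### Projective representations of the octahedral group -/

section GroupTheory

variable {G : Type*} [Group G] {x z : G}

/-- The two relations combine to `(xzx)(zxz) = 1`, and the braid relation says that `xzx` conjugates
`x` to `z`. -/
theorem mul_sq_mul_of_braid (hb : x * z * x = z * x * z) (h3 : (x * z) ^ 3 = 1) :
    z * x ^ 2 * z = (x ^ 2)⁻¹ ∧ x * z ^ 2 * x = (z ^ 2)⁻¹ ∧
      z ^ 4 = x * z * x * x ^ 4 * (x * z * x)⁻¹ := by
  have h1 : (x * z * x) * (z * x * z) = 1 := by rw [← h3]; simp [pow_succ, mul_assoc]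
  refine ⟨?_, ?_, ?_⟩
  · rw [← hb] at h1
    have : x * (z * x ^ 2 * z) * x = 1 := by rw [← h1]; simp [pow_succ, mul_assoc]
    calc z * x ^ 2 * z = x⁻¹ * (x * (z * x ^ 2 * z) * x) * x⁻¹ := by simp [pow_succ, mul_assoc]
      _ = _ := by rw [this]; simp [pow_succ]
  · rw [hb] at h1
    have : z * (x * z ^ 2 * x) * z = 1 := by rw [← h1]; simp [pow_succ, mul_assoc]
    calc x * z ^ 2 * x = z⁻¹ * (z * (x * z ^ 2 * x) * z) * z⁻¹ := by simp [pow_succ, mul_assoc]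
      _ = _ := by rw [this]; simp [pow_succ]
  · have h2 : z = (x * z * x) * x * (x * z * x)⁻¹ := by
      calc z = (z * x * z) * x * (x * z * x)⁻¹ := by simp [mul_assoc]
        _ = _ := by rw [← hb]
    calc z ^ 4 = ((x * z * x) * x * (x * z * x)⁻¹) ^ 4 := by rw [← h2]
      _ = _ := by rw [conj_pow]

/-- Squaring `z x² z⁻¹ = x⁻² z⁻²` gives `q` on the left, by centrality, and `q⁻²` on the right,
because the half turns commute and `z⁴` is conjugate to the central `x⁴`. -/
theorem pow_three_eq_one_of_braid {q : G} (hb : x * z * x = z * x * z) (h3 : (x * z) ^ 3 = 1)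
    (hq : x ^ 4 = q) (hqc : ∀ g, q * g = g * q) (hc : x ^ 2 * z ^ 2 = z ^ 2 * x ^ 2) :
    q ^ 3 = 1 ∧ z ^ 4 = q := by
  obtain ⟨h1, -, h4⟩ := mul_sq_mul_of_braid hb h3
  have hz : z ^ 4 = q := by
    calc z ^ 4 = x * z * x * x ^ 4 * (x * z * x)⁻¹ := by rw [h4]
      _ = _ := by rw [hq, ← hqc]; simp [mul_assoc]
  refine ⟨?_, hz⟩
  have h5 : z * x ^ 2 * z⁻¹ = (x ^ 2)⁻¹ * (z ^ 2)⁻¹ := by rw [← h1]; simp [pow_succ, mul_assoc]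
  have h6 : z * x ^ 4 * z⁻¹ = q := by rw [hq, ← hqc]; simp [mul_assoc]
  have h7 : z * x ^ 4 * z⁻¹ = (z * x ^ 2 * z⁻¹) * (z * x ^ 2 * z⁻¹) := by simp [pow_succ, mul_assoc]
  have h8 : q = q⁻¹ * q⁻¹ := by
    conv_lhs => rw [← h6, h7, h5]
    calc (x ^ 2)⁻¹ * (z ^ 2)⁻¹ * ((x ^ 2)⁻¹ * (z ^ 2)⁻¹) =
        (x ^ 2 * z ^ 2)⁻¹ * (x ^ 2)⁻¹ * (z ^ 2)⁻¹ := by rw [hc]; simp [pow_succ, mul_assoc]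
      _ = (z ^ 4)⁻¹ * (z ^ 2 * (x ^ 4)⁻¹ * (z ^ 2)⁻¹) := by simp [pow_succ, mul_assoc]
      _ = _ := by
        rw [hz, hq]
        congr 1
        calc z ^ 2 * q⁻¹ * (z ^ 2)⁻¹ = q⁻¹ * (q * z ^ 2) * q⁻¹ * (z ^ 2)⁻¹ := by
              simp [pow_succ, mul_assoc]
          _ = _ := by rw [hqc]; simp [pow_succ, mul_assoc]
  calc q ^ 3 = q * (q * q) := by simp [pow_succ, mul_assoc]
    _ = q⁻¹ * q⁻¹ * (q * q) := by nth_rewrite 1 [h8]; rfl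
    _ = 1 := by simp [mul_assoc]

/-- The words `x ^ (2 i) z ^ (2 j) s`, with `s` one of `1, x, z, x z, z x, x z x`. -/
def octahedralWord (x z : G) (i j : ℕ) (k : Fin 6) : G :=
  (x ^ 2) ^ i * (z ^ 2) ^ j * (![1, x, z, x * z, z * x, x * z * x] : Fin 6 → G) k

/-- A normal form: the commuting involutions `x²` and `z²` can be moved to the left past the
generators, leaving one of six representatives. Left multiplication by a generator preserves the
form, and inverses are cubes. Hence the relations allow at most 24 elements. -/
theorem exists_octahedralWord (hb : x * z * x = z * x * z) (h3 : (x * z) ^ 3 = 1) (hx : x ^ 4 = 1)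
    (hz : z ^ 4 = 1) (hc : x ^ 2 * z ^ 2 = z ^ 2 * x ^ 2) {g : G}
    (hg : g ∈ Subgroup.closure {x, z}) : ∃ i j k, g = octahedralWord x z i j k := by
  obtain ⟨h1, h2, -⟩ := mul_sq_mul_of_braid hb h3
  have hx2 : (x ^ 2)⁻¹ = x ^ 2 := by rw [inv_eq_iff_mul_eq_one, ← pow_add, hx]
  have hz2 : (z ^ 2)⁻¹ = z ^ 2 := by rw [inv_eq_iff_mul_eq_one, ← pow_add, hz]
  rw [hx2] at h1
  rw [hz2] at h2
  have e1 : z * x ^ 2 = (x ^ 2 * z ^ 2) * z := by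
    calc z * x ^ 2 = z * x ^ 2 * z * (z ^ 2)⁻¹ * z := by simp [pow_succ, mul_assoc]
      _ = _ := by rw [h1, hz2]
  have e2 : x * z ^ 2 = (x ^ 2 * z ^ 2) * x := by
    calc x * z ^ 2 = x * z ^ 2 * x * (x ^ 2)⁻¹ * x := by simp [pow_succ, mul_assoc]
      _ = _ := by rw [h2, hx2, hc]
  have p1 : ∀ i : ℕ, z * (x ^ 2) ^ i = (x ^ 2) ^ i * (z ^ 2) ^ i * z := fun i => by
    rw [← Commute.mul_pow hc]
    exact SemiconjBy.pow_right (a := z) e1 i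
  have p2 : ∀ i : ℕ, x * (z ^ 2) ^ i = (x ^ 2) ^ i * (z ^ 2) ^ i * x := fun i => by
    rw [← Commute.mul_pow hc]
    exact SemiconjBy.pow_right (a := x) e2 i
  have hcp : ∀ i j : ℕ, (z ^ 2) ^ j * (x ^ 2) ^ i = (x ^ 2) ^ i * (z ^ 2) ^ j := fun i j =>
    (Commute.pow_pow (show Commute (z ^ 2) (x ^ 2) from hc.symm) j i)
  have hword : ∀ (i j i' j' : ℕ) (k : Fin 6),
      (x ^ 2) ^ i * (z ^ 2) ^ j * octahedralWord x z i' j' k =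
        octahedralWord x z (i + i') (j + j') k := fun i j i' j' k => by
    rw [octahedralWord, octahedralWord, pow_add, pow_add]
    generalize (![1, x, z, x * z, z * x, x * z * x] : Fin 6 → G) k = s
    calc (x ^ 2) ^ i * (z ^ 2) ^ j * ((x ^ 2) ^ i' * (z ^ 2) ^ j' * s) =
        (x ^ 2) ^ i * ((z ^ 2) ^ j * (x ^ 2) ^ i') * (z ^ 2) ^ j' * s := by
          simp only [mul_assoc]
      _ = _ := by rw [hcp]; simp only [mul_assoc]
  have hone : ∀ (i j : ℕ) (k : Fin 6), octahedralWord x z i j k =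
      (x ^ 2) ^ i * (z ^ 2) ^ j * octahedralWord x z 0 0 k := fun i j k => by
    rw [hword]; simp
  have hxs : ∀ k, ∃ i j k', x * octahedralWord x z 0 0 k = octahedralWord x z i j k' := by
    intro k
    simp only [octahedralWord, pow_zero, one_mul]
    fin_cases k
    · exact ⟨0, 0, 1, by simp⟩
    · exact ⟨1, 0, 0, by simp [pow_two]⟩
    · exact ⟨0, 0, 3, by simp⟩
    · exact ⟨1, 0, 2, by simp [pow_two, mul_assoc]⟩
    · exact ⟨0, 0, 5, by simp [mul_assoc]⟩
    · exact ⟨1, 0, 4, by simp [pow_two, mul_assoc]⟩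
  have hzs : ∀ k, ∃ i j k', z * octahedralWord x z 0 0 k = octahedralWord x z i j k' := by
    intro k
    simp only [octahedralWord, pow_zero, one_mul]
    fin_cases k
    · exact ⟨0, 0, 2, by simp⟩
    · exact ⟨0, 0, 4, by simp⟩
    · exact ⟨0, 1, 0, by simp [pow_two]⟩
    · exact ⟨0, 0, 5, by simpa [mul_assoc] using hb.symm⟩
    · exact ⟨0, 1, 1, by simp [pow_two, mul_assoc]⟩
    · exact ⟨0, 1, 3, by simp [pow_two, mul_assoc] at hb ⊢; rw [hb]⟩
  have hx' : ∀ i j k, ∃ i' j' k',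
      x * octahedralWord x z i j k = octahedralWord x z i' j' k' := by
    intro i j k
    obtain ⟨i', j', k', h⟩ := hxs k
    refine ⟨i + j + i', j + j', k', ?_⟩
    rw [hone, ← hword, ← h]
    calc x * ((x ^ 2) ^ i * (z ^ 2) ^ j * octahedralWord x z 0 0 k) =
        (x * (x ^ 2) ^ i) * (z ^ 2) ^ j * octahedralWord x z 0 0 k := by simp only [mul_assoc]
      _ = (x ^ 2) ^ i * (x * (z ^ 2) ^ j) * octahedralWord x z 0 0 k := by
        rw [((Commute.refl x).pow_right 2).pow_right i |>.eq]; simp only [mul_assoc]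
      _ = _ := by rw [p2, pow_add]; simp only [mul_assoc]
  have hz' : ∀ i j k, ∃ i' j' k',
      z * octahedralWord x z i j k = octahedralWord x z i' j' k' := by
    intro i j k
    obtain ⟨i', j', k', h⟩ := hzs k
    refine ⟨i + i', i + j + j', k', ?_⟩
    rw [hone, ← hword, ← h]
    calc z * ((x ^ 2) ^ i * (z ^ 2) ^ j * octahedralWord x z 0 0 k) =
        (z * (x ^ 2) ^ i) * (z ^ 2) ^ j * octahedralWord x z 0 0 k := by simp only [mul_assoc]
      _ = (x ^ 2) ^ i * (z ^ 2) ^ i * (z * (z ^ 2) ^ j) * octahedralWord x z 0 0 k := by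
        rw [p1]; simp only [mul_assoc]
      _ = _ := by
        rw [((Commute.refl z).pow_right 2).pow_right j |>.eq, pow_add]; simp only [mul_assoc]
  induction hg using Subgroup.closure_induction_left with
  | one => exact ⟨0, 0, 0, by simp [octahedralWord]⟩
  | mul_left a ha y _ ih =>
    obtain ⟨i, j, k, rfl⟩ := ih
    rcases ha with rfl | rfl
    · exact hx' i j k
    · exact hz' i j k
  | inv_mul_cancel a ha y _ ih =>
    obtain ⟨i, j, k, rfl⟩ := ih
    rcases ha with rfl | rfl
    · obtain ⟨i1, j1, k1, h1⟩ := hx' i j k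
      obtain ⟨i2, j2, k2, h2⟩ := hx' i1 j1 k1
      obtain ⟨i3, j3, k3, h3⟩ := hx' i2 j2 k2
      refine ⟨i3, j3, k3, ?_⟩
      rw [← h3, ← h2, ← h1]
      calc _ = a ^ 4 * (a⁻¹ * octahedralWord a z i j k) := by rw [hx, one_mul]
        _ = _ := by simp [pow_succ, mul_assoc]
    · obtain ⟨i1, j1, k1, h1⟩ := hz' i j k
      obtain ⟨i2, j2, k2, h2⟩ := hz' i1 j1 k1
      obtain ⟨i3, j3, k3, h3⟩ := hz' i2 j2 k2
      refine ⟨i3, j3, k3, ?_⟩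
      rw [← h3, ← h2, ← h1]
      calc _ = a ^ 4 * (a⁻¹ * octahedralWord x a i j k) := by rw [hz, one_mul]
        _ = _ := by simp [pow_succ, mul_assoc]

theorem octahedralWord_mod (hx : x ^ 4 = 1) (hz : z ^ 4 = 1) (i j : ℕ) (k : Fin 6) :
    octahedralWord x z i j k = octahedralWord x z (i % 2) (j % 2) k := by
  have hx2 : (x ^ 2) ^ 2 = 1 := by rw [← pow_mul, hx]
  have hz2 : (z ^ 2) ^ 2 = 1 := by rw [← pow_mul, hz]
  rw [octahedralWord, octahedralWord, pow_eq_pow_mod i hx2, pow_eq_pow_mod j hz2]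

theorem map_octahedralWord {H : Type*} [Group H] (f : G →* H) (i j : ℕ) (k : Fin 6) :
    f (octahedralWord x z i j k) = octahedralWord (f x) (f z) i j k := by
  rw [octahedralWord, octahedralWord]
  fin_cases k <;> simp

end GroupTheory

/-! ### Relations between the quarter turns -/

theorem rotX_braid : rotX * rotZ * rotX = rotZ * rotX * rotZ := by
  apply Subtype.ext; decide

theorem rotX_mul_rotZ_pow_three : (rotX * rotZ) ^ 3 = 1 := by
  rw [pow_three]; apply Subtype.ext; decide

theorem rotX_pow_four : rotX ^ 4 = 1 := by
  simp only [pow_succ, pow_zero, one_mul]; apply Subtype.ext; decide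

theorem rotZ_pow_four : rotZ ^ 4 = 1 := by
  simp only [pow_succ, pow_zero, one_mul]; apply Subtype.ext; decide

theorem rotX_sq_mul_rotZ_sq : rotX ^ 2 * rotZ ^ 2 = rotZ ^ 2 * rotX ^ 2 := by
  rw [pow_two, pow_two]; apply Subtype.ext; decide

/-- Among rotations only the trivial normal form is the identity, so the relations used above
present the octahedral group. -/
theorem octahedralWord_rot_eq_one {i j : ℕ} {k : Fin 6}
    (h : octahedralWord rotX rotZ i j k = 1) : i % 2 = 0 ∧ j % 2 = 0 ∧ k = 0 := by
  rw [octahedralWord_mod rotX_pow_four rotZ_pow_four] at h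
  have hi : i % 2 = 0 ∨ i % 2 = 1 := Nat.mod_two_eq_zero_or_one i
  have hj : j % 2 = 0 ∨ j % 2 = 1 := Nat.mod_two_eq_zero_or_one j
  rcases hi with hi | hi <;> rcases hj with hj | hj <;> rw [hi, hj] at h <;> rw [hi, hj] <;>
    revert h <;> rw [octahedralWord] <;> simp only [pow_zero, pow_one, one_mul, pow_two] <;>
    fin_cases k <;> decide

/-! ### Lifting the relations through a central extension by phases -/

section Lift

variable {G : Type*} [Group G] {phase : Circle →* G}

theorem phase_mul_mul (hc : ∀ ω g, Commute (phase ω) g) (a b : Circle) (g h : G) :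
    (phase a * g) * (phase b * h) = phase (a * b) * (g * h) := by
  rw [map_mul, mul_assoc, mul_assoc, ← mul_assoc g, ← (hc b g).eq, mul_assoc]

theorem exists_circle_pow_eq (w : Circle) {n : ℕ} (hn : n ≠ 0) : ∃ t : Circle, t ^ n = w := by
  refine ⟨Circle.exp (Complex.arg w / n), ?_⟩
  rw [← Circle.exp_nsmul, nsmul_eq_mul, mul_div_cancel₀ _ (by exact_mod_cast hn), Circle.exp_arg]

/-- A projective representation respects relations up to phases. -/
theorem exists_phase_of_prod_eq {H : Type*} [Group H] {U : H → G}
    (hc : ∀ ω g, Commute (phase ω) g) (hU : ∀ g h, ∃ ω, U g * U h = phase ω * U (g * h))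
    {l l' : List H} (h : l.prod = l'.prod) : ∃ ω, (l.map U).prod = phase ω * (l'.map U).prod := by
  have key : ∀ l : List H, ∃ ω, (l.map U).prod = phase ω * U l.prod := by
    intro l
    induction l with
    | nil =>
      obtain ⟨ω, hω⟩ := hU 1 1
      refine ⟨ω⁻¹, ?_⟩
      rw [mul_one, mul_left_inj] at hω
      simp [hω]
    | cons a l ih =>
      obtain ⟨ω, hω⟩ := ih
      obtain ⟨τ, hτ⟩ := hU a l.prod
      refine ⟨ω * τ, ?_⟩
      rw [List.map_cons, List.prod_cons, List.prod_cons, hω, map_mul, mul_assoc (phase ω), ← hτ,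
        ← mul_assoc, ← (hc ω _).eq, mul_assoc]
  obtain ⟨a, ha⟩ := key l
  obtain ⟨b, hb⟩ := key l'
  refine ⟨a * b⁻¹, ?_⟩
  rw [ha, hb, h, ← mul_assoc, ← map_mul, inv_mul_cancel_right]

/-- `rotX` as an element of the octahedral group. -/
def octX : octahedral := ⟨rotX, Subgroup.subset_closure (by simp)⟩

/-- `rotZ` as an element of the octahedral group. -/
def octZ : octahedral := ⟨rotZ, Subgroup.subset_closure (by simp)⟩

/-- If the half turns about two axes commute, the phases of the generators can be chosen such that
they satisfy the relations of the octahedral group. -/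
theorem exists_phase_generators {U : octahedral → G} (hc : ∀ ω g, Commute (phase ω) g)
    (hU : ∀ g h, ∃ ω, U g * U h = phase ω * U (g * h))
    (hcomm : U octX ^ 2 * U octZ ^ 2 = U octZ ^ 2 * U octX ^ 2) :
    ∃ a b : Circle, ∃ x z : G, x = phase a * U octX ∧ z = phase b * U octZ ∧
      x * z * x = z * x * z ∧ (x * z) ^ 3 = 1 ∧ x ^ 4 = 1 ∧ z ^ 4 = 1 ∧
      x ^ 2 * z ^ 2 = z ^ 2 * x ^ 2 := by
  set X := U octX
  set Z := U octZ
  obtain ⟨w, hw⟩ := exists_phase_of_prod_eq (l := [octX, octZ, octX]) (l' := [octZ, octX, octZ])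
    hc hU (by simpa [← mul_assoc] using Subtype.ext rotX_braid)
  obtain ⟨s, hs⟩ := exists_phase_of_prod_eq (l := [octX, octZ, octX, octZ, octX, octZ]) (l' := [])
    hc hU (by
      have := rotX_mul_rotZ_pow_three
      simp only [pow_three, mul_assoc] at this
      simpa using Subtype.ext this)
  obtain ⟨q, hq⟩ := exists_phase_of_prod_eq (l := [octX, octX, octX, octX]) (l' := [])
    hc hU (by
      have := rotX_pow_four
      simp only [pow_succ, pow_zero, one_mul, mul_assoc] at this
      simpa using Subtype.ext this)
  have hw' : X * Z * X = phase w * (Z * X * Z) := by simpa [mul_assoc] using hw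
  have hs' : (X * Z) ^ 3 = phase s := by simpa [pow_three, mul_assoc] using hs
  have hq' : X ^ 4 = phase q := by simpa [pow_succ, mul_assoc] using hq
  -- The relative phase `w⁻¹` of the two lifts repairs the braid relation. Their common phase enters
  -- `(xz)³` six times, hence a sixth root.
  obtain ⟨t, ht⟩ := exists_circle_pow_eq (w ^ 3 * s⁻¹) (n := 6) (by norm_num)
  have hpow : ∀ (a : Circle) (g : G) (n : ℕ), (phase a * g) ^ n = phase (a ^ n) * g ^ n :=
    fun a g n => by rw [(hc a g).mul_pow, map_pow]
  have braid : ∀ a, (phase (a * w⁻¹) * X) * (phase a * Z) * (phase (a * w⁻¹) * X) =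
      (phase a * Z) * (phase (a * w⁻¹) * X) * (phase a * Z) := by
    intro a
    rw [phase_mul_mul hc, phase_mul_mul hc, phase_mul_mul hc, phase_mul_mul hc, hw', ← mul_assoc,
      ← map_mul]
    congr 2
    calc a * w⁻¹ * a * (a * w⁻¹) * w = a * (a * w⁻¹) * a * (w⁻¹ * w) := by
          simp only [mul_comm, mul_left_comm]
      _ = _ := by rw [inv_mul_cancel, mul_one]
  have cube : ∀ a : Circle, ((phase (a * w⁻¹) * X) * (phase a * Z)) ^ 3 =
      phase (a ^ 6 * (w ^ 3)⁻¹ * s) := by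
    intro a
    rw [phase_mul_mul hc, hpow, hs', ← map_mul]
    congr 2
    rw [mul_pow, mul_pow, inv_pow, mul_right_comm, ← pow_add]
  have comm : ∀ a b : Circle, (phase a * X) ^ 2 * (phase b * Z) ^ 2 =
      (phase b * Z) ^ 2 * (phase a * X) ^ 2 := by
    intro a b
    rw [hpow, hpow, phase_mul_mul hc, phase_mul_mul hc, hcomm, mul_comm (a ^ 2)]
  have four : ∀ a : Circle, (phase a * X) ^ 4 = phase (a ^ 4 * q) := by
    intro a
    rw [hpow, hq', map_mul]
  have ht1 : t ^ 6 * (w ^ 3)⁻¹ * s = 1 := by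
    rw [ht, mul_inv_cancel_comm, inv_mul_cancel]
  obtain ⟨h1, -⟩ := pow_three_eq_one_of_braid (braid t) (by rw [cube, ht1, map_one]) (four _)
    (fun g => hc _ g) (comm _ _)
  -- The phase left in `x⁴`, whose image in `G` has cube one. Multiplying both generators by `p²`
  -- changes `x⁴` to `p⁹` and `(xz)³` by `p¹²`, both trivial in `G`.
  set p : Circle := (t * w⁻¹) ^ 4 * q with hp
  have hfour : (phase (t * p ^ 2 * w⁻¹) * X) ^ 4 = 1 := by
    rw [four]
    have : (t * p ^ 2 * w⁻¹) ^ 4 * q = (p ^ 3) ^ 3 := by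
      calc (t * p ^ 2 * w⁻¹) ^ 4 * q = p ^ 8 * ((t * w⁻¹) ^ 4 * q) := by
            rw [mul_right_comm, mul_pow, ← pow_mul, mul_comm _ (p ^ 8), mul_assoc]
        _ = _ := by rw [← hp, ← pow_succ, ← pow_mul]
    rw [this, map_pow, map_pow, h1, one_pow]
  have hcube : ((phase (t * p ^ 2 * w⁻¹) * X) * (phase (t * p ^ 2) * Z)) ^ 3 = 1 := by
    rw [cube]
    have : (t * p ^ 2) ^ 6 * (w ^ 3)⁻¹ * s = (p ^ 3) ^ 4 * (t ^ 6 * (w ^ 3)⁻¹ * s) := by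
      rw [mul_pow, ← pow_mul, ← pow_mul, mul_comm (t ^ 6)]
      simp only [mul_assoc]
    rw [this, ht1, mul_one, map_pow, map_pow, h1, one_pow]
  obtain ⟨-, h2⟩ := pow_three_eq_one_of_braid (braid (t * p ^ 2)) hcube hfour (by simp) (comm _ _)
  exact ⟨_, _, _, _, rfl, rfl, braid (t * p ^ 2), hcube, hfour, h2, comm _ _⟩

/-- If the half turns about two axes commute, a projective representation of the octahedral group
can be turned into a linear one. -/
theorem exists_linear_lift {U : octahedral → G} (hc : ∀ ω g, Commute (phase ω) g)
    (hU : ∀ g h, ∃ ω, U g * U h = phase ω * U (g * h))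
    (hcomm : U octX ^ 2 * U octZ ^ 2 = U octZ ^ 2 * U octX ^ 2) :
    ∃ β : octahedral → Circle, ∀ g h,
      (phase (β g) * U g) * (phase (β h) * U h) = phase (β (g * h)) * U (g * h) := by
  obtain ⟨a, b, x, z, hxd, hzd, hb, h3, hx, hz, hxz⟩ := exists_phase_generators hc hU hcomm
  -- `Γ` is the graph of the linear lift. It is single valued because a normal form whose rotation
  -- is trivial is the trivial word, and it differs from `U` only by phases.
  set Γ : Subgroup (octahedral × G) := Subgroup.closure {(octX, x), (octZ, z)} with hΓ
  have hinj : ∀ y ∈ Γ, y.1 = 1 → y.2 = 1 := by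
    intro y hy h1
    obtain ⟨i, j, k, rfl⟩ := exists_octahedralWord
      (Prod.ext (Subtype.ext rotX_braid) hb) (Prod.ext (Subtype.ext rotX_mul_rotZ_pow_three) h3)
      (Prod.ext (Subtype.ext rotX_pow_four) hx) (Prod.ext (Subtype.ext rotZ_pow_four) hz)
      (Prod.ext (Subtype.ext rotX_sq_mul_rotZ_sq) hxz) hy
    have h2 := congrArg (octahedral.subtype) h1
    have h3 := map_octahedralWord (x := (octX, x)) (z := (octZ, z))
      (octahedral.subtype.comp (MonoidHom.fst octahedral G)) i j k
    obtain ⟨hi, hj, rfl⟩ := octahedralWord_rot_eq_one (h3.symm.trans h2)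
    have h4 := map_octahedralWord (x := (octX, x)) (z := (octZ, z)) (MonoidHom.snd octahedral G) i j 0
    refine (h4.trans (octahedralWord_mod (x := x) (z := z) hx hz i j 0)).trans ?_
    rw [hi, hj]
    simp [octahedralWord]
  have hsurj : ∀ g : octahedral, ∃ u, (g, u) ∈ Γ := by
    rintro ⟨g, hg⟩
    induction hg using Subgroup.closure_induction with
    | mem y hy =>
      rcases hy with rfl | rfl
      · exact ⟨x, Subgroup.subset_closure (by simp [octX])⟩
      · exact ⟨z, Subgroup.subset_closure (by simp [octZ])⟩
    | one => exact ⟨1, Γ.one_mem⟩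
    | mul y y' hy hy' ih ih' =>
      obtain ⟨u, hu⟩ := ih
      obtain ⟨u', hu'⟩ := ih'
      exact ⟨u * u', Γ.mul_mem hu hu'⟩
    | inv y hy ih =>
      obtain ⟨u, hu⟩ := ih
      refine ⟨u⁻¹, ?_⟩
      have h := Γ.inv_mem hu
      rw [Prod.inv_mk] at h
      have h' : (⟨y, hy⟩ : octahedral)⁻¹ = ⟨y⁻¹, inv_mem hy⟩ := Subtype.ext (InvMemClass.coe_inv _)
      rwa [h'] at h
  have hray : ∀ y ∈ Γ, ∃ ω, y.2 = phase ω * U y.1 := by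
    obtain ⟨e, he⟩ := hU 1 1
    rw [mul_one, mul_left_inj] at he
    intro y hy
    induction hy using Subgroup.closure_induction with
    | mem y hy =>
      rcases hy with rfl | rfl
      · exact ⟨a, hxd⟩
      · exact ⟨b, hzd⟩
    | one => exact ⟨e⁻¹, by simp [he]⟩
    | mul y y' hy hy' ih ih' =>
      obtain ⟨u, hu⟩ := ih
      obtain ⟨u', hu'⟩ := ih'
      obtain ⟨v, hv⟩ := hU y.1 y'.1
      refine ⟨u * u' * v, ?_⟩
      rw [Prod.snd_mul, Prod.fst_mul, hu, hu', phase_mul_mul hc, hv, map_mul _ (u * u'), mul_assoc]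
    | inv y hy ih =>
      obtain ⟨u, hu⟩ := ih
      obtain ⟨v, hv⟩ := hU y.1 y.1⁻¹
      rw [mul_inv_cancel, he, ← map_mul] at hv
      refine ⟨u⁻¹ * (v * e)⁻¹, ?_⟩
      rw [Prod.snd_inv, Prod.fst_inv, inv_eq_iff_mul_eq_one, hu, phase_mul_mul hc, hv, ← map_mul,
        ← map_one phase]
      congr 1
      rw [mul_inv_cancel_left, inv_mul_cancel]
  choose u hu using hsurj
  choose β hβ using fun g => hray _ (hu g)
  refine ⟨β, fun g h => ?_⟩
  have h1 := hinj _ (Γ.mul_mem (Γ.mul_mem (hu g) (hu h)) (Γ.inv_mem (hu (g * h)))) (by simp)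
  rw [← hβ, ← hβ, ← hβ]
  simpa [mul_inv_eq_one] using h1

end Lift

/-! ### Pauli relations between the lifted half turns -/

section PauliGroup

variable {G : Type*} [Group G] {phase : Circle →* G} {U : octahedral → G}

/-- The half turns commute as rotations, so their lifts commute up to a phase `ε`. Moving `X²` past
the central `Z⁴` picks up `ε²`, which must be one. -/
theorem exists_commutator_phase (hc : ∀ ω g, Commute (phase ω) g)
    (hU : ∀ g h, ∃ ω, U g * U h = phase ω * U (g * h)) :
    ∃ ε, U octX ^ 2 * U octZ ^ 2 = phase ε * (U octZ ^ 2 * U octX ^ 2) ∧ phase ε ^ 2 = 1 := by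
  set X := U octX
  set Z := U octZ
  obtain ⟨ε, hε⟩ := exists_phase_of_prod_eq (l := [octX, octX, octZ, octZ])
    (l' := [octZ, octZ, octX, octX]) hc hU (by
      have := rotX_sq_mul_rotZ_sq
      simp only [pow_two, mul_assoc] at this
      simpa using Subtype.ext this)
  obtain ⟨q, hq⟩ := exists_phase_of_prod_eq (l := [octZ, octZ, octZ, octZ]) (l' := [])
    hc hU (by
      have := rotZ_pow_four
      simp only [pow_succ, pow_zero, one_mul, mul_assoc] at this
      simpa using Subtype.ext this)
  have hε' : X ^ 2 * Z ^ 2 = phase ε * (Z ^ 2 * X ^ 2) := by simpa [pow_two, mul_assoc] using hε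
  have hq' : Z ^ 4 = phase q := by simpa [pow_succ, mul_assoc] using hq
  refine ⟨ε, hε', ?_⟩
  have h1 : X ^ 2 * Z ^ 4 = phase ε ^ 2 * (Z ^ 4 * X ^ 2) := by
    calc X ^ 2 * Z ^ 4 = X ^ 2 * Z ^ 2 * Z ^ 2 := by rw [mul_assoc, ← pow_add]
      _ = phase ε * (Z ^ 2 * (X ^ 2 * Z ^ 2)) := by
        nth_rewrite 1 [hε']; simp only [mul_assoc]
      _ = phase ε * (phase ε * (Z ^ 2 * (Z ^ 2 * X ^ 2))) := by
        rw [hε', ← mul_assoc (Z ^ 2), ← (hc ε _).eq]; simp only [mul_assoc]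
      _ = _ := by
        rw [← mul_assoc (Z ^ 2), ← pow_add, ← mul_assoc (phase ε), ← pow_two]
  rw [hq', ← (hc q _).eq] at h1
  exact (mul_eq_right.1 h1.symm)

/-- With `C = zx`, this says that `C²` conjugates the half turn about `x` to the one about `z`. -/
theorem octahedral_relation_one : [octZ, octX, octZ, octX, octX, octX].prod =
    [octZ, octZ, octZ, octX, octZ, octX].prod := by
  apply Subtype.ext; apply Subtype.ext
  simp only [List.prod_cons, List.prod_nil, mul_one]
  show rotZ.1 * (rotX.1 * (rotZ.1 * (rotX.1 * (rotX.1 * rotX.1)))) =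
    rotZ.1 * (rotZ.1 * (rotZ.1 * (rotX.1 * (rotZ.1 * rotX.1))))
  decide

/-- With `C = zx`, this says that `x²` times its conjugate by `C` is `z²`: two half turns about
orthogonal axes compose to the third. -/
theorem octahedral_relation_two : [octX, octX, octZ, octX, octX, octX].prod =
    [octZ, octZ, octZ, octX].prod := by
  apply Subtype.ext; apply Subtype.ext
  simp only [List.prod_cons, List.prod_nil, mul_one]
  show rotX.1 * (rotX.1 * (rotZ.1 * (rotX.1 * (rotX.1 * rotX.1)))) =
    rotZ.1 * (rotZ.1 * (rotZ.1 * rotX.1))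
  decide

/-- Suitable phases of the half turns about the three axes satisfy the relations of the Pauli
matrices, and the generators of the octahedral group permute them like the axes. -/
theorem exists_pauli_elements (hc : ∀ ω g, Commute (phase ω) g)
    (hU : ∀ g h, ∃ ω, U g * U h = phase ω * U (g * h)) {ε : Circle}
    (hε : U octX ^ 2 * U octZ ^ 2 = phase ε * (U octZ ^ 2 * U octX ^ 2))
    (hε2 : phase ε ^ 2 = 1) :
    ∃ P₀ P₁ P₂ : G, (∃ ω, P₀ = phase ω * U octX ^ 2) ∧ (∃ ω, P₂ = phase ω * U octZ ^ 2) ∧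
      U octX * P₀ = P₀ * U octX ∧ U octX * P₁ = P₂ * U octX ∧
      U octX * P₂ = phase ε * P₁ * U octX ∧
      U octZ * P₀ = P₁ * U octZ ∧ U octZ * P₁ = phase ε * P₀ * U octZ ∧
      U octZ * P₂ = P₂ * U octZ ∧ P₀ ^ 2 = 1 ∧ P₂ ^ 2 = 1 ∧ P₂ * P₀ = phase ε * (P₀ * P₂) ∧
      ∃ j, P₀ * P₁ = phase j * P₂ ∧ phase (j ^ 2) = phase ε := by
  set X := U octX
  set Z := U octZ
  obtain ⟨q, hq⟩ := exists_phase_of_prod_eq (l := [octX, octX, octX, octX]) (l' := [])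
    hc hU (by
      have := rotX_pow_four
      simp only [pow_succ, pow_zero, one_mul, mul_assoc] at this
      simpa using Subtype.ext this)
  obtain ⟨s, hs⟩ := exists_phase_of_prod_eq (l := [octX, octZ, octX, octZ, octX, octZ]) (l' := [])
    hc hU (by
      have := rotX_mul_rotZ_pow_three
      simp only [pow_three, mul_assoc] at this
      simpa using Subtype.ext this)
  obtain ⟨v, hv⟩ := exists_phase_of_prod_eq hc hU octahedral_relation_one
  obtain ⟨u, hu⟩ := exists_phase_of_prod_eq hc hU octahedral_relation_two
  obtain ⟨t, ht⟩ := exists_circle_pow_eq q⁻¹ (n := 2) (by norm_num)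
  have hq' : X ^ 4 = phase q := by simpa [pow_succ, mul_assoc] using hq
  -- `C` lifts a rotation of order three that cycles the axes. The three Pauli elements are the
  -- orbit of the normalized half turn `P₀` under conjugation by `C`, which fixes their relative
  -- phases.
  set C := Z * X with hC
  have hs' : C ^ 3 = phase s := by
    have h1 : (X * Z) ^ 3 = phase s := by simpa [pow_three, mul_assoc] using hs
    calc C ^ 3 = X⁻¹ * (X * Z) ^ 3 * X := by simp [hC, pow_three, mul_assoc]
      _ = _ := by rw [h1, mul_assoc, (hc s X).eq, inv_mul_cancel_left]
  have hv' : C * C * X ^ 2 = phase v * (Z ^ 2 * (C * C)) := by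
    simpa [hC, pow_two, mul_assoc] using hv
  have hu' : X ^ 2 * C * X ^ 2 = phase u * (Z ^ 2 * C) := by
    simpa [hC, pow_two, mul_assoc] using hu
  set P₀ := phase t * X ^ 2 with hP₀
  set P₁ := C * P₀ * C⁻¹ with hP₁
  set P₂ := C * P₁ * C⁻¹ with hP₂
  have hP0sq : P₀ ^ 2 = 1 := by
    rw [hP₀, (hc t _).mul_pow, ← map_pow, ht, ← pow_mul, hq', ← map_mul, inv_mul_cancel, map_one]
  have hP2Z : P₂ = phase (t * v) * Z ^ 2 := by
    calc P₂ = C * C * (phase t * X ^ 2) * (C * C)⁻¹ := by simp [hP₂, hP₁, hP₀, mul_assoc]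
      _ = phase t * (C * C * X ^ 2) * (C * C)⁻¹ := by
        rw [← mul_assoc (C * C), ← (hc t _).eq]; simp only [mul_assoc]
      _ = _ := by rw [hv', map_mul]; simp [mul_assoc]
  have hcyc : C * P₂ * C⁻¹ = P₀ := by
    calc C * P₂ * C⁻¹ = C ^ 3 * P₀ * (C ^ 3)⁻¹ := by simp [hP₂, hP₁, pow_three, mul_assoc]
      _ = _ := by rw [hs', (hc s _).eq, mul_inv_cancel_right]
  have hXP0 : X * P₀ = P₀ * X := by
    rw [hP₀, ← mul_assoc, ← (hc t X).eq, mul_assoc, mul_assoc, ← pow_succ', ← pow_succ]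
  have hZP2 : Z * P₂ = P₂ * Z := by
    rw [hP2Z, ← mul_assoc, ← (hc _ Z).eq, mul_assoc, mul_assoc, ← pow_succ', ← pow_succ]
  have hZP0 : Z * P₀ = P₁ * Z := by
    calc Z * P₀ = Z * (P₀ * X) * X⁻¹ := by simp [mul_assoc]
      _ = C * P₀ * X⁻¹ := by rw [← hXP0, hC]; simp only [mul_assoc]
      _ = _ := by simp [hP₁, hC, mul_assoc]
  have hCP1 : C * P₁ = P₂ * C := by simp [hP₂]
  have hXP1 : X * P₁ = P₂ * X := by
    calc X * P₁ = Z⁻¹ * (C * P₁) := by simp [hC, mul_assoc]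
      _ = Z⁻¹ * (P₂ * Z) * X := by rw [hCP1, hC]; simp only [mul_assoc]
      _ = _ := by rw [← hZP2, inv_mul_cancel_left]
  have hanti : P₀ * P₂ = phase ε * (P₂ * P₀) := by
    rw [hP2Z, hP₀, phase_mul_mul hc, phase_mul_mul hc, hε, mul_comm t]
    exact (hc ε _).symm.left_comm _
  have hanti' : P₂ * P₀ = phase ε * (P₀ * P₂) := by
    rw [hanti, ← mul_assoc (phase ε), ← pow_two (phase ε), hε2, one_mul]
  have hconj : ∀ a b : G, C * (a * b) * C⁻¹ = (C * a * C⁻¹) * (C * b * C⁻¹) := fun a b => by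
    simp [mul_assoc]
  have hanti1 : P₁ * P₀ = phase ε * (P₀ * P₁) := by
    have h := congrArg (fun y => C * y * C⁻¹) hanti
    simp only [hconj, hcyc, ← hP₁] at h
    rwa [← (hc ε C).eq, mul_inv_cancel_right] at h
  have hadj : ∀ (ω : Circle) (g y : G), phase ω * g * y * (phase ω * g)⁻¹ = g * y * g⁻¹ :=
    fun ω g y => by
      calc phase ω * g * y * (phase ω * g)⁻¹ = phase ω * (g * y * g⁻¹) * (phase ω)⁻¹ := by
            simp [mul_assoc]
        _ = _ := by rw [(hc ω _).eq, mul_inv_cancel_right]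
  have hXX : ∀ y, X ^ 2 * y * (X ^ 2)⁻¹ = P₀ * y * P₀⁻¹ := fun y => by
    exact (hadj t _ y).symm
  have hZZ : ∀ y, Z ^ 2 * y * (Z ^ 2)⁻¹ = P₂ * y * P₂⁻¹ := fun y => by
    rw [hP2Z]
    exact (hadj _ _ y).symm
  refine ⟨P₀, P₁, P₂, ⟨t, rfl⟩, ⟨_, hP2Z⟩, hXP0, hXP1, ?_, hZP0, ?_, hZP2, hP0sq, ?_, hanti',
    ?_⟩
  · calc X * P₂ = X * (P₂ * X) * X⁻¹ := by simp [mul_assoc]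
      _ = X ^ 2 * P₁ * (X ^ 2)⁻¹ * X := by rw [← hXP1]; simp [pow_two, mul_assoc]
      _ = phase ε ^ 2 * (P₀ * P₁) * P₀⁻¹ * X := by rw [hXX, hε2, one_mul]
      _ = phase ε * (P₁ * P₀) * P₀⁻¹ * X := by rw [hanti1, pow_two]; simp only [mul_assoc]
      _ = _ := by simp [mul_assoc]
  · calc Z * P₁ = Z * (P₁ * Z) * Z⁻¹ := by simp [mul_assoc]
      _ = Z ^ 2 * P₀ * (Z ^ 2)⁻¹ * Z := by rw [← hZP0]; simp [pow_two, mul_assoc]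
      _ = phase ε * (P₀ * P₂) * P₂⁻¹ * Z := by rw [hZZ, hanti']
      _ = _ := by simp [mul_assoc]
  · calc P₂ ^ 2 = C * C * P₀ ^ 2 * (C * C)⁻¹ := by simp [hP₂, hP₁, pow_two, mul_assoc]
      _ = 1 := by rw [hP0sq, mul_one, mul_inv_cancel]
  · have hj : P₀ * P₁ = phase (t * u * v⁻¹) * P₂ := by
      calc P₀ * P₁ = phase t * X ^ 2 * C * (phase t * X ^ 2) * C⁻¹ := by
            simp only [hP₁, hP₀, mul_assoc]
        _ = phase (t * t) * (X ^ 2 * C * X ^ 2) * C⁻¹ := by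
          rw [mul_assoc (phase t), phase_mul_mul hc]
        _ = phase (t * t * u) * Z ^ 2 := by
          rw [hu', map_mul _ (t * t)]; simp [mul_assoc]
        _ = _ := by
          rw [hP2Z, ← mul_assoc, ← map_mul]
          congr 2
          rw [mul_comm t v, mul_assoc _ v⁻¹, inv_mul_cancel_left, mul_right_comm]
    refine ⟨_, hj, ?_⟩
    set j := t * u * v⁻¹
    have hP1sq : P₁ ^ 2 = 1 := by rw [hP₁, conj_pow, hP0sq, mul_one, mul_inv_cancel]
    have hP2sq : P₂ ^ 2 = 1 := by rw [hP₂, conj_pow, hP1sq, mul_one, mul_inv_cancel]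
    calc phase (j ^ 2) = (phase j * P₂) ^ 2 := by rw [(hc j _).mul_pow, hP2sq, mul_one, map_pow]
      _ = P₀ * (P₁ * P₀) * P₁ := by rw [← hj, pow_two]; simp only [mul_assoc]
      _ = phase ε * P₀ ^ 2 * P₁ ^ 2 := by
        rw [hanti1, ← mul_assoc P₀, ← (hc ε P₀).eq]; simp only [pow_two, mul_assoc]
      _ = _ := by rw [hP0sq, hP1sq, mul_one, mul_one]

end PauliGroup

/-! ### Triples transforming as vectors -/

section Covariance

variable {n : Type*} [Fintype n] [DecidableEq n]

/-- Conjugation by `u` acts on the triple `P` as the rotation `g`. -/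
def Covariant (g : Matrix.SpecialLinearGroup (Fin 3) ℤ) (u : Matrix n n ℂ)
    (P : Fin 3 → Matrix n n ℂ) : Prop :=
  ∀ i, u * P i * uᴴ = ∑ j, spinOne g j i • P j

theorem spinOne_one : spinOne 1 = 1 := by
  ext i j
  simp [spinOne, Matrix.one_apply, apply_ite]

theorem spinOne_mul (g h : Matrix.SpecialLinearGroup (Fin 3) ℤ) :
    spinOne (g * h) = spinOne g * spinOne h := by
  ext i j
  simp [spinOne, Matrix.mul_apply]

theorem Covariant.one (P : Fin 3 → Matrix n n ℂ) : Covariant 1 1 P := by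
  intro i
  simp [spinOne_one, Matrix.one_apply]

theorem Covariant.mul {g h : Matrix.SpecialLinearGroup (Fin 3) ℤ} {u v : Matrix n n ℂ}
    {P : Fin 3 → Matrix n n ℂ} (hu : Covariant g u P) (hv : Covariant h v P) :
    Covariant (g * h) (u * v) P := by
  intro i
  calc u * v * P i * (u * v)ᴴ = u * (v * P i * vᴴ) * uᴴ := by
        rw [Matrix.conjTranspose_mul]; simp only [Matrix.mul_assoc]
    _ = ∑ k, spinOne h k i • ∑ j, spinOne g j k • P j := by
      rw [hv, Matrix.mul_sum, Matrix.sum_mul]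
      refine Finset.sum_congr rfl fun k _ => ?_
      rw [Matrix.mul_smul, Matrix.smul_mul, hu]
    _ = _ := by
      simp only [Finset.smul_sum, smul_smul]
      rw [Finset.sum_comm]
      refine Finset.sum_congr rfl fun j _ => ?_
      rw [spinOne_mul, Matrix.mul_apply, Finset.sum_smul]
      exact Finset.sum_congr rfl fun k _ => by rw [mul_comm]

theorem Covariant.inv {g : Matrix.SpecialLinearGroup (Fin 3) ℤ} {u : Matrix n n ℂ}
    {P : Fin 3 → Matrix n n ℂ} (hu : Covariant g u P) (huu : uᴴ * u = 1) :
    Covariant g⁻¹ uᴴ P := by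
  intro k
  have h1 : ∑ i, spinOne g⁻¹ i k • (u * P i * uᴴ) = P k := by
    simp only [hu _, Finset.smul_sum, smul_smul]
    rw [Finset.sum_comm]
    have : ∀ j, ∑ i, (spinOne g⁻¹ i k * spinOne g j i) • P j =
        (1 : Matrix (Fin 3) (Fin 3) ℂ) j k • P j := fun j => by
      rw [← Finset.sum_smul, ← spinOne_one, ← mul_inv_cancel g, spinOne_mul, Matrix.mul_apply]
      exact congrArg (· • P j) (Finset.sum_congr rfl fun i _ => mul_comm _ _)
    simp [this, Matrix.one_apply]
  conv_lhs => rw [← h1]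
  rw [Matrix.conjTranspose_conjTranspose, Matrix.mul_sum, Matrix.sum_mul]
  refine Finset.sum_congr rfl fun i _ => ?_
  rw [Matrix.mul_smul, Matrix.smul_mul]
  congr 1
  calc uᴴ * (u * P i * uᴴ) * u = (uᴴ * u) * P i * (uᴴ * u) := by simp only [Matrix.mul_assoc]
    _ = _ := by rw [huu, Matrix.one_mul, Matrix.mul_one]

theorem Covariant.smul {g : Matrix.SpecialLinearGroup (Fin 3) ℤ} {u : Matrix n n ℂ}
    {P : Fin 3 → Matrix n n ℂ} (hu : Covariant g u P) {w : ℂ} (hw : w * star w = 1) :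
    Covariant g (w • u) P := by
  intro i
  rw [Matrix.conjTranspose_smul, Matrix.smul_mul, Matrix.smul_mul, Matrix.mul_smul, smul_smul, hw,
    one_smul, hu]

end Covariance

/-- The spin-1/2 representation, up to phases. -/
theorem exists_covariant_pauli (g : octahedral) :
    ∃ S : Matrix.unitaryGroup (Fin 2) ℂ, Covariant g.1 S.1 pauli := by
  -- `quarterTurn κ` rotates by `-π/2` and so implements `r⁻¹`; its adjoint implements `r`.
  have key : ∀ (κ : Fin 3) (r : Matrix.SpecialLinearGroup (Fin 3) ℤ),
      (∀ i, quarterTurn κ * pauli i * (quarterTurn κ)ᴴ = ∑ j, spinOne r i j • pauli j) →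
      (∀ i j, spinOne r⁻¹ i j = spinOne r j i) →
      ∃ S : Matrix.unitaryGroup (Fin 2) ℂ, Covariant r S.1 pauli := by
    intro κ r h hr
    refine ⟨⟨(quarterTurn κ)ᴴ, ?_⟩, ?_⟩
    · rw [Matrix.mem_unitaryGroup_iff, Matrix.star_eq_conjTranspose,
        Matrix.conjTranspose_conjTranspose]
      exact mul_eq_one_comm.1 (quarterTurn_mul_conjTranspose κ)
    · have h1 : Covariant r⁻¹ (quarterTurn κ) pauli := fun i => by rw [h]; simp only [hr]
      have := h1.inv (mul_eq_one_comm.1 (quarterTurn_mul_conjTranspose κ))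
      rwa [inv_inv] at this
  have hinv : ∀ r : Matrix.SpecialLinearGroup (Fin 3) ℤ, r.1 * r.1ᵀ = 1 →
      ∀ i j, spinOne r⁻¹ i j = spinOne r j i := by
    intro r hr i j
    have h1 : (r⁻¹).1 = r.1ᵀ := by
      have h2 : (r⁻¹).1 * r.1 = 1 := congrArg Subtype.val (inv_mul_cancel r)
      calc (r⁻¹).1 = (r⁻¹).1 * (r.1 * r.1ᵀ) := by rw [hr, Matrix.mul_one]
        _ = _ := by rw [← Matrix.mul_assoc, h2, Matrix.one_mul]
    rw [spinOne, h1]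
    rfl
  obtain ⟨g, hg⟩ := g
  show ∃ S : Matrix.unitaryGroup (Fin 2) ℂ, Covariant g S.1 pauli
  induction hg using Subgroup.closure_induction with
  | mem y hy =>
    rcases hy with rfl | rfl
    · refine key 0 rotX (fun i => ?_) (hinv rotX (by decide))
      simp only [spinOne_rotX_smul_pauli, Finset.sum_ite_eq', Finset.mem_univ, if_true]
    · refine key 2 rotZ (fun i => ?_) (hinv rotZ (by decide))
      simp only [spinOne_rotZ_smul_pauli, Finset.sum_ite_eq', Finset.mem_univ, if_true]
  | one => exact ⟨1, Covariant.one pauli⟩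
  | mul y y' _ _ ih ih' =>
    obtain ⟨S, hS⟩ := ih
    obtain ⟨S', hS'⟩ := ih'
    exact ⟨S * S', hS.mul hS'⟩
  | inv y _ ih =>
    obtain ⟨S, hS⟩ := ih
    exact ⟨S⁻¹, hS.inv (Matrix.mem_unitaryGroup_iff'.1 S.2)⟩

/-! ### Pauli matrices on the virtual space in the nontrivial phase -/

section Phases

variable {N : ℕ}

/-- The scalar unitary matrices. -/
def phase (N : ℕ) : Circle →* Matrix.unitaryGroup (Fin N) ℂ where
  toFun w := ⟨(w : ℂ) • 1, by
    rw [Matrix.mem_unitaryGroup_iff, star_smul, star_one, Matrix.smul_mul, Matrix.mul_smul,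
      Matrix.mul_one, smul_smul, Complex.star_def, Complex.mul_conj, Complex.normSq_eq_norm_sq,
      Circle.norm_coe]
    simp⟩
  map_one' := Subtype.ext (by simp)
  map_mul' a b := Subtype.ext (by simp [smul_smul, mul_comm])

theorem phase_commute (w : Circle) (g : Matrix.unitaryGroup (Fin N) ℂ) :
    Commute (phase N w) g := by
  apply Subtype.ext
  show ((w : ℂ) • (1 : Matrix (Fin N) (Fin N) ℂ)) * g.1 = g.1 * ((w : ℂ) • 1)
  rw [Matrix.smul_mul, Matrix.mul_smul, Matrix.one_mul, Matrix.mul_one]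

theorem phase_mul_val (w : Circle) (g : Matrix.unitaryGroup (Fin N) ℂ) :
    (phase N w * g).1 = (w : ℂ) • g.1 := by
  show ((w : ℂ) • (1 : Matrix (Fin N) (Fin N) ℂ)) * g.1 = _
  rw [Matrix.smul_mul, Matrix.one_mul]

theorem phase_injective [Nonempty (Fin N)] : Function.Injective (phase N) := by
  intro a b h
  obtain ⟨i⟩ := ‹Nonempty (Fin N)›
  have h1 := congrFun (congrFun (congrArg Subtype.val h) i) i
  exact Circle.ext (by simpa [phase] using h1)

theorem IsSPTOState.exists_phase {A : Fin 3 → Matrix (Fin N) (Fin N) ℂ}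
    {U : octahedral → Matrix.unitaryGroup (Fin N) ℂ} (hA : IsSPTOState A U) (g h : octahedral) :
    ∃ w, U g * U h = phase N w * U (g * h) := by
  obtain ⟨w, hw, hgh⟩ := hA.projective g h
  have hw' : w ∈ Submonoid.unitSphere ℂ := mem_sphere_zero_iff_norm.2 hw
  exact ⟨⟨w, hw'⟩, Subtype.ext (hgh.trans (phase_mul_val ⟨w, hw'⟩ (U (g * h))).symm)⟩

/-- In the nontrivial phase, the symmetry operations determine a representation of the Pauli
matrices on the virtual space. -/
theorem IsSPTOState.exists_pauli {A : Fin 3 → Matrix (Fin N) (Fin N) ℂ}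
    {U : octahedral → Matrix.unitaryGroup (Fin N) ℂ} (hA : IsSPTOState A U) :
    ∃ P : Fin 3 → Matrix (Fin N) (Fin N) ℂ, (∀ i, (P i)ᴴ * P i = 1) ∧ (∀ i, P i * P i = 1) ∧
      P 2 * P 0 = -(P 0 * P 2) ∧ P 1 = Complex.I • (P 0 * P 2) ∧
      (∀ g, Covariant g.1 (U g).1 P) ∧
      (∃ w : ℂ, P 0 = w • (U (octX * octX)).1) ∧ (∃ w : ℂ, P 2 = w • (U (octZ * octZ)).1) := by
  obtain ⟨Λ, hΛ⟩ := hA.canonical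
  have := hΛ.nonempty
  have hU := hA.exists_phase
  obtain ⟨ε, hε, hε2⟩ := exists_commutator_phase phase_commute hU
  -- Commuting half turns would allow a linear lift, contradicting the nontrivial class; so `ε =
  -- -1`.
  have hne : phase N ε ≠ 1 := by
    intro h1
    rw [h1, one_mul] at hε
    obtain ⟨β, hβ⟩ := exists_linear_lift phase_commute hU hε
    refine hA.nontrivial ⟨fun g => β g, fun g => Circle.norm_coe _, fun g h => ?_⟩
    have := congrArg Subtype.val (hβ g h)
    rwa [phase_mul_val, Submonoid.coe_mul, phase_mul_val, phase_mul_val] at this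
  have hεC : (ε : ℂ) = -1 := by
    rw [← map_pow, ← map_one (phase N)] at hε2
    have h2 : (ε : ℂ) ^ 2 = 1 := by
      have := congrArg (fun w : Circle => (w : ℂ)) (phase_injective hε2)
      simpa using this
    refine (mul_self_eq_one_iff.1 ((pow_two _).symm.trans h2)).resolve_left fun h3 => hne ?_
    rw [show ε = 1 from Circle.ext (by simpa using h3), map_one]
  obtain ⟨P₀, P₁, P₂, ⟨a, ha⟩, ⟨b, hb⟩, hX0, hX1, hX2, hZ0, hZ1, hZ2, hs0, hs2, hanti, j, hj, hj2⟩ :=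
    exists_pauli_elements phase_commute hU hε hε2
  have hjC : (j : ℂ) ^ 2 = -1 := by
    rw [← hεC, ← phase_injective hj2]; simp
  -- Since `j = ±i`, this is a sign. Covariance leaves the overall sign of the triple free, and `σ`
  -- selects the handedness `P 1 = i P 0 P 2` of the Pauli matrices.
  set σ : ℂ := -Complex.I * j with hσ
  have hσ2 : σ * σ = 1 := by
    rw [hσ]; linear_combination (Complex.I ^ 2) * hjC - Complex.I_sq
  have hσs : star σ * σ = 1 := by
    rcases mul_self_eq_one_iff.1 hσ2 with h | h <;> rw [h] <;> simp
  have hneg : ∀ g : Matrix.unitaryGroup (Fin N) ℂ, (phase N ε * g).1 = -g.1 := fun g => by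
    rw [phase_mul_val, hεC, neg_smul, one_smul]
  have hunit : ∀ g : Matrix.unitaryGroup (Fin N) ℂ, g.1ᴴ * g.1 = 1 := fun g =>
    Matrix.mem_unitaryGroup_iff'.1 g.2
  have hunit' : ∀ g : Matrix.unitaryGroup (Fin N) ℂ, g.1 * g.1ᴴ = 1 := fun g =>
    Matrix.mem_unitaryGroup_iff.1 g.2
  have hs0' : P₀.1 * P₀.1 = 1 := by rw [← pow_two]; exact congrArg Subtype.val hs0
  have hs2' : P₂.1 * P₂.1 = 1 := by rw [← pow_two]; exact congrArg Subtype.val hs2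
  have hanti' : P₂.1 * P₀.1 = -(P₀.1 * P₂.1) := (congrArg Subtype.val hanti).trans (hneg _)
  have hj' : P₀.1 * P₁.1 = (j : ℂ) • P₂.1 := (congrArg Subtype.val hj).trans (phase_mul_val _ _)
  have hP1 : P₁.1 = (j : ℂ) • (P₀.1 * P₂.1) := by
    rw [← Matrix.mul_smul, ← hj', ← Matrix.mul_assoc, hs0', Matrix.one_mul]
  have hs1' : P₁.1 * P₁.1 = 1 := by
    rw [hP1, Matrix.smul_mul, Matrix.mul_smul, smul_smul]
    calc ((j : ℂ) * j) • (P₀.1 * P₂.1 * (P₀.1 * P₂.1)) =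
        ((j : ℂ) ^ 2) • (P₀.1 * (P₂.1 * P₀.1) * P₂.1) := by
          rw [pow_two]; simp only [Matrix.mul_assoc]
      _ = (P₀.1 * P₀.1) * (P₂.1 * P₂.1) := by
        rw [hjC, hanti']
        simp [Matrix.mul_assoc]
      _ = 1 := by rw [hs0', hs2', Matrix.one_mul]
  set Q : Fin 3 → Matrix.unitaryGroup (Fin N) ℂ := ![P₀, P₁, P₂] with hQ
  have hQs : ∀ i, (Q i).1 * (Q i).1 = 1 := by
    intro i; fin_cases i
    exacts [hs0', hs1', hs2']
  have hconj : ∀ {u p : Matrix.unitaryGroup (Fin N) ℂ} {q : Matrix (Fin N) (Fin N) ℂ},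
      u.1 * p.1 = q * u.1 → u.1 * (σ • p.1) * u.1ᴴ = σ • q := by
    intro u p q h
    rw [Matrix.mul_smul, Matrix.smul_mul, h, Matrix.mul_assoc, hunit', Matrix.mul_one]
  have hcov : ∀ g : octahedral, Covariant g.1 (U g).1 (fun i => σ • (Q i).1) := by
    obtain ⟨e, he⟩ := hU 1 1
    rw [mul_one, mul_left_inj] at he
    -- Conjugation ignores phases, so covariance may be checked on any lift and thus extends from
    -- the generators although `U` is only projective.
    have hphase : ∀ (w : Circle) (y : Matrix.SpecialLinearGroup (Fin 3) ℤ) (hy : y ∈ octahedral)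
        (u : Matrix.unitaryGroup (Fin N) ℂ),
        u = phase N w * U ⟨y, hy⟩ → Covariant y u.1 (fun i => σ • (Q i).1) →
        Covariant y (U ⟨y, hy⟩).1 (fun i => σ • (Q i).1) := by
      intro w y hy u hu h
      have h1 : (U ⟨y, hy⟩).1 = ((w⁻¹ : Circle) : ℂ) • u.1 := by
        rw [← phase_mul_val, hu, ← mul_assoc, ← map_mul, inv_mul_cancel, map_one, one_mul]
      rw [h1]
      refine h.smul ?_
      rw [Complex.star_def, Complex.mul_conj, Complex.normSq_eq_norm_sq, Circle.norm_coe]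
      simp
    rintro ⟨g, hg⟩
    change Covariant g (U ⟨g, hg⟩).1 _
    induction hg using Subgroup.closure_induction with
    | mem y hy =>
      rcases hy with rfl | rfl
      · intro i
        have e0 := hconj (congrArg Subtype.val hX0)
        have e1 := hconj (congrArg Subtype.val hX1)
        have e2 := hconj ((congrArg Subtype.val hX2).trans
          (congrArg (· * (U octX).1) (hneg P₁)))
        fin_cases i
        · exact e0.trans (by simp [Fin.sum_univ_three, spinOne, rotX, hQ])
        · exact e1.trans (by simp [Fin.sum_univ_three, spinOne, rotX, hQ])
        · exact e2.trans (by simp [Fin.sum_univ_three, spinOne, rotX, hQ])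
      · intro i
        have e0 := hconj (congrArg Subtype.val hZ0)
        have e1 := hconj ((congrArg Subtype.val hZ1).trans
          (congrArg (· * (U octZ).1) (hneg P₀)))
        have e2 := hconj (congrArg Subtype.val hZ2)
        fin_cases i
        · exact e0.trans (by simp [Fin.sum_univ_three, spinOne, rotZ, hQ])
        · exact e1.trans (by simp [Fin.sum_univ_three, spinOne, rotZ, hQ])
        · exact e2.trans (by simp [Fin.sum_univ_three, spinOne, rotZ, hQ])
    | one =>
      exact hphase e⁻¹ 1 (one_mem _) 1 (by
        rw [show (⟨1, one_mem _⟩ : octahedral) = 1 from rfl, he, ← map_mul, inv_mul_cancel,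
          map_one]) (Covariant.one _)
    | mul y y' hy hy' ih ih' =>
      obtain ⟨w, hw⟩ := hU ⟨y, hy⟩ ⟨y', hy'⟩
      rw [MulMemClass.mk_mul_mk] at hw
      exact hphase w _ _ _ hw (ih.mul ih')
    | inv y hy ih =>
      obtain ⟨w, hw⟩ := hU ⟨y, hy⟩ ⟨y, hy⟩⁻¹
      have h' : (⟨y, hy⟩ : octahedral)⁻¹ = ⟨y⁻¹, inv_mem hy⟩ := Subtype.ext (InvMemClass.coe_inv _)
      rw [mul_inv_cancel, he, ← map_mul, h'] at hw
      refine hphase (w * e)⁻¹ _ _ (U ⟨y, hy⟩)⁻¹ ?_ (ih.inv (hunit _))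
      rw [map_inv, eq_inv_mul_iff_mul_eq, (phase_commute _ _).eq, ← hw, inv_mul_cancel_left]
  have hray : ∀ (g : octahedral) (p : Matrix.unitaryGroup (Fin N) ℂ) (a : Circle),
      p = phase N a * U g ^ 2 → ∃ w : ℂ, σ • p.1 = w • (U (g * g)).1 := by
    intro g p a hp
    obtain ⟨w, hw⟩ := hU g g
    refine ⟨σ * ((a * w : Circle) : ℂ), ?_⟩
    rw [hp, pow_two, hw, ← mul_assoc, ← map_mul, phase_mul_val, smul_smul]
  refine ⟨fun i => σ • (Q i).1, fun i => ?_, fun i => ?_, ?_, ?_, hcov, hray octX P₀ a ha,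
    hray octZ P₂ b hb⟩
  · rw [Matrix.conjTranspose_smul, Matrix.smul_mul, Matrix.mul_smul, smul_smul, hσs, one_smul, hunit]
  · rw [Matrix.smul_mul, Matrix.mul_smul, smul_smul, hσ2, one_smul, hQs]
  · show σ • P₂.1 * σ • P₀.1 = -(σ • P₀.1 * σ • P₂.1)
    simp only [Matrix.smul_mul, Matrix.mul_smul, hanti', smul_neg]
  · show σ • P₁.1 = Complex.I • (σ • P₀.1 * σ • P₂.1)
    rw [hP1, Matrix.smul_mul, Matrix.mul_smul, smul_smul, smul_smul, smul_smul]
    congr 1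
    linear_combination (-Complex.I * σ) * hσ + σ * (j : ℂ) * Complex.I_sq

end Phases

/-! ### The protected qubit -/

/-- Two anticommuting Hermitian involutions generate the Pauli matrices of a qubit. -/
theorem exists_qubit_factor {N : ℕ} {X Z : Matrix (Fin N) (Fin N) ℂ} (hX : Xᴴ = X) (hZ : Zᴴ = Z)
    (hXX : X * X = 1) (hZZ : Z * Z = 1) (hZX : Z * X = -(X * Z)) :
    ∃ (D : ℕ) (W : Matrix (Fin 2 × Fin D) (Fin N) ℂ), W * Wᴴ = 1 ∧ Wᴴ * W = 1 ∧
      W * X = (pauli 0 ⊗ₖ (1 : Matrix (Fin D) (Fin D) ℂ)) * W ∧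
      W * Z = (pauli 2 ⊗ₖ (1 : Matrix (Fin D) (Fin D) ℂ)) * W := by
  -- The projection onto the `+1` eigenspace of `Z`. As `X` exchanges the two eigenspaces, an
  -- orthonormal basis `Q` of this one and its image `Q X` together form the unitary `W`.
  set E : Matrix (Fin N) (Fin N) ℂ := (1 / 2 : ℂ) • (1 + Z) with hE
  have hEE : E * E = E := by
    rw [hE, Matrix.smul_mul, Matrix.mul_smul, smul_smul, Matrix.add_mul, Matrix.mul_add, Matrix.mul_add, hZZ]
    simp only [Matrix.one_mul, Matrix.mul_one]
    module
  have hEh : Eᴴ = E := by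
    rw [hE, Matrix.conjTranspose_smul, Matrix.conjTranspose_add, Matrix.conjTranspose_one, hZ]
    simp
  have hEZ : E * Z = E := by
    rw [hE, Matrix.smul_mul, Matrix.add_mul, hZZ, Matrix.one_mul, add_comm]
  have hXEX : X * E * X = 1 - E := by
    have h1 : X * Z * X = -Z := by
      rw [Matrix.mul_assoc, hZX, Matrix.mul_neg, ← Matrix.mul_assoc, hXX, Matrix.one_mul]
    rw [hE, Matrix.mul_smul, Matrix.smul_mul, Matrix.mul_add, Matrix.add_mul, Matrix.mul_one, hXX,
      h1]
    module
  have hEXE : E * X * E = 0 := by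
    calc E * X * E = E * (X * E * X) * X := by
          simp only [Matrix.mul_assoc]; rw [hXX, Matrix.mul_one]
      _ = 0 := by rw [hXEX, Matrix.mul_sub, hEE, Matrix.mul_one, sub_self, Matrix.zero_mul]
  have hpos : E.PosSemidef := by
    have := Matrix.posSemidef_conjTranspose_mul_self E
    rwa [hEh, hEE] at this
  obtain ⟨p, q, -, R, δ, hR1, hR2, hδ, hR⟩ := exists_diagonalization hpos
  set Δ : Matrix (Fin p) (Fin p) ℂ := Matrix.diagonal fun i => (δ i : ℂ) with hΔ
  set Q : Matrix (Fin p) (Fin N) ℂ := R.submatrix Sum.inl id with hQ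
  have hQQ : Q * Qᴴ = 1 := by
    have h1 : Q * Qᴴ = (R * Rᴴ).submatrix Sum.inl Sum.inl := by
      ext i j; simp [hQ, Matrix.mul_apply]
    rw [h1, hR1]
    ext i j; simp [Matrix.one_apply]
  have hEQ : E = Qᴴ * Δ * Q := by
    have h1 : E = Rᴴ * (R * E * Rᴴ) * R := by
      calc E = (Rᴴ * R) * E * (Rᴴ * R) := by rw [hR2, Matrix.one_mul, Matrix.mul_one]
        _ = _ := by simp only [Matrix.mul_assoc]
    rw [h1, hR]
    ext i j
    simp [hQ, Matrix.mul_apply, Fintype.sum_sum_type]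
  have hΔ1 : Δ = 1 := by
    have h1 : Q * E * Qᴴ = Δ := by
      rw [hEQ]
      calc Q * (Qᴴ * Δ * Q) * Qᴴ = (Q * Qᴴ) * Δ * (Q * Qᴴ) := by simp only [Matrix.mul_assoc]
        _ = Δ := by rw [hQQ, Matrix.one_mul, Matrix.mul_one]
    have h2 : Δ * Δ = Δ := by
      calc Δ * Δ = Q * (Qᴴ * Δ * (Q * Qᴴ) * Δ * Q) * Qᴴ := by
            rw [hQQ, Matrix.mul_one]
            calc Δ * Δ = (Q * Qᴴ) * Δ * Δ * (Q * Qᴴ) := by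
                  rw [hQQ, Matrix.one_mul, Matrix.mul_one]
              _ = _ := by simp only [Matrix.mul_assoc]
        _ = Q * (E * E) * Qᴴ := by rw [hEQ]; simp only [Matrix.mul_assoc]
        _ = Δ := by rw [hEE, h1]
    ext i j
    have h3 := congrFun (congrFun h2 i) i
    simp only [hΔ, Matrix.diagonal_mul_diagonal, Matrix.diagonal_apply_eq] at h3
    have h4 : (δ i : ℂ) = 1 := by
      have : (δ i : ℂ) ≠ 0 := by exact_mod_cast (hδ i).ne'
      exact mul_left_cancel₀ this (by rw [h3, mul_one])
    by_cases hij : i = j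
    · subst hij; simp [hΔ, h4]
    · simp [hΔ, hij]
  rw [hΔ1, Matrix.mul_one] at hEQ
  have hQE : Q * E = Q := by rw [hEQ, ← Matrix.mul_assoc, hQQ, Matrix.one_mul]
  have hEQh : E * Qᴴ = Qᴴ := by rw [hEQ, Matrix.mul_assoc, hQQ, Matrix.mul_one]
  have hQXQ : Q * X * Qᴴ = 0 := by
    calc Q * X * Qᴴ = (Q * E) * X * (E * Qᴴ) := by rw [hQE, hEQh]
      _ = Q * (E * X * E) * Qᴴ := by simp only [Matrix.mul_assoc]
      _ = 0 := by rw [hEXE, Matrix.mul_zero, Matrix.zero_mul]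
  have hQZ : Q * Z = Q := by
    rw [← hQE, Matrix.mul_assoc, hEZ]
  have hQXZ : Q * X * Z = -(Q * X) := by
    have h1 : X * Z = -(Z * X) := by rw [hZX, neg_neg]
    rw [Matrix.mul_assoc, h1, Matrix.mul_neg, ← Matrix.mul_assoc, hQZ]
  set B : Fin 2 → Matrix (Fin p) (Fin N) ℂ := ![Q, Q * X] with hB
  set W : Matrix (Fin 2 × Fin p) (Fin N) ℂ := Matrix.of fun i j => B i.1 i.2 j with hW
  have hBB : ∀ i j, B i * (B j)ᴴ = if i = j then 1 else 0 := by
    intro i j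
    fin_cases i <;> fin_cases j <;>
      simp [hB, Matrix.conjTranspose_mul, hX, hQQ, ← Matrix.mul_assoc, hQXQ,
        Matrix.mul_assoc Q X X, hXX]
  have hrow : ∀ (Y : Matrix (Fin N) (Fin N) ℂ) (i : Fin 2) (k : Fin p) (n : Fin N),
      (W * Y) (i, k) n = (B i * Y) k n := fun Y i k n => by simp [hW, Matrix.mul_apply]
  refine ⟨p, W, ?_, ?_, ?_, ?_⟩
  · ext ⟨i, k⟩ ⟨j, l⟩
    have h1 : (W * Wᴴ) (i, k) (j, l) = (B i * (B j)ᴴ) k l := by simp [hW, Matrix.mul_apply]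
    rw [h1, hBB]
    by_cases hij : i = j
    · simp [hij, Matrix.one_apply]
    · simp [hij]
  · have h1 : Wᴴ * W = Qᴴ * Q + (Q * X)ᴴ * (Q * X) := by
      ext i j
      rw [Matrix.add_apply, Matrix.mul_apply, Matrix.mul_apply, Matrix.mul_apply,
        Fintype.sum_prod_type, Fin.sum_univ_two]
      rfl
    rw [h1, Matrix.conjTranspose_mul, hX, ← hEQ]
    have h2 : X * Qᴴ * (Q * X) = X * (Qᴴ * Q) * X := by simp only [Matrix.mul_assoc]
    rw [h2, ← hEQ, hXEX]
    abel
  · ext ⟨i, k⟩ n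
    rw [hrow]
    fin_cases i <;>
      simp [hB, hW, Matrix.mul_apply, Fintype.sum_prod_type, Fin.sum_univ_two, pauli,
        Matrix.one_apply, Matrix.kroneckerMap_apply]
    · have h1 : (Q * X) * X = Q := by rw [Matrix.mul_assoc, hXX, Matrix.mul_one]
      simpa [Matrix.mul_apply] using congrFun (congrFun h1 k) n
  · ext ⟨i, k⟩ n
    rw [hrow]
    fin_cases i <;>
      simp [hB, hW, Matrix.mul_apply, Fintype.sum_prod_type, Fin.sum_univ_two, pauli,
        Matrix.one_apply, Matrix.kroneckerMap_apply]
    · simpa [Matrix.mul_apply] using congrFun (congrFun hQZ k) n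
    · simpa [Matrix.mul_apply] using congrFun (congrFun hQXZ k) n

/-- A half turn multiplies `P i` and `A i` by the same sign, so their product is invariant under it.
-/
theorem Covariant.mul_comm_of_diagonal {n : Type*} [Fintype n] [DecidableEq n]
    {g : Matrix.SpecialLinearGroup (Fin 3) ℤ} {u : Matrix n n ℂ} {P A : Fin 3 → Matrix n n ℂ}
    (hP : Covariant g u P) (hA : Covariant g u A) (hu : uᴴ * u = 1) {s : Fin 3 → ℂ}
    (hs : ∀ i, s i * s i = 1) (hg : ∀ j i, spinOne g j i = if j = i then s i else 0) (i : Fin 3) :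
    u * (P i * A i) = P i * A i * u := by
  have h1 : ∀ {B : Fin 3 → Matrix n n ℂ}, Covariant g u B → u * B i = s i • (B i * u) := by
    intro B hB
    have h2 := hB i
    simp only [hg, ite_smul, zero_smul, Finset.sum_ite_eq', Finset.mem_univ, if_true] at h2
    rw [← Matrix.smul_mul, ← h2, Matrix.mul_assoc, hu, Matrix.mul_one]
  rw [← Matrix.mul_assoc, h1 hP, Matrix.smul_mul, Matrix.mul_assoc, h1 hA, Matrix.mul_smul,
    smul_smul, hs, one_smul, Matrix.mul_assoc]

/-- The virtual space of a ground state in the nontrivial phase is the tensor product of a protected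
qubit and a junk space. -/
theorem exists_isProtectedJunk {N : ℕ} {A : Fin 3 → Matrix (Fin N) (Fin N) ℂ}
    {U : octahedral → Matrix.unitaryGroup (Fin N) ℂ} (hA : IsSPTOState A U) :
    ∃ (D : ℕ) (W : Matrix (Fin 2 × Fin D) (Fin N) ℂ) (a : Fin 3 → Matrix (Fin D) (Fin D) ℂ),
      IsProtectedJunk A U W a := by
  obtain ⟨P, hPu, hPP, hanti, hP1, hcov, ⟨wX, hwX⟩, ⟨wZ, hwZ⟩⟩ := hA.exists_pauli
  have hPh : ∀ i, (P i)ᴴ = P i := fun i => by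
    calc (P i)ᴴ = (P i)ᴴ * (P i * P i) := by rw [hPP, Matrix.mul_one]
      _ = P i := by rw [← Matrix.mul_assoc, hPu, Matrix.one_mul]
  obtain ⟨D, W, hW1, hW2, hWX, hWZ⟩ :=
    exists_qubit_factor (hPh 0) (hPh 2) (hPP 0) (hPP 2) hanti
  have hunit : ∀ g : Matrix.unitaryGroup (Fin N) ℂ, g.1ᴴ * g.1 = 1 := fun g =>
    Matrix.mem_unitaryGroup_iff'.1 g.2
  have hWP : ∀ i, W * P i = (pauli i ⊗ₖ (1 : Matrix (Fin D) (Fin D) ℂ)) * W := by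
    intro i
    fin_cases i
    · exact hWX
    · show W * P 1 = _
      have h1 : pauli 1 = Complex.I • (pauli 0 * pauli 2) := by
        ext i j
        fin_cases i <;> fin_cases j <;> simp [pauli]
      rw [hP1, Matrix.mul_smul, ← Matrix.mul_assoc, hWX, Matrix.mul_assoc, hWZ, ← Matrix.mul_assoc,
        ← Matrix.mul_kronecker_mul, Matrix.one_mul, ← Matrix.smul_mul, ← Matrix.smul_kronecker,
        ← h1]
      rfl
    · exact hWZ
  have hPW : ∀ i, P i * Wᴴ = Wᴴ * (pauli i ⊗ₖ (1 : Matrix (Fin D) (Fin D) ℂ)) := by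
    intro i
    calc P i * Wᴴ = (Wᴴ * W) * P i * Wᴴ := by rw [hW2, Matrix.one_mul]
      _ = Wᴴ * (W * P i) * Wᴴ := by simp only [Matrix.mul_assoc]
      _ = Wᴴ * (pauli i ⊗ₖ (1 : Matrix (Fin D) (Fin D) ℂ)) * (W * Wᴴ) := by
        rw [hWP]; simp only [Matrix.mul_assoc]
      _ = _ := by rw [hW1, Matrix.mul_one]
  -- `P 0` and `P 2` are themselves multiples of the symmetry operations of half turns. Commuting
  -- with both confines `P i * A i` to the junk factor.
  have hcomm : ∀ i, P 0 * (P i * A i) = P i * A i * P 0 ∧ P 2 * (P i * A i) = P i * A i * P 2 := by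
    intro i
    have hX := Covariant.mul_comm_of_diagonal (hcov (octX * octX)) (hA.covariant (octX * octX))
      (hunit _) (s := ![1, -1, -1]) (by intro i; fin_cases i <;> simp)
      (by
        intro j i
        rw [Subgroup.coe_mul, spinOne_mul]
        fin_cases i <;> fin_cases j <;>
          simp [Matrix.mul_apply, Fin.sum_univ_three, spinOne, octX, rotX]) i
    have hZ := Covariant.mul_comm_of_diagonal (hcov (octZ * octZ)) (hA.covariant (octZ * octZ))
      (hunit _) (s := ![-1, -1, 1]) (by intro i; fin_cases i <;> simp)
      (by
        intro j i
        rw [Subgroup.coe_mul, spinOne_mul]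
        fin_cases i <;> fin_cases j <;>
          simp [Matrix.mul_apply, Fin.sum_univ_three, spinOne, octZ, rotZ]) i
    constructor
    · rw [hwX, Matrix.smul_mul, hX, Matrix.mul_smul]
    · rw [hwZ, Matrix.smul_mul, hZ, Matrix.mul_smul]
  have hjunk : ∀ Y : Matrix (Fin N) (Fin N) ℂ, P 0 * Y = Y * P 0 → P 2 * Y = Y * P 2 →
      ∃ y : Matrix (Fin D) (Fin D) ℂ, W * Y * Wᴴ = (1 : Matrix (Fin 2) (Fin 2) ℂ) ⊗ₖ y := by
    intro Y h0 h2
    have h : ∀ i, P i * Y = Y * P i → (pauli i ⊗ₖ (1 : Matrix (Fin D) (Fin D) ℂ)) * (W * Y * Wᴴ) =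
        W * Y * Wᴴ * (pauli i ⊗ₖ (1 : Matrix (Fin D) (Fin D) ℂ)) := by
      intro i hi
      calc (pauli i ⊗ₖ (1 : Matrix (Fin D) (Fin D) ℂ)) * (W * Y * Wᴴ) = (W * P i) * Y * Wᴴ := by
            rw [hWP]; simp only [Matrix.mul_assoc]
        _ = W * Y * (P i * Wᴴ) := by
          rw [Matrix.mul_assoc W, hi]; simp only [Matrix.mul_assoc]
        _ = _ := by rw [hPW]; simp only [Matrix.mul_assoc]
    exact ⟨_, eq_one_kronecker_of_commute (h 0 h0) (h 2 h2)⟩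
  choose a ha using fun i => hjunk (P i * A i) (hcomm i).1 (hcomm i).2
  refine ⟨D, W, a, hW1, hW2, fun μ => ?_, fun g => ?_⟩
  · calc W * A μ * Wᴴ = W * (P μ * P μ) * A μ * Wᴴ := by rw [hPP, Matrix.mul_one]
      _ = (W * P μ) * (P μ * A μ) * Wᴴ := by simp only [Matrix.mul_assoc]
      _ = (pauli μ ⊗ₖ (1 : Matrix (Fin D) (Fin D) ℂ)) * (W * (P μ * A μ) * Wᴴ) := by
        rw [hWP]; simp only [Matrix.mul_assoc]
      _ = _ := by
        rw [ha, ← Matrix.mul_kronecker_mul, Matrix.mul_one, Matrix.one_mul, withProtected]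
  · obtain ⟨S, hS⟩ := exists_covariant_pauli g
    have hS1 : S.1 * S.1ᴴ = 1 := Matrix.mem_unitaryGroup_iff.1 S.2
    have hS2 : S.1ᴴ * S.1 = 1 := Matrix.mem_unitaryGroup_iff'.1 S.2
    have hU1 : (U g).1 * (U g).1ᴴ = 1 := Matrix.mem_unitaryGroup_iff.1 (U g).2
    set M : Matrix (Fin 2 × Fin D) (Fin 2 × Fin D) ℂ := W * (U g).1 * Wᴴ with hM
    -- `T` undoes the qubit rotation; what remains of the symmetry operation commutes with the Pauli
    -- matrices and so acts on the junk space alone.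
    set T : Matrix (Fin 2 × Fin D) (Fin 2 × Fin D) ℂ :=
      S.1ᴴ ⊗ₖ (1 : Matrix (Fin D) (Fin D) ℂ) with hT
    have hMM : M * Mᴴ = 1 := by
      rw [hM, Matrix.conjTranspose_mul, Matrix.conjTranspose_mul, Matrix.conjTranspose_conjTranspose]
      calc W * (U g).1 * Wᴴ * (W * ((U g).1ᴴ * Wᴴ)) =
          W * (U g).1 * (Wᴴ * W) * (U g).1ᴴ * Wᴴ := by simp only [Matrix.mul_assoc]
        _ = W * ((U g).1 * (U g).1ᴴ) * Wᴴ := by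
          rw [hW2, Matrix.mul_one]; simp only [Matrix.mul_assoc]
        _ = 1 := by rw [hU1, Matrix.mul_one, hW1]
    have hMσ : ∀ i, M * (pauli i ⊗ₖ (1 : Matrix (Fin D) (Fin D) ℂ)) =
        ((S.1 * pauli i * S.1ᴴ) ⊗ₖ (1 : Matrix (Fin D) (Fin D) ℂ)) * M := by
      intro i
      have h1 : (U g).1 * P i = (∑ j, spinOne g.1 j i • P j) * (U g).1 := by
        rw [← hcov g i, Matrix.mul_assoc, hunit, Matrix.mul_one]
      have h2 : W * (∑ j, spinOne g.1 j i • P j) =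
          ((S.1 * pauli i * S.1ᴴ) ⊗ₖ (1 : Matrix (Fin D) (Fin D) ℂ)) * W := by
        rw [hS i, Fin.sum_univ_three, Fin.sum_univ_three]
        simp only [Matrix.mul_add, Matrix.add_kronecker, Matrix.add_mul, Matrix.mul_smul,
          Matrix.smul_kronecker, Matrix.smul_mul, hWP]
      calc M * (pauli i ⊗ₖ (1 : Matrix (Fin D) (Fin D) ℂ)) = W * ((U g).1 * P i) * Wᴴ := by
            rw [hM, Matrix.mul_assoc, ← hPW]; simp only [Matrix.mul_assoc]
        _ = W * (∑ j, spinOne g.1 j i • P j) * (U g).1 * Wᴴ := by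
          rw [h1]; simp only [Matrix.mul_assoc]
        _ = _ := by rw [h2, hM]; simp only [Matrix.mul_assoc]
    have hTM : ∀ i, (pauli i ⊗ₖ (1 : Matrix (Fin D) (Fin D) ℂ)) * (T * M) =
        T * M * (pauli i ⊗ₖ (1 : Matrix (Fin D) (Fin D) ℂ)) := by
      intro i
      rw [Matrix.mul_assoc T, hMσ, ← Matrix.mul_assoc _ T, ← Matrix.mul_assoc T, hT,
        ← Matrix.mul_kronecker_mul, ← Matrix.mul_kronecker_mul]
      congr 2
      calc pauli i * S.1ᴴ = (S.1ᴴ * S.1) * pauli i * S.1ᴴ := by rw [hS2, Matrix.one_mul]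
        _ = _ := by simp only [Matrix.mul_assoc]
    have hV := eq_one_kronecker_of_commute (hTM 0) (hTM 2)
    set V := (T * M).submatrix (fun k => ((0 : Fin 2), k)) (fun k => ((0 : Fin 2), k))
    have hMV : M = S.1 ⊗ₖ V := by
      calc M = (S.1 ⊗ₖ (1 : Matrix (Fin D) (Fin D) ℂ)) * (T * M) := by
            rw [← Matrix.mul_assoc, hT, ← Matrix.mul_kronecker_mul, hS1, Matrix.one_mul,
              Matrix.one_kronecker_one, Matrix.one_mul]
        _ = _ := by rw [hV, ← Matrix.mul_kronecker_mul, Matrix.mul_one, Matrix.one_mul]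
    have hVV : V * Vᴴ = 1 := by
      rw [hMV, Matrix.conjTranspose_kronecker, ← Matrix.mul_kronecker_mul, hS1,
        ← Matrix.one_kronecker_one] at hMM
      exact kronecker_one_injective hMM
    exact ⟨S, ⟨V, Matrix.mem_unitaryGroup_iff.2 hVV⟩, hS, hMV⟩

/-! ### String order of the fixed points -/

section FixedPoints

variable {N D d : ℕ} {A : Fin 3 → Matrix (Fin N) (Fin N) ℂ}
  {U : octahedral → Matrix.unitaryGroup (Fin N) ℂ} {W : Matrix (Fin 2 × Fin D) (Fin N) ℂ}
  {a b : Fin 3 → Matrix (Fin D) (Fin D) ℂ} {c : Fin 3 → Matrix (Fin d) (Fin d) ℂ}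
  {Λ : Matrix (Fin 2 × Fin d) (Fin 2 × Fin d) ℂ} {κ : Fin 3}

theorem IsRGFixedPoint.exists_canonicalForm (hb : IsRGFixedPoint a κ b)
    (hF : FiniteCorrelationLength (withProtected b)) :
    ∃ (d : ℕ) (c : Fin 3 → Matrix (Fin d) (Fin d) ℂ)
      (Λ : Matrix (Fin 2 × Fin d) (Fin 2 × Fin d) ℂ), IsCanonicalFormOf b c Λ := by
  obtain ⟨R, hR, hmix⟩ := exists_mixing_of_finiteCorrelationLength hb.1 hF
  obtain ⟨r, hr, hm⟩ := exists_junk_mixing hR hmix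
  exact exists_isCanonicalFormOf hr hm

theorem IsRGFixedPoint.isNormal (hb : IsRGFixedPoint a κ b)
    (hF : FiniteCorrelationLength (withProtected b)) (hc : IsCanonicalFormOf b c Λ) :
    IsNormal (withProtected c) Λ := by
  obtain ⟨R, hR, hmix⟩ := exists_mixing_of_finiteCorrelationLength hb.1 hF
  exact hc.isNormal hmix

/-- A quarter turn about the buffered axis exchanges the two other axes; its string order is maximal
exactly if the corresponding components of the fixed point agree. -/
theorem IsRGFixedPoint.exists_stringOrder (hA : IsSPTOState A U) (ha : IsProtectedJunk A U W a)
    (hb : IsRGFixedPoint a κ b) (hF : FiniteCorrelationLength (withProtected b))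
    (hc : IsCanonicalFormOf b c Λ) (g : octahedral) (s : Equiv.Perm (Fin 3)) (ε : Fin 3 → ℂ)
    (hε : ∀ i, ε i ≠ 0) (hg : ∀ j i, spinOne g.1 j i = if j = s i then ε i else 0)
    (h0 : s κ = κ) (h1 : s (κ + 1) = κ + 2) (h2 : s (κ + 2) = κ + 1)
    (hw : ∀ ν η, spinOne g.1 ν η • pauli η =
      if η = s ν then quarterTurn κ * pauli ν * (quarterTurn κ)ᴴ else 0) :
    ∃ o : ℝ, HasStringOrder c Λ g.1 o ∧ o ≤ 1 / 2 ∧ (o = 1 / 2 ↔ c (κ + 1) = c (κ + 2)) := by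
  have hN := hb.isNormal hF hc
  obtain ⟨R, hR, hmix⟩ := exists_mixing_of_finiteCorrelationLength hb.1 hF
  obtain ⟨r, -, hm⟩ := exists_junk_mixing hR hmix
  obtain ⟨l, hl, hΛ⟩ := hN.exists_junk
  obtain ⟨V₀, hV1, hV2, hVa⟩ := ha.exists_junk_unitary hA g s ε hε hg
  obtain ⟨V, hV, hV', hcV⟩ := hc.exists_unitary hm hl s
    fun w => hb.trace_wordProd_perm h0 hV1 hV2 hVa w
  obtain ⟨hle, heq⟩ := hl.norm_trace_mul_unitary_sq hV
  refine ⟨‖(l * V).trace‖ ^ 2 / 2, tendsto_stringExpectation hN hl.canonical.left_pos.1 hΛ hV hcV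
    (quarterTurn_mul_conjTranspose κ) (norm_trace_quarterTurn_sq κ) hw, by linarith, fun h => ?_,
    fun h => ?_⟩
  · have ht : ‖(l * V).trace‖ ^ 2 = 1 := by linarith
    have h3 := heq ht
    have h4 := hcV (κ + 1)
    have hne : (l * V).trace ≠ 0 := by intro h0; simp [h0] at ht
    rw [h1, h3, Matrix.mul_smul, Matrix.smul_mul, Matrix.mul_one, Matrix.one_mul] at h4
    exact (smul_right_injective _ hne h4).symm
  · have hs : ∀ i, c (s i) = c i := by
      intro i
      obtain rfl | rfl | rfl : i = κ ∨ i = κ + 1 ∨ i = κ + 2 :=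
        (by decide : ∀ κ i : Fin 3, i = κ ∨ i = κ + 1 ∨ i = κ + 2) κ i
      · rw [h0]
      · rw [h1, h]
      · rw [h2, h]
    -- If the transverse components agree, `V` commutes with all components and is fixed by the
    -- channel. Normality makes it scalar, and unitarity gives the scalar modulus one.
    have hfix : transfer c c V = V := by
      rw [transfer_apply]
      have : ∀ i, c i * V * (c i)ᴴ = V * (c i * (c i)ᴴ) := fun i => by
        rw [← Matrix.mul_assoc, ← hcV i, hs]
      rw [Finset.sum_congr rfl fun i _ => this i, ← Matrix.mul_sum, hl.canonical.right_fixed,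
        Matrix.mul_one]
    have hVt := hl.eq_smul_one hfix
    have hne := hl.canonical.nonempty
    set t := (l * V).trace with ht
    have h5 : ‖t‖ ^ 2 = 1 := by
      rw [hVt, Matrix.conjTranspose_smul, Matrix.conjTranspose_one, Matrix.smul_mul,
        Matrix.mul_smul, Matrix.mul_one, smul_smul] at hV
      obtain ⟨i⟩ := hne
      have h6 := congrFun (congrFun hV i) i
      simp only [Matrix.smul_apply, Matrix.one_apply_eq, smul_eq_mul, mul_one] at h6
      rw [Complex.star_def, Complex.mul_conj, Complex.normSq_eq_norm_sq] at h6
      exact_mod_cast h6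
    linarith

end FixedPoints

/-! ### From junk components to gates and rotations -/

/-- Every Euler decomposition of the generic gate has a generic `x` rotation and at least one
generic `z` rotation, and a single generic angle per axis already forces the transverse components
to agree. -/
theorem perfectGates_iff {dx dz : ℕ} {cx : Fin 3 → Matrix (Fin dx) (Fin dx) ℂ}
    {cz : Fin 3 → Matrix (Fin dz) (Fin dz) ℂ}
    {Λx : Matrix (Fin 2 × Fin dx) (Fin 2 × Fin dx) ℂ}
    {Λz : Matrix (Fin 2 × Fin dz) (Fin 2 × Fin dz) ℂ} (hx : IsNormal (withProtected cx) Λx)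
    (hz : IsNormal (withProtected cz) Λz) {ρx : Matrix (Fin dx) (Fin dx) ℂ}
    {ρz : Matrix (Fin dz) (Fin dz) ℂ} (hρx : ρx.PosDef) (hρz : ρz.PosDef) :
    PerfectGates cx ρx cz ρz ↔ cx 1 = cx 2 ∧ cz 0 = cz 1 := by
  constructor
  · intro h
    obtain ⟨G, hG, hgen⟩ := exists_generic_gate
    obtain ⟨α, β, γ, hGe, hα, hβ, hγ⟩ := h G hG
    obtain ⟨h1, h2⟩ := hgen α β γ hGe
    exact ⟨eq_of_perfectRotation (κ := 0) hρx h1 hβ,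
      h2.elim (fun h3 => eq_of_perfectRotation (κ := 2) hρz h3 hα)
        fun h3 => eq_of_perfectRotation (κ := 2) hρz h3 hγ⟩
  · rintro ⟨h1, h2⟩ G hG
    obtain ⟨α, β, γ, hGe⟩ := exists_euler_angles hG
    exact ⟨α, β, γ, hGe, perfectRotation_of_eq (κ := 2) hz hρz h2 α,
      perfectRotation_of_eq (κ := 0) hx hρx h1 β, perfectRotation_of_eq (κ := 2) hz hρz h2 γ⟩

theorem perfectRotations_iff {dx dz : ℕ} {cx : Fin 3 → Matrix (Fin dx) (Fin dx) ℂ}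
    {cz : Fin 3 → Matrix (Fin dz) (Fin dz) ℂ}
    {Λx : Matrix (Fin 2 × Fin dx) (Fin 2 × Fin dx) ℂ}
    {Λz : Matrix (Fin 2 × Fin dz) (Fin 2 × Fin dz) ℂ} (hx : IsNormal (withProtected cx) Λx)
    (hz : IsNormal (withProtected cz) Λz) {ρx : Matrix (Fin dx) (Fin dx) ℂ}
    {ρz : Matrix (Fin dz) (Fin dz) ℂ} (hρx : ρx.PosDef) (hρz : ρz.PosDef) :
    (∀ Θ, PerfectRotation cx ρx 0 Θ ∧ PerfectRotation cz ρz 2 Θ) ↔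
      cx 1 = cx 2 ∧ cz 0 = cz 1 := by
  constructor
  · intro h
    -- Any angle with `cos(Θ/2) sin(Θ/2) ≠ 0` would serve; a quarter turn is one.
    have hΘ : Real.cos (Real.pi / 2 / 2) * Real.sin (Real.pi / 2 / 2) ≠ 0 := by
      have : Real.pi / 2 / 2 = Real.pi / 4 := by ring
      rw [this, Real.cos_pi_div_four, Real.sin_pi_div_four]
      positivity
    exact ⟨eq_of_perfectRotation (κ := 0) hρx hΘ (h _).1,
      eq_of_perfectRotation (κ := 2) hρz hΘ (h _).2⟩
  · rintro ⟨h1, h2⟩ Θ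
    exact ⟨perfectRotation_of_eq (κ := 0) hx hρx h1 Θ, perfectRotation_of_eq (κ := 2) hz hρz h2 Θ⟩

theorem spinOne_rotX_apply (j i : Fin 3) :
    spinOne rotX j i = if j = Equiv.swap 1 2 i then (![1, 1, -1] : Fin 3 → ℂ) i else 0 := by
  have hs0 : Equiv.swap (1 : Fin 3) 2 0 = 0 := by decide
  have hs1 : Equiv.swap (1 : Fin 3) 2 1 = 2 := by decide
  have hs2 : Equiv.swap (1 : Fin 3) 2 2 = 1 := by decide
  fin_cases j <;> fin_cases i <;> simp [hs0, hs1, hs2, spinOne, rotX]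

theorem spinOne_rotZ_apply (j i : Fin 3) :
    spinOne rotZ j i = if j = Equiv.swap 0 1 i then (![1, -1, 1] : Fin 3 → ℂ) i else 0 := by
  have hs0 : Equiv.swap (0 : Fin 3) 1 0 = 1 := by decide
  have hs1 : Equiv.swap (0 : Fin 3) 1 1 = 0 := by decide
  have hs2 : Equiv.swap (0 : Fin 3) 1 2 = 2 := by decide
  fin_cases j <;> fin_cases i <;> simp [hs0, hs1, hs2, spinOne, rotZ]

end SPTO

end

theorem theorem2 {N : ℕ} (A : Fin 3 → Matrix (Fin N) (Fin N) ℂ)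
    (U : SPTO.octahedral → Matrix.unitaryGroup (Fin N) ℂ) (hA : SPTO.IsSPTOState A U) :
    (∃ (D : ℕ) (W : Matrix (Fin 2 × Fin D) (Fin N) ℂ) (a : Fin 3 → Matrix (Fin D) (Fin D) ℂ),
      SPTO.IsProtectedJunk A U W a) ∧
    ∀ (D : ℕ) (W : Matrix (Fin 2 × Fin D) (Fin N) ℂ) (a : Fin 3 → Matrix (Fin D) (Fin D) ℂ),
      SPTO.IsProtectedJunk A U W a →
    ∀ bx bz : Fin 3 → Matrix (Fin D) (Fin D) ℂ,
      SPTO.IsRGFixedPoint a 0 bx → SPTO.IsRGFixedPoint a 2 bz →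
      SPTO.FiniteCorrelationLength (SPTO.withProtected bx) →
      SPTO.FiniteCorrelationLength (SPTO.withProtected bz) →
    (∃ (dx : ℕ) (cx : Fin 3 → Matrix (Fin dx) (Fin dx) ℂ)
      (Λx : Matrix (Fin 2 × Fin dx) (Fin 2 × Fin dx) ℂ), SPTO.IsCanonicalFormOf bx cx Λx) ∧
    (∃ (dz : ℕ) (cz : Fin 3 → Matrix (Fin dz) (Fin dz) ℂ)
      (Λz : Matrix (Fin 2 × Fin dz) (Fin 2 × Fin dz) ℂ), SPTO.IsCanonicalFormOf bz cz Λz) ∧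
    ∀ (dx dz : ℕ) (cx : Fin 3 → Matrix (Fin dx) (Fin dx) ℂ)
      (cz : Fin 3 → Matrix (Fin dz) (Fin dz) ℂ)
      (Λx : Matrix (Fin 2 × Fin dx) (Fin 2 × Fin dx) ℂ)
      (Λz : Matrix (Fin 2 × Fin dz) (Fin 2 × Fin dz) ℂ),
      SPTO.IsCanonicalFormOf bx cx Λx → SPTO.IsCanonicalFormOf bz cz Λz →
    ∀ (ρx : Matrix (Fin dx) (Fin dx) ℂ) (ρz : Matrix (Fin dz) (Fin dz) ℂ),
      ρx.PosDef → ρx.trace = 1 → ρz.PosDef → ρz.trace = 1 →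
    ∃ ox oz : ℝ,
      SPTO.HasStringOrder cx Λx SPTO.rotX ox ∧ SPTO.HasStringOrder cz Λz SPTO.rotZ oz ∧
      ox ≤ 1 / 2 ∧ oz ≤ 1 / 2 ∧
      (SPTO.PerfectGates cx ρx cz ρz ↔ ox = 1 / 2 ∧ oz = 1 / 2) ∧
      ((∀ Θ : ℝ, SPTO.PerfectRotation cx ρx 0 Θ ∧ SPTO.PerfectRotation cz ρz 2 Θ) ↔
        ox = 1 / 2 ∧ oz = 1 / 2) ∧
      (ox = 1 / 2 ↔ cx 1 = cx 2) ∧ (oz = 1 / 2 ↔ cz 0 = cz 1) := by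
  refine ⟨SPTO.exists_isProtectedJunk hA, fun D W a ha bx bz hbx hbz hFx hFz =>
    ⟨hbx.exists_canonicalForm hFx, hbz.exists_canonicalForm hFz,
      fun dx dz cx cz Λx Λz hcx hcz ρx ρz hρx _ hρz _ => ?_⟩⟩
  have hNx := hbx.isNormal hFx hcx
  have hNz := hbz.isNormal hFz hcz
  obtain ⟨ox, hox, hlex, hiffx⟩ := hbx.exists_stringOrder hA ha hFx hcx
    ⟨SPTO.rotX, Subgroup.subset_closure (by simp)⟩ (Equiv.swap 1 2) ![1, 1, -1]
    (by intro i; fin_cases i <;> simp) SPTO.spinOne_rotX_apply (by decide) (by decide) (by decide)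
    SPTO.spinOne_rotX_smul_pauli
  obtain ⟨oz, hoz, hlez, hiffz⟩ := hbz.exists_stringOrder hA ha hFz hcz
    ⟨SPTO.rotZ, Subgroup.subset_closure (by simp)⟩ (Equiv.swap 0 1) ![1, -1, 1]
    (by intro i; fin_cases i <;> simp) SPTO.spinOne_rotZ_apply (by decide) (by decide) (by decide)
    SPTO.spinOne_rotZ_smul_pauli
  refine ⟨ox, oz, hox, hoz, hlex, hlez, ?_, ?_, hiffx, hiffz⟩
  · rw [hiffx, hiffz]
    exact SPTO.perfectGates_iff hNx hNz hρx hρz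
  · rw [hiffx, hiffz]
    exact SPTO.perfectRotations_iff hNx hNz hρx hρz
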